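/- **Setting.** A grammar with ownership is $G=(N,T,P)$ with finite disjoint sets $N$ (non-terminals) and $T$ (terminals), a finite set $P\subseteq N\times(N\cup T)^*$ of rules $X\to\eta$ such that every non-terminal has at least one rule, and a partition of $N$ into the non-terminals of two players, *refuter* and *prover*. Its size is $|G|=\sum_{(X\to\eta)\in P}(1+|\eta|)$. Positions are the sentential forms $\alpha\in(N\cup T)^*$; a move replaces the leftmost non-terminal $X$ by some $\eta$ with $X\to\eta$ in $P$, and the owner of $X$ chooses the rule. A maximal play is infinite or ends in a terminal word. Let $A=(T,Q,q_0,Q_F,\to)$ be a nondeterministic finite automaton. In the non-inclusion game, refuter wins a maximal play iff it is finite and ends in a word outside $L(A)$. A strategy of refuter maps every finite play that ends in a non-terminal position of refuter to a successor of that position; *refuter wins from $\alpha$* if she has a strategy such that she wins every maximal play from $\alpha$ that conforms to it. **CNF formulas.** A box is a relation $\rho\subseteq Q\times Q$; the box of a terminal $a$ is $\rho_a=\{(q,q'): q\xrightarrow{a}q'\}$, and $\mathrm{id}$ is the identity relation. A clause is a set of boxes (read as a disjunction), a CNF formula is a set of clauses (read as a conjunction). Put $\mathit{false}=\{\emptyset\}$,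 $F\wedge F'=F\cup F'$, $F\vee F'=\{K\cup H: K\in F, H\in F'\}$, and $$F;F'=\Big\{\bigcup_{\rho\in K}\{\rho;\tau : \tau\in z(\rho)\}\ :\ K\in F,\ z:K\to F'\Big\}.$$ A formula is *rejecting* if it is true under the assignment that makes exactly those boxes true that contain no pair $(q_0,q_f)$ with $q_f\in Q_F$. **Algorithm.** For formulas $\sigma_X$ ($X\in N$), extend $\sigma$ to sentential forms by $\sigma_\varepsilon=\{\{\mathrm{id}\}\}$, $\sigma_a=\{\{\rho_a\}\}$ for $a\in T$, and $\sigma_{\beta x}=\sigma_\beta;\sigma_x$ for a symbol $x$. (1) Let $\sigma^0_X=\mathit{false}$ for all $X$. (2) For $i=1,2,\dots$ let $\sigma^i_X=\bigwedge_{X\to\eta}\sigma^{i-1}_\eta$ if prover owns $X$ and $\sigma^i_X=\bigvee_{X\to\eta}\sigma^{i-1}_\eta$ if refuter owns $X$, until, for some $i=n\ge 1$, $\sigma^{n}_X$ and $\sigma^{n-1}_X$ are logically equivalent for all $X\in N$. (3) Return true iff $\sigma^n_\alpha$ is rejecting. **Theorem.** The algorithm terminates on every input $(G,A,\alpha)$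 and returns true iff refuter wins from $\alpha$. Moreover, a fixed explicit program that implements it on a unit-cost random access machine (with constants, array access, addition, truncated subtraction, comparisons, bitwise or, and bit test), with formulas stored as bit tables and the input written down under arbitrary numberings of $N$, $T$, $Q$ and $P$, ends with the formulas $\sigma^n_X$ ($X\in N$) and $\sigma^n_\alpha$ in its memory, outputs $1$ if refuter wins from $\alpha$ and $0$ otherwise, and runs in time $$O\Big(|G|^2\cdot 2^{2^{|Q|^{c_1}}}+|\alpha|\cdot 2^{2^{|Q|^{c_2}}}\Big)$$ for constants $c_1,c_2\in\mathbb N$. That is, there are $C,c_1,c_2\in\mathbb N$ such that for all $(G,A,\alpha)$ that satisfy $|G|+|\alpha|>0$ the number of steps is at most $C\big(|G|^2\, 2^{2^{|Q|^{c_1}}}+|\alpha|\, 2^{2^{|Q|^{c_2}}}\big)$. -/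

import Mathlib

namespace InclusionGame

/-! ## Grammars with ownership, arena, plays and strategies -/

/-- The two players: refuter wants to derive a word outside the language, prover wants inclusion. -/
inductive Player where
  | refuter
  | prover
  deriving DecidableEq

/-- A context-free grammar with an ownership partitioning of its non-terminals `N`. Symbols are
elements of `N ⊕ T`, sentential forms are lists of symbols. Every non-terminal has a rule. -/
structure Grammar (N T : Type) where
  own : N → Player
  rules : Finset (N × List (N ⊕ T))
  exists_rule : ∀ X, ∃ η, (X, η) ∈ rules

/-- The size of a grammar: every rule `X → η` contributes `1 + |η|`. -/
def Grammar.size {N T : Type} (G : Grammar N T) : ℕ :=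
  ∑ r ∈ G.rules, (1 + r.2.length)

/-- Left derivation: replace the leftmost non-terminal by a right-hand side. -/
def Grammar.Step {N T : Type} (G : Grammar N T) (α β : List (N ⊕ T)) : Prop :=
  ∃ (w : List T) (X : N) (γ η : List (N ⊕ T)),
    α = w.map Sum.inr ++ Sum.inl X :: γ ∧ (X, η) ∈ G.rules ∧ β = w.map Sum.inr ++ η ++ γ

/-- The owner of a sentential form is the owner of its leftmost non-terminal; terminal words are
owned by refuter. -/
def Grammar.turn {N T : Type} (G : Grammar N T) : List (N ⊕ T) → Player
  | [] => .refuter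
  | Sum.inl X :: _ => G.own X
  | Sum.inr _ :: γ => G.turn γ

/-- The sentential form is a terminal word. -/
def IsTerminal {N T : Type} (α : List (N ⊕ T)) : Prop := ∃ w : List T, α = w.map Sum.inr

/-- A finite or infinite sequence of positions. -/
inductive Play (N T : Type) where
  | fin (l : List (List (N ⊕ T)))
  | inf (p : ℕ → List (N ⊕ T))

/-- A finite play: a non-empty finite path in the arena, in chronological order. -/
def Grammar.IsFinitePlay {N T : Type} (G : Grammar N T) (l : List (List (N ⊕ T))) : Prop :=
  l ≠ [] ∧ ∀ (i : ℕ) (h : i + 1 < l.length), G.Step (l[i]) (l[i + 1])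

/-- Maximal plays starting in `α`: infinite paths, and finite paths ending in a terminal word. -/
def Grammar.IsMaximalPlayFrom {N T : Type} (G : Grammar N T) (α : List (N ⊕ T)) :
    Play N T → Prop
  | .fin l => G.IsFinitePlay l ∧ l.head? = some α ∧ ∃ β, l.getLast? = some β ∧ IsTerminal β
  | .inf p => p 0 = α ∧ ∀ i, G.Step (p i) (p (i + 1))

/-- A strategy for `pl` maps every non-maximal finite play whose last position belongs to `pl` to a
successor of this last position. -/
def Grammar.IsStrategy {N T : Type} (G : Grammar N T) (pl : Player)
    (s : List (List (N ⊕ T)) → List (N ⊕ T)) : Prop :=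
  ∀ l β, G.IsFinitePlay l → l.getLast? = some β → ¬ IsTerminal β → G.turn β = pl →
    G.Step β (s l)

/-- The play follows the strategy `s` of player `pl` whenever it is the turn of `pl`. -/
def Grammar.Conforms {N T : Type} (G : Grammar N T) (pl : Player)
    (s : List (List (N ⊕ T)) → List (N ⊕ T)) : Play N T → Prop
  | .fin l => ∀ (i : ℕ) (h : i + 1 < l.length), G.turn (l[i]) = pl →
      l[i + 1] = s (l.take (i + 1))
  | .inf p => ∀ i : ℕ, G.turn (p i) = pl → p (i + 1) = s ((List.range (i + 1)).map p)

/-- The non-inclusion winning condition (for maximal plays): the play is finite and ends in a word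
outside the language of the automaton. -/
def NonInclusion {N T Q : Type} (A : NFA T Q) : Play N T → Prop
  | .fin l => ∃ w : List T, l.getLast? = some (w.map Sum.inr) ∧ w ∉ A.accepts
  | .inf _ => False

/-- Refuter has a winning strategy for the non-inclusion game from position `α`. -/
def RefuterWins {N T Q : Type} (G : Grammar N T) (A : NFA T Q) (α : List (N ⊕ T)) : Prop :=
  ∃ s : List (List (N ⊕ T)) → List (N ⊕ T), G.IsStrategy .refuter s ∧
    ∀ p : Play N T, G.IsMaximalPlayFrom α p → G.Conforms .refuter s p → NonInclusion A p

/-! ## Formulas over the transition monoid in conjunctive normal form -/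

/-- Boxes: relations over the states. -/
abbrev Box (Q : Type) := Set (Q × Q)

/-- Clauses: disjunctions of boxes, written as sets. -/
abbrev Clause (Q : Type) := Set (Box Q)

/-- CNF formulas: conjunctions of clauses, written as sets. -/
abbrev CNF (Q : Type) := Set (Clause Q)

def boxId (Q : Type) : Box Q := {x | x.1 = x.2}

/-- Relational composition of boxes. -/
def boxComp {Q : Type} (ρ τ : Box Q) : Box Q :=
  {x | ∃ q, (x.1, q) ∈ ρ ∧ (q, x.2) ∈ τ}

/-- The box of a letter. -/
def letterBox {T Q : Type} (A : NFA T Q) (a : T) : Box Q := {x | x.2 ∈ A.step x.1 a}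

/-- `ν` is an assignment, given as the set of the boxes that are true. -/
def Sat {Q : Type} (ν : Set (Box Q)) (F : CNF Q) : Prop := ∀ K ∈ F, ∃ ρ ∈ K, ρ ∈ ν

/-- Logical equivalence. -/
def CNFEquiv {Q : Type} (F G : CNF Q) : Prop := ∀ ν : Set (Box Q), Sat ν F ↔ Sat ν G

/-- A formula is rejecting if it holds under the assignment that makes exactly those boxes true that
contain no pair of an initial and a final state. -/
def Rejecting {T Q : Type} (A : NFA T Q) (F : CNF Q) : Prop :=
  Sat {ρ : Box Q | ∀ q ∈ A.start, ∀ f ∈ A.accept, (q, f) ∉ ρ} F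

/-- The formula `false`: the CNF whose only clause is the empty one. -/
def cnfFalse (Q : Type) : CNF Q := {∅}

/-- Relational composition in CNF: for every clause `K` of `F` and every map `z` from the boxes of
`K` to clauses of `G`, the clause `⋃ ρ ∈ K, ρ ; z ρ`. -/
def cnfComp {Q : Type} (F G : CNF Q) : CNF Q :=
  {C | ∃ K ∈ F, ∃ z : Box Q → Clause Q, (∀ ρ ∈ K, z ρ ∈ G) ∧
    C = ⋃ ρ ∈ K, (fun τ => boxComp ρ τ) '' z ρ}

/-- Conjunction of a family of CNF formulas. -/
def cnfConj {Q I : Type} (S : Set I) (F : I → CNF Q) : CNF Q := ⋃ i ∈ S, F i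

/-- Disjunction of a family of CNF formulas, by distributivity: select a clause from every formula
and take the union. -/
def cnfDisj {Q I : Type} (S : Set I) (F : I → CNF Q) : CNF Q :=
  {C | ∃ c : I → Clause Q, (∀ i ∈ S, c i ∈ F i) ∧ C = ⋃ i ∈ S, c i}

/-- The formula of a symbol, given formulas `v` for the non-terminals. -/
def symFormula {N T Q : Type} (A : NFA T Q) (v : N → CNF Q) : N ⊕ T → CNF Q
  | Sum.inl X => v X
  | Sum.inr a => {{letterBox A a}}

/-- The formula of a sentential form: the composition of the formulas of its symbols. -/
def formFormula {N T Q : Type} (A : NFA T Q) (v : N → CNF Q) (α : List (N ⊕ T)) : CNF Q :=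
  α.foldl (fun F s => cnfComp F (symFormula A v s)) {{boxId Q}}

/-- The right-hand sides of the system of equations induced by the grammar and the automaton. -/
def equations {N T Q : Type} (G : Grammar N T) (A : NFA T Q) (v : N → CNF Q) (X : N) : CNF Q :=
  match G.own X with
  | .prover => cnfConj {η | (X, η) ∈ G.rules} (formFormula A v)
  | .refuter => cnfDisj {η | (X, η) ∈ G.rules} (formFormula A v)

/-- The Kleene approximants. -/
def approximant {N T Q : Type} (G : Grammar N T) (A : NFA T Q) : ℕ → N → CNF Q
  | 0 => fun _ => cnfFalse Q
  | i + 1 => equations G A (approximant G A i)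

/-- The Kleene iteration (do ... until) stops after iteration `n`: this is the first `i ≥ 1` for
which the approximants `i` and `i - 1` are logically equivalent for all non-terminals. -/
def StopsAt {N T Q : Type} (G : Grammar N T) (A : NFA T Q) (n : ℕ) : Prop :=
  IsLeast {i | 1 ≤ i ∧ ∀ X, CNFEquiv (approximant G A i X) (approximant G A (i - 1) X)} n

/-! ## A unit-cost random access machine

Finitely many registers and finitely many arrays hold natural numbers. The only operation that
produces numbers larger than its arguments is addition (and bitwise or, which adds no bits). -/

/-- Registers. The first five hold the input, `out` the output. -/
inductive Reg where
  | nQ | nN | nR | q0 | len | out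
  | sq | k | M | idb
  | i | m | base | ptr | bx
  | p1 | p2 | p3 | row1 | row2 | rho | tau | box | cl
  | K | H | J | s | j | hi | X | r | conv | fnd | bad
  deriving DecidableEq

/-- Arrays. The first seven hold the input. -/
inductive Arr where
  | delta | final | owner | lhs | start | sym | alpha
  | pow | acc | arg | part | tmp | res | cur | nxt
  deriving DecidableEq

/-- Expressions. -/
inductive Expr where
  | lit (n : ℕ)
  | reg (x : Reg)
  | read (a : Arr) (e : Expr)
  | add (e f : Expr)
  | sub (e f : Expr)
  | lor (e f : Expr)
  | bit (e f : Expr)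
  | lt (e f : Expr)
  | eq (e f : Expr)

/-- Commands. -/
inductive Cmd where
  | skip
  | set (x : Reg) (e : Expr)
  | store (a : Arr) (e f : Expr)
  | seq (c d : Cmd)
  | ite (e : Expr) (c d : Cmd)
  | loop (e : Expr) (c : Cmd)

/-- Machine states. -/
structure Store where
  reg : Reg → ℕ
  arr : Arr → ℕ → ℕ

/-- Values of expressions; truth values are `1` and `0`, and `bit e f` is bit number `f` of `e`. -/
def Expr.eval (σ : Store) : Expr → ℕ
  | .lit n => n
  | .reg x => σ.reg x
  | .read a e => σ.arr a (e.eval σ)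
  | .add e f => e.eval σ + f.eval σ
  | .sub e f => e.eval σ - f.eval σ
  | .lor e f => e.eval σ ||| f.eval σ
  | .bit e f => if (e.eval σ).testBit (f.eval σ) then 1 else 0
  | .lt e f => if e.eval σ < f.eval σ then 1 else 0
  | .eq e f => if e.eval σ = f.eval σ then 1 else 0

/-- Every node of an expression costs one step. -/
def Expr.cost : Expr → ℕ
  | .lit _ => 1
  | .reg _ => 1
  | .read _ e => e.cost + 1
  | .add e f => e.cost + f.cost + 1
  | .sub e f => e.cost + f.cost + 1
  | .lor e f => e.cost + f.cost + 1
  | .bit e f => e.cost + f.cost + 1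
  | .lt e f => e.cost + f.cost + 1
  | .eq e f => e.cost + f.cost + 1

def Store.setReg (σ : Store) (x : Reg) (v : ℕ) : Store :=
  { σ with reg := Function.update σ.reg x v }

def Store.setArr (σ : Store) (a : Arr) (i v : ℕ) : Store :=
  { σ with arr := Function.update σ.arr a (Function.update (σ.arr a) i v) }

/-- `Exec c σ σ' t`: started in `σ`, the command `c` halts in `σ'` after exactly `t` steps. -/
inductive Exec : Cmd → Store → Store → ℕ → Prop
  | skip (σ : Store) : Exec .skip σ σ 1
  | set (x : Reg) (e : Expr) (σ : Store) :
      Exec (.set x e) σ (σ.setReg x (e.eval σ)) (e.cost + 1)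
  | store (a : Arr) (e f : Expr) (σ : Store) :
      Exec (.store a e f) σ (σ.setArr a (e.eval σ) (f.eval σ)) (e.cost + f.cost + 1)
  | seq {c d : Cmd} {σ σ₁ σ₂ : Store} {t u : ℕ} :
      Exec c σ σ₁ t → Exec d σ₁ σ₂ u → Exec (.seq c d) σ σ₂ (t + u)
  | iteTrue {e : Expr} {c d : Cmd} {σ σ' : Store} {t : ℕ} :
      e.eval σ ≠ 0 → Exec c σ σ' t → Exec (.ite e c d) σ σ' (e.cost + 1 + t)
  | iteFalse {e : Expr} {c d : Cmd} {σ σ' : Store} {t : ℕ} :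
      e.eval σ = 0 → Exec d σ σ' t → Exec (.ite e c d) σ σ' (e.cost + 1 + t)
  | loopTrue {e : Expr} {c : Cmd} {σ σ₁ σ₂ : Store} {t u : ℕ} :
      e.eval σ ≠ 0 → Exec c σ σ₁ t → Exec (.loop e c) σ₁ σ₂ u →
        Exec (.loop e c) σ σ₂ (e.cost + 1 + t + u)
  | loopFalse {e : Expr} {c : Cmd} {σ : Store} :
      e.eval σ = 0 → Exec (.loop e c) σ σ (e.cost + 1)

/-- The machine is deterministic: final state and number of steps are unique. -/
theorem Exec.deterministic {c : Cmd} {σ σ₁ : Store} {t : ℕ} (h : Exec c σ σ₁ t) :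
    ∀ {σ₂ : Store} {u : ℕ}, Exec c σ σ₂ u → σ₁ = σ₂ ∧ t = u := by
  induction h with
  | skip => intro _ _ h'; cases h'; exact ⟨rfl, rfl⟩
  | set => intro _ _ h'; cases h'; exact ⟨rfl, rfl⟩
  | store => intro _ _ h'; cases h'; exact ⟨rfl, rfl⟩
  | seq _ _ ih₁ ih₂ =>
    intro _ _ h'
    cases h' with
    | seq h₁ h₂ =>
      obtain ⟨rfl, rfl⟩ := ih₁ h₁
      obtain ⟨rfl, rfl⟩ := ih₂ h₂
      exact ⟨rfl, rfl⟩
  | iteTrue he _ ih =>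
    intro _ _ h'
    cases h' with
    | iteTrue _ h₁ => obtain ⟨rfl, rfl⟩ := ih h₁; exact ⟨rfl, rfl⟩
    | iteFalse he' _ => exact absurd he' he
  | iteFalse he _ ih =>
    intro _ _ h'
    cases h' with
    | iteTrue he' _ => exact absurd he he'
    | iteFalse _ h₁ => obtain ⟨rfl, rfl⟩ := ih h₁; exact ⟨rfl, rfl⟩
  | loopTrue he _ _ ih₁ ih₂ =>
    intro _ _ h'
    cases h' with
    | loopTrue _ h₁ h₂ =>
      obtain ⟨rfl, rfl⟩ := ih₁ h₁
      obtain ⟨rfl, rfl⟩ := ih₂ h₂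
      exact ⟨rfl, rfl⟩
    | loopFalse he' => exact absurd he' he
  | loopFalse he =>
    intro _ _ h'
    cases h' with
    | loopTrue he' _ _ => exact absurd he he'
    | loopFalse _ => exact ⟨rfl, rfl⟩

/-! ## The algorithm as a program of the machine

With `q` states, a box is coded by a number below `2 ^ (q * q)` (bit `p * q + p'` tells whether the
box contains `(p, p')`), a clause by a number below `M = 2 ^ 2 ^ (q * q)` (bit `b` tells whether the
clause contains the box with code `b`), and a formula by `M` consecutive array cells
(cell `c` is `1` iff the clause with code `c` belongs to the formula, and `0` otherwise). -/

infixr:60 " ;; " => Cmd.seq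

/-- `for x = 0, ..., e - 1 do c` -/
def forTo (x : Reg) (e : Expr) (c : Cmd) : Cmd :=
  .set x (.lit 0) ;; .loop (.lt (.reg x) e) (c ;; .set x (.add (.reg x) (.lit 1)))

/-- `if e then c` -/
def when (e : Expr) (c : Cmd) : Cmd := .ite e c .skip

/-- `x := e * f` by repeated addition -/
def mulTo (x : Reg) (e f : Expr) : Cmd :=
  .set x (.lit 0) ;; forTo .m f (.set x (.add (.reg x) e))

/-- `a := {}` -/
def clearArr (a : Arr) : Cmd := forTo .i (.reg .M) (.store a (.reg .i) (.lit 0))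

/-- `a := b` -/
def copyArr (a b : Arr) : Cmd := forTo .i (.reg .M) (.store a (.reg .i) (.read b (.reg .i)))

/-- `a := ` the formula stored in `b` from address `base` on -/
def loadArr (a b : Arr) : Cmd :=
  forTo .i (.reg .M) (.store a (.reg .i) (.read b (.add (.reg .base) (.reg .i))))

/-- store the formula `a` in `b` from address `base` on -/
def saveArr (b a : Arr) : Cmd :=
  forTo .i (.reg .M) (.store b (.add (.reg .base) (.reg .i)) (.read a (.reg .i)))

/-- `sq := q * q`, `k := 2 ^ sq` (number of boxes), `M := 2 ^ k` (number of clauses), a table of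
the powers of two up to `M`, and the code `idb` of the identity box -/
def setup : Cmd :=
  mulTo .sq (.reg .nQ) (.reg .nQ) ;;
  .store .pow (.lit 0) (.lit 1) ;;
  forTo .i (.reg .sq) (.store .pow (.add (.reg .i) (.lit 1))
    (.add (.read .pow (.reg .i)) (.read .pow (.reg .i)))) ;;
  .set .k (.read .pow (.reg .sq)) ;;
  forTo .i (.reg .k) (.store .pow (.add (.reg .i) (.lit 1))
    (.add (.read .pow (.reg .i)) (.read .pow (.reg .i)))) ;;
  .set .M (.read .pow (.reg .k)) ;;
  .set .idb (.lit 0) ;;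
  .set .row1 (.lit 0) ;;
  forTo .p1 (.reg .nQ) (
    .set .idb (.lor (.reg .idb) (.read .pow (.add (.reg .row1) (.reg .p1)))) ;;
    .set .row1 (.add (.reg .row1) (.reg .nQ)))

/-- composition of boxes: `box := rho ; tau` -/
def boxCompCmd : Cmd :=
  .set .box (.lit 0) ;;
  .set .row1 (.lit 0) ;;
  forTo .p1 (.reg .nQ) (
    .set .row2 (.lit 0) ;;
    forTo .p2 (.reg .nQ) (
      when (.bit (.reg .rho) (.add (.reg .row1) (.reg .p2)))
        (forTo .p3 (.reg .nQ)
          (when (.bit (.reg .tau) (.add (.reg .row2) (.reg .p3)))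
            (.set .box (.lor (.reg .box) (.read .pow (.add (.reg .row1) (.reg .p3))))))) ;;
      .set .row2 (.add (.reg .row2) (.reg .nQ))) ;;
    .set .row1 (.add (.reg .row1) (.reg .nQ)))

/-- composition of a box with a clause: `cl := rho ; H` -/
def prefixCmd : Cmd :=
  .set .cl (.lit 0) ;;
  forTo .tau (.reg .k)
    (when (.bit (.reg .H) (.reg .tau))
      (boxCompCmd ;; .set .cl (.lor (.reg .cl) (.read .pow (.reg .box)))))

/-- conjunction: `acc := acc ∧ arg` -/
def conjCmd : Cmd :=
  forTo .H (.reg .M) (when (.read .arg (.reg .H)) (.store .acc (.reg .H) (.lit 1)))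

/-- disjunction: `acc := acc ∨ arg` -/
def disjCmd : Cmd :=
  clearArr .tmp ;;
  forTo .K (.reg .M) (when (.read .acc (.reg .K))
    (forTo .H (.reg .M) (when (.read .arg (.reg .H))
      (.store .tmp (.lor (.reg .K) (.reg .H)) (.lit 1))))) ;;
  copyArr .acc .tmp

/-- relational composition: `acc := acc ; arg`. For every clause `K` of `acc`, `part` runs from
`{{}}` through the boxes `rho` of `K` to the set of all clauses `⋃ rho ∈ K, rho ; z rho`. -/
def compCmd : Cmd :=
  clearArr .res ;;
  forTo .K (.reg .M) (when (.read .acc (.reg .K)) (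
    clearArr .part ;;
    .store .part (.lit 0) (.lit 1) ;;
    forTo .rho (.reg .k) (when (.bit (.reg .K) (.reg .rho)) (
      clearArr .tmp ;;
      forTo .H (.reg .M) (when (.read .arg (.reg .H)) (
        prefixCmd ;;
        forTo .J (.reg .M) (when (.read .part (.reg .J))
          (.store .tmp (.lor (.reg .J) (.reg .cl)) (.lit 1))))) ;;
      copyArr .part .tmp)) ;;
    forTo .J (.reg .M) (when (.read .part (.reg .J)) (.store .res (.reg .J) (.lit 1))))) ;;
  copyArr .acc .res

/-- `arg := ` the formula of the symbol `s`: the current approximant of a non-terminal, or the box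
of a letter, which is read off the transition table -/
def symCmd : Cmd :=
  .ite (.lt (.reg .s) (.reg .nN))
    (mulTo .base (.reg .s) (.reg .M) ;; loadArr .arg .cur)
    (clearArr .arg ;;
      mulTo .ptr (.sub (.reg .s) (.reg .nN)) (.reg .sq) ;;
      .set .bx (.lit 0) ;;
      forTo .i (.reg .sq)
        (when (.read .delta (.add (.reg .ptr) (.reg .i)))
          (.set .bx (.lor (.reg .bx) (.read .pow (.reg .i))))) ;;
      .store .arg (.read .pow (.reg .bx)) (.lit 1))

/-- `acc := ` the formula of the sentential form in the cells `j, ..., hi - 1` of array `a` -/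
def formCmd (a : Arr) : Cmd :=
  clearArr .acc ;;
  .store .acc (.read .pow (.reg .idb)) (.lit 1) ;;
  .loop (.lt (.reg .j) (.reg .hi)) (
    .set .s (.read a (.reg .j)) ;;
    symCmd ;;
    compCmd ;;
    .set .j (.add (.reg .j) (.lit 1)))

/-- all non-terminals: `cur := false` -/
def initCmd : Cmd :=
  .set .base (.lit 0) ;;
  forTo .X (.reg .nN) (
    forTo .i (.reg .M) (.store .cur (.add (.reg .base) (.reg .i)) (.lit 0)) ;;
    .store .cur (.reg .base) (.lit 1) ;;
    .set .base (.add (.reg .base) (.reg .M)))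

/-- `nxt := f(cur)`: start with the empty conjunction or disjunction for every non-terminal, then
add the rules one by one -/
def equationsCmd : Cmd :=
  .set .base (.lit 0) ;;
  forTo .X (.reg .nN) (
    forTo .i (.reg .M) (.store .nxt (.add (.reg .base) (.reg .i)) (.lit 0)) ;;
    .ite (.read .owner (.reg .X)) .skip (.store .nxt (.reg .base) (.lit 1)) ;;
    .set .base (.add (.reg .base) (.reg .M))) ;;
  forTo .r (.reg .nR) (
    .set .j (.read .start (.reg .r)) ;;
    .set .hi (.read .start (.add (.reg .r) (.lit 1))) ;;
    formCmd .sym ;;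
    copyArr .arg .acc ;;
    .set .X (.read .lhs (.reg .r)) ;;
    mulTo .base (.reg .X) (.reg .M) ;;
    loadArr .acc .nxt ;;
    .ite (.read .owner (.reg .X)) conjCmd disjCmd ;;
    saveArr .nxt .acc)

/-- `conv := 0` unless the formula in `a` implies the one in `b` (both from address `base` on),
that is, unless every clause of `b` has a subset among the clauses of `a` -/
def impliesCmd (a b : Arr) : Cmd :=
  forTo .H (.reg .M) (when (.read b (.add (.reg .base) (.reg .H))) (
    .set .fnd (.lit 0) ;;
    forTo .K (.reg .M) (when (.read a (.add (.reg .base) (.reg .K)))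
      (when (.eq (.lor (.reg .K) (.reg .H)) (.reg .H)) (.set .fnd (.lit 1)))) ;;
    .ite (.reg .fnd) .skip (.set .conv (.lit 0))))

/-- `conv := ` whether `cur` and `nxt` are equivalent for all non-terminals; then `cur := nxt` -/
def compareCmd : Cmd :=
  .set .conv (.lit 1) ;;
  .set .base (.lit 0) ;;
  forTo .X (.reg .nN) (
    impliesCmd .cur .nxt ;;
    impliesCmd .nxt .cur ;;
    forTo .i (.reg .M) (.store .cur (.add (.reg .base) (.reg .i))
      (.read .nxt (.add (.reg .base) (.reg .i)))) ;;
    .set .base (.add (.reg .base) (.reg .M)))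

/-- `out := ` whether `acc` is rejecting: every clause `K` of `acc` contains a box `rho` without
a pair of the initial state and a final state -/
def rejectCmd : Cmd :=
  mulTo .row1 (.reg .q0) (.reg .nQ) ;;
  .set .out (.lit 1) ;;
  forTo .K (.reg .M) (when (.read .acc (.reg .K)) (
    .set .fnd (.lit 0) ;;
    forTo .rho (.reg .k) (when (.bit (.reg .K) (.reg .rho)) (
      .set .bad (.lit 0) ;;
      forTo .p1 (.reg .nQ) (when (.read .final (.reg .p1))
        (when (.bit (.reg .rho) (.add (.reg .row1) (.reg .p1))) (.set .bad (.lit 1)))) ;;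
      .ite (.reg .bad) .skip (.set .fnd (.lit 1)))) ;;
    .ite (.reg .fnd) .skip (.set .out (.lit 0))))

/-- The algorithm: (1) start with `false` for all non-terminals, (2) iterate `f` until two
successive approximants are equivalent, (3) compute the formula of the initial position and
test whether it is rejecting. -/
def kleeneProgram : Cmd :=
  setup ;;
  initCmd ;;
  .set .conv (.lit 0) ;;
  .loop (.eq (.reg .conv) (.lit 0)) (equationsCmd ;; compareCmd) ;;
  .set .j (.lit 0) ;;
  .set .hi (.reg .len) ;;
  formCmd .alpha ;;
  rejectCmd

/-! ## The input of the program -/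

/-- A way to write down a grammar and a finite automaton: numberings of non-terminals, terminals
and states, and a list of the rules without repetitions. -/
structure Presentation {N T : Type} [Fintype N] [Fintype T] (G : Grammar N T)
    (Q : Type) [Fintype Q] where
  eN : N ≃ Fin (Fintype.card N)
  eT : T ≃ Fin (Fintype.card T)
  eQ : Q ≃ Fin (Fintype.card Q)
  prods : List (N × List (N ⊕ T))
  nodup : prods.Nodup
  mem_prods : ∀ r, r ∈ prods ↔ r ∈ G.rules

section

variable {N T Q : Type} [Fintype N] [Fintype T] [Fintype Q] {G : Grammar N T}

/-- The code of a symbol: non-terminals come first, then the terminals. -/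
def Presentation.symCode (P : Presentation G Q) : N ⊕ T → ℕ
  | Sum.inl X => (P.eN X : ℕ)
  | Sum.inr a => Fintype.card N + (P.eT a : ℕ)

open Classical in
/-- The initial state of the machine. Transition table, final states and owners are given bit by
bit; the right-hand sides of the rules are written one after the other into `sym`, that of rule `r`
starting in cell `start r`. Everything that is not input is zero. -/
noncomputable def Presentation.input (P : Presentation G Q) (A : NFA T Q) (q₀ : Q)
    (α : List (N ⊕ T)) : Store where
  reg := fun x => match x with
    | .nQ => Fintype.card Q
    | .nN => Fintype.card N
    | .nR => P.prods.length
    | .q0 => (P.eQ q₀ : ℕ)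
    | .len => α.length
    | _ => 0
  arr := fun a i => match a with
    | .delta => if ∃ (a : T) (p p' : Q), p' ∈ A.step p a ∧
        i = ((P.eT a : ℕ) * Fintype.card Q + (P.eQ p : ℕ)) * Fintype.card Q + (P.eQ p' : ℕ)
        then 1 else 0
    | .final => if ∃ p : Q, p ∈ A.accept ∧ i = (P.eQ p : ℕ) then 1 else 0
    | .owner => if ∃ X : N, G.own X = .prover ∧ i = (P.eN X : ℕ) then 1 else 0
    | .lhs => (P.prods.map fun r => (P.eN r.1 : ℕ)).getD i 0
    | .start => ((P.prods.take i).map fun r => r.2.length).sum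
    | .sym => ((P.prods.flatMap fun r => r.2).map P.symCode).getD i 0
    | .alpha => (α.map P.symCode).getD i 0
    | _ => 0

/-- The box with a given code. -/
def Presentation.boxOf (P : Presentation G Q) (b : ℕ) : Box Q :=
  {x | b.testBit ((P.eQ x.1 : ℕ) * Fintype.card Q + (P.eQ x.2 : ℕ)) = true}

/-- The clause with a given code. -/
def Presentation.clauseOf (P : Presentation G Q) (c : ℕ) : Clause Q :=
  {ρ | ∃ b < 2 ^ (Fintype.card Q * Fintype.card Q), c.testBit b = true ∧ P.boxOf b = ρ}

/-- The CNF formula stored in an array from address `base` on. -/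
def Presentation.formulaOf (P : Presentation G Q) (a : ℕ → ℕ) (base : ℕ) : CNF Q :=
  {K | ∃ c < 2 ^ 2 ^ (Fintype.card Q * Fintype.card Q), a (base + c) = 1 ∧ P.clauseOf c = K}

end

end InclusionGame

open InclusionGame

namespace InclusionGame

/-! ## Semantics of the operations on formulas -/

/-! Read an assignment as the set of boxes that refuter accepts as the outcome of a derivation.
Formulas contain no negation, so satisfaction is monotone. Conjunction is a choice of prover and
disjunction a choice of refuter. By `sat_cnfComp`, satisfying `F;G` means to play `F` up to some box
`ρ` and then to play `G` with those boxes `τ` as target for which `ρ;τ` is accepted. Since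
derivations are leftmost, a sentential form is played in exactly this way, symbol by symbol.

Let `Win` be the inductive predicate that refuter can force a word with an accepted box.
Satisfaction at any Kleene stage implies `Win` (`win_of_sat_approximant`). Conversely `Win` is the
least predicate closed under its rules, and satisfaction in any solution of the equations is closed
under them (`Win.sat`). The stages increase, and up to equivalence there are only finitely many
formulas, so the iteration becomes stationary (`exists_stopsAt`). The stage where it stops solves
the equations, hence describes `Win` exactly (`rejecting_iff_win`).

`Win` agrees with the existence of a winning strategy (`refuterWins_iff_win`). As there are finitely
many rules, a position in `Win` has a finite rank that refuter can decrease. Outside `Win`, prover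
can keep the play outside forever.

The program is verified by total-correctness triples with time bounds and frame conditions. Loops
over states, boxes and clauses run at most `M = numClauses Q` times, so their cost is a polynomial
in `M` whose degree depends on the program only. Loops over non-terminals, rules, symbols and Kleene
rounds are counted separately. A round costs `|G|` and the final formula `|α|`, up to such a
polynomial, and there are at most `|N| * M + 1` rounds. Powers of `M` are absorbed by a double
exponential (`numClauses_pow_le`). -/

theorem Sat.mono {Q : Type} {ν ν' : Set (Box Q)} (h : ν ⊆ ν') {F : CNF Q} (hF : Sat ν F) :
    Sat ν' F := fun K hK => by
  obtain ⟨ρ, h₁, h₂⟩ := hF K hK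
  exact ⟨ρ, h₁, h h₂⟩

/-- The map `z` in `cnfComp` acts as a Skolem function: if every box of a clause `K` admits a
failing clause of `G`, selecting these clauses gives a failing clause of the composition. Later
semantic arguments use this nested form and never look at clauses of a composition again. -/
theorem sat_cnfComp {Q : Type} (ν : Set (Box Q)) (F G : CNF Q) :
    Sat ν (cnfComp F G) ↔ Sat {ρ | Sat {τ | boxComp ρ τ ∈ ν} G} F := by
  constructor
  · intro h K hK
    by_contra! hc
    have hc' : ∀ ρ, ∃ H, ρ ∈ K → H ∈ G ∧ ∀ τ ∈ H, boxComp ρ τ ∉ ν := by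
      intro ρ
      by_cases hρ : ρ ∈ K
      · have := hc ρ hρ
        simp only [Sat, Set.mem_ofPred_eq] at this
        push Not at this
        obtain ⟨H, h₁, h₂⟩ := this
        exact ⟨H, fun _ => ⟨h₁, h₂⟩⟩
      -- Outside `K` the value of `z` is irrelevant; the empty clause is a dummy and need not belong
      -- to `G`.
      · exact ⟨∅, fun h => absurd h hρ⟩
    choose z hz using hc'
    obtain ⟨β, hβ, hν⟩ := h _ ⟨K, hK, z, fun ρ hρ => (hz ρ hρ).1, rfl⟩
    simp only [Set.mem_iUnion, Set.mem_image] at hβ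
    obtain ⟨ρ, hρ, τ, hτ, rfl⟩ := hβ
    exact (hz ρ hρ).2 τ hτ hν
  · rintro h C ⟨K, hK, z, hz, rfl⟩
    obtain ⟨ρ, hρ, hs⟩ := h K hK
    obtain ⟨τ, hτ, hν⟩ := hs (z ρ) (hz ρ hρ)
    exact ⟨boxComp ρ τ, by simp only [Set.mem_iUnion, Set.mem_image]; exact ⟨ρ, hρ, τ, hτ, rfl⟩, hν⟩

theorem sat_cnfConj {Q I : Type} (ν : Set (Box Q)) (S : Set I) (F : I → CNF Q) :
    Sat ν (cnfConj S F) ↔ ∀ i ∈ S, Sat ν (F i) := by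
  simp only [Sat, cnfConj, Set.mem_iUnion]
  exact ⟨fun h i hi K hK => h K ⟨i, hi, hK⟩, fun h K ⟨i, hi, hK⟩ => h i hi K hK⟩

/-- Distributivity, by the same selection argument: if all disjuncts fail, the union of one failing
clause from each fails as well. The index set may be infinite. -/
theorem sat_cnfDisj {Q I : Type} (ν : Set (Box Q)) (S : Set I) (F : I → CNF Q) :
    Sat ν (cnfDisj S F) ↔ ∃ i ∈ S, Sat ν (F i) := by
  constructor
  · intro h
    by_contra! hc
    have hc' : ∀ i, ∃ H, i ∈ S → H ∈ F i ∧ ∀ τ ∈ H, τ ∉ ν := by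
      intro i
      by_cases hi : i ∈ S
      · have := hc i hi
        simp only [Sat] at this
        push Not at this
        obtain ⟨H, h₁, h₂⟩ := this
        exact ⟨H, fun _ => ⟨h₁, h₂⟩⟩
      · exact ⟨∅, fun h => absurd h hi⟩
    choose z hz using hc'
    obtain ⟨β, hβ, hν⟩ := h _ ⟨z, fun i hi => (hz i hi).1, rfl⟩
    simp only [Set.mem_iUnion] at hβ
    obtain ⟨i, hi, hβ⟩ := hβ
    exact (hz i hi).2 β hβ hν
  · rintro ⟨i, hi, h⟩ C ⟨c, hc, rfl⟩
    obtain ⟨ρ, hρ, hs⟩ := h _ (hc i hi)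
    exact ⟨ρ, Set.mem_biUnion hi hρ, hs⟩

theorem sat_singleton {Q : Type} (ν : Set (Box Q)) (ρ : Box Q) : Sat ν {{ρ}} ↔ ρ ∈ ν := by
  simp [Sat]

theorem boxComp_assoc {Q : Type} (ρ σ τ : Box Q) :
    boxComp (boxComp ρ σ) τ = boxComp ρ (boxComp σ τ) := by
  ext x
  simp only [boxComp, Set.mem_ofPred_eq]
  exact ⟨fun ⟨q, ⟨r, h₁, h₂⟩, h₃⟩ => ⟨r, h₁, q, h₂, h₃⟩,
    fun ⟨r, h₁, q, h₂, h₃⟩ => ⟨q, ⟨r, h₁, h₂⟩, h₃⟩⟩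

theorem boxId_comp {Q : Type} (ρ : Box Q) : boxComp (boxId Q) ρ = ρ := by
  ext ⟨a, b⟩; simp [boxComp, boxId]

theorem boxComp_id {Q : Type} (ρ : Box Q) : boxComp ρ (boxId Q) = ρ := by
  ext ⟨a, b⟩; simp [boxComp, boxId]

/-! ### Formulas of words and sentential forms -/

section

variable {N T Q : Type} {G : Grammar N T} {A : NFA T Q}

/-- The box of a word. -/
def wordBox (A : NFA T Q) (w : List T) : Box Q :=
  w.foldr (fun a ρ => boxComp (letterBox A a) ρ) (boxId Q)

theorem wordBox_append (u v : List T) :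
    wordBox A (u ++ v) = boxComp (wordBox A u) (wordBox A v) := by
  induction u with
  | nil => simp [wordBox, boxId_comp]
  | cons a u ih =>
    have h : ∀ w, wordBox A (a :: w) = boxComp (letterBox A a) (wordBox A w) := fun _ => rfl
    rw [List.cons_append, h, h, ih, boxComp_assoc]

theorem formFormula_append_singleton (v : N → CNF Q) (α : List (N ⊕ T)) (s : N ⊕ T) :
    formFormula A v (α ++ [s]) = cnfComp (formFormula A v α) (symFormula A v s) := by
  simp [formFormula]

/-- Composition is bracketed to the left, yet a form may be split anywhere: associativity of boxes
carries over to satisfaction. The induction takes symbols off the right end, where `foldl` appends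
them. -/
theorem sat_formFormula_append (v : N → CNF Q) (α β : List (N ⊕ T)) (ν : Set (Box Q)) :
    Sat ν (formFormula A v (α ++ β)) ↔
      Sat {ρ | Sat {τ | boxComp ρ τ ∈ ν} (formFormula A v β)} (formFormula A v α) := by
  induction β using List.reverseRecOn generalizing ν with
  | nil =>
    have : formFormula A v [] = {{boxId Q}} := rfl
    simp [this, sat_singleton, boxComp_id]
  | append_singleton β s ih =>
    rw [← List.append_assoc, formFormula_append_singleton, sat_cnfComp, ih]
    simp only [formFormula_append_singleton, sat_cnfComp, Set.mem_ofPred_eq, boxComp_assoc]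

theorem sat_formFormula_singleton (v : N → CNF Q) (s : N ⊕ T) (ν : Set (Box Q)) :
    Sat ν (formFormula A v [s]) ↔ Sat ν (symFormula A v s) := by
  have : formFormula A v [s] = cnfComp {{boxId Q}} (symFormula A v s) := rfl
  simp [this, sat_cnfComp, sat_singleton, boxId_comp]

theorem sat_formFormula_word (v : N → CNF Q) (w : List T) (ν : Set (Box Q)) :
    Sat ν (formFormula A v (w.map Sum.inr)) ↔ wordBox A w ∈ ν := by
  induction w using List.reverseRecOn generalizing ν with
  | nil => exact sat_singleton _ _
  | append_singleton w a ih =>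
    rw [List.map_append, sat_formFormula_append, ih, wordBox_append]
    change Sat _ (formFormula A v [Sum.inr a]) ↔ _
    rw [sat_formFormula_singleton]
    simp [symFormula, sat_singleton, wordBox, boxComp_id]

/-- Monotonicity is inherited from `Sat.mono`: in the nested reading of composition, a weaker
formula for a symbol enlarges the assignment used for the prefix. -/
theorem sat_formFormula_mono {v v' : N → CNF Q} (h : ∀ X ν, Sat ν (v X) → Sat ν (v' X))
    (α : List (N ⊕ T)) (ν : Set (Box Q)) (hs : Sat ν (formFormula A v α)) :
    Sat ν (formFormula A v' α) := by
  induction α using List.reverseRecOn generalizing ν with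
  | nil => exact hs
  | append_singleton α s ih =>
    rw [formFormula_append_singleton, sat_cnfComp] at hs ⊢
    refine (ih _ hs).mono fun ρ hρ => ?_
    cases s with
    | inl X => exact h X _ hρ
    | inr a => exact hρ

/-- The right-hand side of an equation, read semantically, is one move of the game: all rules for
prover, some rule for refuter. -/
theorem sat_equations (v : N → CNF Q) (X : N) (ν : Set (Box Q)) :
    Sat ν (equations G A v X) ↔
      (G.own X = .prover ∧ ∀ η, (X, η) ∈ G.rules → Sat ν (formFormula A v η)) ∨
      (G.own X = .refuter ∧ ∃ η, (X, η) ∈ G.rules ∧ Sat ν (formFormula A v η)) := by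
  unfold equations
  cases h : G.own X <;> simp [sat_cnfConj, sat_cnfDisj]

theorem sat_equations_mono {v v' : N → CNF Q} (h : ∀ X ν, Sat ν (v X) → Sat ν (v' X))
    (X : N) (ν : Set (Box Q)) (hs : Sat ν (equations G A v X)) :
    Sat ν (equations G A v' X) := by
  rw [sat_equations] at hs ⊢
  rcases hs with ⟨h₁, h₂⟩ | ⟨h₁, η, h₂, h₃⟩
  · exact .inl ⟨h₁, fun η hη => sat_formFormula_mono h _ _ (h₂ η hη)⟩
  · exact .inr ⟨h₁, η, h₂, sat_formFormula_mono h _ _ h₃⟩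

theorem not_sat_cnfFalse (ν : Set (Box Q)) : ¬ Sat ν (cnfFalse Q) := by
  simp [Sat, cnfFalse]

/-- The chain starts at `false`, which no assignment satisfies, and monotonicity of the equations
propagates the first inclusion. -/
theorem sat_approximant_succ (i : ℕ) : ∀ (X : N) (ν : Set (Box Q)),
    Sat ν (approximant G A i X) → Sat ν (approximant G A (i + 1) X) := by
  induction i with
  | zero => exact fun X ν h => absurd h (not_sat_cnfFalse ν)
  | succ i ih => exact sat_equations_mono ih

/-- The iteration becomes stationary within a number of rounds bounded by the number of pairs of a
non-terminal and an assignment. -/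
theorem exists_stopsAt [Fintype N] [Fintype Q] (G : Grammar N T) (A : NFA T Q) :
    ∃ n, StopsAt G A n ∧
      n ≤ Fintype.card N * 2 ^ 2 ^ (Fintype.card Q * Fintype.card Q) + 1 := by
  classical
  -- Up to equivalence, a stage is this subset of a finite set, and the stopping condition is
  -- equality of two consecutive subsets.
  let S : ℕ → Set (N × Set (Box Q)) := fun i => {x | Sat x.2 (approximant G A i x.1)}
  have hS : ∀ i, S i ⊆ S (i + 1) := fun i x hx => sat_approximant_succ i x.1 x.2 hx
  have hcard : Nat.card (N × Set (Box Q)) =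
      Fintype.card N * 2 ^ 2 ^ (Fintype.card Q * Fintype.card Q) := by
    simp [Nat.card_eq_fintype_card, Fintype.card_prod, Fintype.card_set]
  have hex : ∃ i, 1 ≤ i ∧ i ≤ Nat.card (N × Set (Box Q)) + 1 ∧ S i = S (i - 1) := by
    by_contra! hc
    -- Without a stationary step each inclusion is strict and adds an element, so the last set would
    -- be larger than the whole type.
    have hlt : ∀ i, i ≤ Nat.card (N × Set (Box Q)) + 1 → i ≤ (S i).ncard := by
      intro i
      induction i with
      | zero => simp
      | succ i ih =>
        intro hi
        have h₁ := ih (by omega)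
        have h₂ : S i ⊂ S (i + 1) :=
          (hS i).ssubset_of_ne (by simpa using (hc (i + 1) (by omega) hi).symm)
        have := Set.ncard_lt_ncard h₂ (Set.toFinite _)
        omega
    have h₁ := hlt _ le_rfl
    have h₂ := Set.ncard_le_card (S (Nat.card (N × Set (Box Q)) + 1))
    omega
  have key : ∀ i, S i = S (i - 1) →
      ∀ X, CNFEquiv (approximant G A i X) (approximant G A (i - 1) X) := by
    intro i hi X ν
    exact Set.ext_iff.1 hi (X, ν)
  obtain ⟨i, h₁, h₂, h₃⟩ := hex
  have hex' : ∃ i, 1 ≤ i ∧ ∀ X, CNFEquiv (approximant G A i X) (approximant G A (i - 1) X) :=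
    ⟨i, h₁, key i h₃⟩
  refine ⟨Nat.find hex', ⟨Nat.find_spec hex', fun j hj => Nat.find_min' hex' hj⟩, ?_⟩
  rw [← hcard]
  exact (Nat.find_min' hex' ⟨h₁, key i h₃⟩).trans h₂

/-! ## The non-inclusion game -/

/-- Refuter can enforce that a terminal word in `P` is derived. -/
inductive Win (G : Grammar N T) (P : List T → Prop) : List (N ⊕ T) → Prop
  | word (w : List T) : P w → Win G P (w.map Sum.inr)
  | refuter (w : List T) (X : N) (γ η : List (N ⊕ T)) : G.own X = .refuter → (X, η) ∈ G.rules →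
      Win G P (w.map Sum.inr ++ η ++ γ) → Win G P (w.map Sum.inr ++ Sum.inl X :: γ)
  | prover (w : List T) (X : N) (γ : List (N ⊕ T)) : G.own X = .prover →
      (∀ η, (X, η) ∈ G.rules → Win G P (w.map Sum.inr ++ η ++ γ)) →
      Win G P (w.map Sum.inr ++ Sum.inl X :: γ)

/-- Terminals in front are never rewritten, so the play on `γ` can be repeated behind `u`. -/
theorem Win.prepend {P : List T → Prop} (u : List T) {γ : List (N ⊕ T)}
    (h : Win G (fun v => P (u ++ v)) γ) : Win G P (u.map Sum.inr ++ γ) := by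
  induction h with
  | word w hw => rw [← List.map_append]; exact .word _ hw
  | refuter w X γ η ho hη _ ih =>
    rw [← List.append_assoc, ← List.map_append]
    refine .refuter _ X γ η ho hη ?_
    simpa using ih
  | prover w X γ ho _ ih =>
    rw [← List.append_assoc, ← List.map_append]
    refine .prover _ X γ ho fun η hη => ?_
    simpa using ih η hη

/-- Leftmost rewriting finishes `β` before it touches `γ`. The two phases are therefore played one
after the other, with `R` as the interface between them. -/
theorem Win.append {P R : List T → Prop} {β γ : List (N ⊕ T)} (h : Win G R β)
    (hR : ∀ u, R u → Win G P (u.map Sum.inr ++ γ)) : Win G P (β ++ γ) := by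
  induction h with
  | word w hw => exact hR w hw
  | refuter w X δ η ho hη _ ih =>
    rw [List.append_assoc, List.cons_append]
    refine .refuter _ X _ η ho hη ?_
    simpa using ih
  | prover w X δ ho _ ih =>
    rw [List.append_assoc, List.cons_append]
    refine .prover _ X _ ho fun η hη => ?_
    simpa using ih η hη

/-- Soundness holds at every stage, not only at the last one. The outer induction unfolds one rule
per stage by `sat_equations`; the auxiliary `step` lifts the claim from non-terminals to forms,
using `Win.append` once per symbol. -/
theorem win_of_sat_approximant (i : ℕ) : ∀ (α : List (N ⊕ T)) (ν : Set (Box Q)),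
    Sat ν (formFormula A (approximant G A i) α) → Win G (fun w => wordBox A w ∈ ν) α := by
  have step : ∀ v : N → CNF Q,
      (∀ X ν, Sat ν (v X) → Win G (fun w => wordBox A w ∈ ν) [Sum.inl X]) →
      ∀ (α : List (N ⊕ T)) (ν : Set (Box Q)),
        Sat ν (formFormula A v α) → Win G (fun w => wordBox A w ∈ ν) α := by
    intro v hv α
    induction α using List.reverseRecOn with
    | nil =>
      intro ν h
      exact .word [] ((sat_singleton _ _).1 h)
    | append_singleton α s ih =>
      intro ν h
      rw [formFormula_append_singleton, sat_cnfComp] at h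
      refine (ih _ h).append fun u hu => Win.prepend u ?_
      simp only [wordBox_append]
      cases s with
      | inl X => exact hv X _ hu
      | inr a =>
        have := (sat_singleton _ _).1 hu
        exact .word [a] (by simpa [wordBox, boxComp_id] using this)
  induction i with
  | zero => exact step _ fun X ν h => absurd h (not_sat_cnfFalse ν)
  | succ i ih =>
    refine step _ fun X ν h => ?_
    rcases (sat_equations _ X ν).1 h with ⟨h₁, h₂⟩ | ⟨h₁, η, h₂, h₃⟩
    · exact .prover [] X [] h₁ fun η hη => by simpa using ih η ν (h₂ η hη)
    · exact .refuter [] X [] η h₁ h₂ (by simpa using ih η ν h₃)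

/-- Completeness: satisfaction in a solution of the equations is closed under the rules that
generate `Win`, so induction on `Win` applies. -/
theorem Win.sat {v : N → CNF Q} (hv : ∀ X, CNFEquiv (equations G A v X) (v X))
    {α : List (N ⊕ T)} {ν : Set (Box Q)} (h : Win G (fun w => wordBox A w ∈ ν) α) :
    Sat ν (formFormula A v α) := by
  -- Both expansions test the leftmost factor against the same assignment: the boxes that, put
  -- between the word `w` and the remainder `γ`, still allow `ν` to be reached. A move from `X` to
  -- `η` thus becomes an instance of the equation of `X`.
  have expand : ∀ (w : List T) (X : N) (γ : List (N ⊕ T)),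
      Sat ν (formFormula A v (w.map Sum.inr ++ Sum.inl X :: γ)) ↔
      Sat {σ | Sat {τ | boxComp (boxComp (wordBox A w) σ) τ ∈ ν} (formFormula A v γ)}
        (equations G A v X) := by
    intro w X γ
    rw [hv X, sat_formFormula_append, sat_formFormula_word, Set.mem_ofPred_eq,
      ← List.singleton_append, sat_formFormula_append, sat_formFormula_singleton]
    simp [boxComp_assoc, symFormula]
  have expand' : ∀ (w : List T) (η γ : List (N ⊕ T)),
      Sat ν (formFormula A v (w.map Sum.inr ++ η ++ γ)) ↔
      Sat {σ | Sat {τ | boxComp (boxComp (wordBox A w) σ) τ ∈ ν} (formFormula A v γ)}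
        (formFormula A v η) := by
    intro w η γ
    rw [List.append_assoc, sat_formFormula_append, sat_formFormula_word, Set.mem_ofPred_eq,
      sat_formFormula_append]
    simp [boxComp_assoc]
  induction h with
  | word w hw => exact (sat_formFormula_word _ _ _).2 hw
  | refuter w X γ η ho hη _ ih =>
    rw [expand, sat_equations]
    exact .inr ⟨ho, η, hη, (expand' _ _ _).1 ih⟩
  | prover w X γ ho _ ih =>
    rw [expand, sat_equations]
    exact .inl ⟨ho, fun η hη => (expand' _ _ _).1 (ih η hη)⟩

theorem mem_evalFrom_iff (S : Set Q) (w : List T) (p : Q) :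
    p ∈ A.evalFrom S w ↔ ∃ q ∈ S, (q, p) ∈ wordBox A w := by
  induction w generalizing S with
  | nil => simp [wordBox, boxId]
  | cons a w ih =>
    rw [NFA.evalFrom_cons, ih]
    have h : wordBox A (a :: w) = boxComp (letterBox A a) (wordBox A w) := rfl
    simp only [h, boxComp, letterBox, NFA.mem_stepSet, Set.mem_ofPred_eq]
    exact ⟨fun ⟨r, ⟨q, h₁, h₂⟩, h₃⟩ => ⟨q, h₁, r, h₂, h₃⟩,
      fun ⟨q, h₁, r, h₂, h₃⟩ => ⟨r, ⟨q, h₁, h₂⟩, h₃⟩⟩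

theorem not_mem_accepts_iff (w : List T) : w ∉ A.accepts ↔
    wordBox A w ∈ {ρ : Box Q | ∀ q ∈ A.start, ∀ f ∈ A.accept, (q, f) ∉ ρ} := by
  rw [NFA.mem_accepts]
  simp only [mem_evalFrom_iff, Set.mem_ofPred_eq]
  push Not
  exact ⟨fun h q hq f hf => h f hf q hq, fun h f hf q hq => h q hq f hf⟩

/-- The rejecting assignment contains the box of a word exactly if the word is not accepted. Only
the direction from `Win` needs that the iteration has stopped. -/
theorem rejecting_iff_win {n : ℕ} (hn : StopsAt G A n) (α : List (N ⊕ T)) :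
    Rejecting A (formFormula A (approximant G A n) α) ↔ Win G (fun w => w ∉ A.accepts) α := by
  simp only [not_mem_accepts_iff]
  constructor
  · exact win_of_sat_approximant n α _
  · intro h
    obtain ⟨⟨h₁, h₂⟩, -⟩ := hn
    refine Win.sat (fun X => ?_) h
    -- Stage `m + 1` is by definition the right-hand side at stage `m`. As the two stages are
    -- equivalent, monotonicity shows that stage `m + 1` solves the equations up to equivalence.
    obtain ⟨m, rfl⟩ : ∃ m, n = m + 1 := ⟨n - 1, by omega⟩
    have h₂' : ∀ X ν, Sat ν (approximant G A (m + 1) X) ↔ Sat ν (approximant G A m X) := h₂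
    intro ν
    exact ⟨sat_equations_mono (fun X ν => (h₂' X ν).1) X ν,
      sat_equations_mono (fun X ν => (h₂' X ν).2) X ν⟩

/-! ### Positions and moves of the arena -/

theorem terminal_or_split (α : List (N ⊕ T)) :
    IsTerminal α ∨ ∃ (w : List T) (X : N) (γ : List (N ⊕ T)),
      α = w.map Sum.inr ++ Sum.inl X :: γ := by
  induction α with
  | nil => exact .inl ⟨[], rfl⟩
  | cons s α ih =>
    cases s with
    | inl X => exact .inr ⟨[], X, α, rfl⟩
    | inr a =>
      rcases ih with ⟨w, rfl⟩ | ⟨w, X, γ, rfl⟩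
      · exact .inl ⟨a :: w, rfl⟩
      · exact .inr ⟨a :: w, X, γ, rfl⟩

/-- The position of the first non-terminal fixes the splitting, so moves and the cases of `Win` can
be inverted. -/
theorem split_inj {w w' : List T} {X X' : N} {γ γ' : List (N ⊕ T)}
    (h : w.map Sum.inr ++ Sum.inl X :: γ = w'.map Sum.inr ++ Sum.inl X' :: γ') :
    w = w' ∧ X = X' ∧ γ = γ' := by
  induction w generalizing w' with
  | nil =>
    cases w' with
    | nil => simpa using h
    | cons => simp at h
  | cons a w ih =>
    cases w' with
    | nil => simp at h
    | cons a' w' =>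
      simp only [List.map_cons, List.cons_append, List.cons.injEq, Sum.inr.injEq] at h
      obtain ⟨rfl, h⟩ := h
      obtain ⟨rfl, h'⟩ := ih h
      exact ⟨rfl, h'⟩

theorem not_isTerminal_split (w : List T) (X : N) (γ : List (N ⊕ T)) :
    ¬ IsTerminal (w.map Sum.inr ++ Sum.inl X :: γ) := by
  rintro ⟨w', h⟩
  have : Sum.inl X ∈ w'.map (Sum.inr : T → N ⊕ T) := h ▸ by simp
  simp at this

theorem turn_split (w : List T) (X : N) (γ : List (N ⊕ T)) :
    G.turn (w.map Sum.inr ++ Sum.inl X :: γ) = G.own X := by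
  induction w with
  | nil => rfl
  | cons a w ih => exact ih

theorem step_split (w : List T) (X : N) (γ β : List (N ⊕ T)) :
    G.Step (w.map Sum.inr ++ Sum.inl X :: γ) β ↔
      ∃ η, (X, η) ∈ G.rules ∧ β = w.map Sum.inr ++ η ++ γ := by
  constructor
  · rintro ⟨w', X', γ', η, h, hη, rfl⟩
    obtain ⟨rfl, rfl, rfl⟩ := split_inj h
    exact ⟨η, hη, rfl⟩
  · rintro ⟨η, hη, rfl⟩
    exact ⟨w, X, γ, η, rfl, hη, rfl⟩

theorem exists_step {α : List (N ⊕ T)} (h : ¬ IsTerminal α) : ∃ β, G.Step α β := by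
  rcases terminal_or_split α with h' | ⟨w, X, γ, rfl⟩
  · exact absurd h' h
  · obtain ⟨η, hη⟩ := G.exists_rule X
    exact ⟨_, (step_split _ _ _ _).2 ⟨η, hη, rfl⟩⟩

theorem Grammar.Step.not_isTerminal {α β : List (N ⊕ T)} (h : G.Step α β) : ¬ IsTerminal α := by
  obtain ⟨w, X, γ, η, rfl, -, -⟩ := h
  exact not_isTerminal_split _ _ _

/-- This and `win_prover_iff` restate the rules of `Win` through `turn` and `Step`, the notions in
which plays and strategies are defined. -/
theorem win_refuter_iff {P : List T → Prop} {α : List (N ⊕ T)} (h : ¬ IsTerminal α)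
    (ht : G.turn α = .refuter) : Win G P α ↔ ∃ β, G.Step α β ∧ Win G P β := by
  rcases terminal_or_split α with h' | ⟨w, X, γ, rfl⟩
  · exact absurd h' h
  rw [turn_split] at ht
  constructor
  · intro hw
    generalize hα : w.map Sum.inr ++ Sum.inl X :: γ = α at hw
    cases hw with
    | word w' _ => exact absurd ⟨w', hα⟩ (not_isTerminal_split _ _ _)
    | refuter w' X' γ' η ho hη hw =>
      exact ⟨_, (step_split _ _ _ _).2 ⟨η, hη, rfl⟩, hw⟩
    | prover w' X' γ' ho _ =>
      obtain ⟨rfl, rfl, rfl⟩ := split_inj hα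
      rw [ho] at ht; cases ht
  · rintro ⟨β, hs, hw⟩
    obtain ⟨η, hη, rfl⟩ := (step_split _ _ _ _).1 hs
    exact .refuter _ _ _ η ht hη hw

theorem win_prover_iff {P : List T → Prop} {α : List (N ⊕ T)} (h : ¬ IsTerminal α)
    (ht : G.turn α = .prover) : Win G P α ↔ ∀ β, G.Step α β → Win G P β := by
  rcases terminal_or_split α with h' | ⟨w, X, γ, rfl⟩
  · exact absurd h' h
  rw [turn_split] at ht
  constructor
  · intro hw β hs
    generalize hα : w.map Sum.inr ++ Sum.inl X :: γ = α at hw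
    cases hw with
    | word w' _ => exact absurd ⟨w', hα⟩ (not_isTerminal_split _ _ _)
    | refuter w' X' γ' η ho hη hw =>
      obtain ⟨rfl, rfl, rfl⟩ := split_inj hα
      rw [ho] at ht; cases ht
    | prover w' X' γ' ho hw =>
      obtain ⟨rfl, rfl, rfl⟩ := split_inj hα
      obtain ⟨η, hη, rfl⟩ := (step_split _ _ _ _).1 hs
      exact hw η hη
  · intro hw
    exact .prover _ _ _ ht fun η hη => hw _ ((step_split _ _ _ _).2 ⟨η, hη, rfl⟩)

theorem win_word_iff {P : List T → Prop} (w : List T) :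
    Win G P (w.map Sum.inr) ↔ P w := by
  refine ⟨fun hw => ?_, .word w⟩
  generalize hα : w.map (Sum.inr : T → N ⊕ T) = α at hw
  cases hw with
  | word w' h =>
    rwa [List.map_injective_iff.2 Sum.inr_injective hα]
  | refuter w' X γ => exact absurd ⟨w, hα.symm⟩ (not_isTerminal_split _ _ _)
  | prover w' X γ => exact absurd ⟨w, hα.symm⟩ (not_isTerminal_split _ _ _)

/-- Refuter can enforce a word in `P` within `n` moves. -/
inductive WinIn (G : Grammar N T) (P : List T → Prop) : ℕ → List (N ⊕ T) → Prop
  | word (n : ℕ) (w : List T) : P w → WinIn G P n (w.map Sum.inr)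
  | refuter (n : ℕ) (α β : List (N ⊕ T)) : G.turn α = .refuter → G.Step α β → WinIn G P n β →
      WinIn G P (n + 1) α
  | prover (n : ℕ) (α : List (N ⊕ T)) : ¬ IsTerminal α → G.turn α = .prover →
      (∀ β, G.Step α β → WinIn G P n β) → WinIn G P (n + 1) α

theorem WinIn.mono {P : List T → Prop} {n m : ℕ} {α : List (N ⊕ T)} (h : WinIn G P n α)
    (hnm : n ≤ m) : WinIn G P m α := by
  induction h generalizing m with
  | word n w hw => exact .word m w hw
  | refuter n α β ht hs _ ih =>
    obtain ⟨m, rfl⟩ : ∃ m', m = m' + 1 := ⟨m - 1, by omega⟩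
    exact .refuter m α β ht hs (ih (by omega))
  | prover n α h ht _ ih =>
    obtain ⟨m, rfl⟩ : ∃ m', m = m' + 1 := ⟨m - 1, by omega⟩
    exact .prover m α h ht fun β hs => ih β hs (by omega)

/-- Finiteness of the rule set enters here: the bounds after the various moves of prover have a
common maximum. Otherwise ranks would have to be ordinals. -/
theorem Win.exists_winIn {P : List T → Prop} {α : List (N ⊕ T)} (h : Win G P α) :
    ∃ n, WinIn G P n α := by
  induction h with
  | word w hw => exact ⟨0, .word 0 w hw⟩
  | refuter w X γ η ho hη _ ih =>
    obtain ⟨n, hn⟩ := ih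
    exact ⟨n + 1, .refuter n _ _ ((turn_split _ _ _).trans ho)
      ((step_split _ _ _ _).2 ⟨η, hη, rfl⟩) hn⟩
  | prover w X γ ho _ ih =>
    have : ∀ η, ∃ n, (X, η) ∈ G.rules → WinIn G P n (w.map Sum.inr ++ η ++ γ) := by
      intro η
      by_cases hη : (X, η) ∈ G.rules
      · obtain ⟨n, hn⟩ := ih η hη
        exact ⟨n, fun _ => hn⟩
      · exact ⟨0, fun h => absurd h hη⟩
    choose f hf using this
    -- The supremum is taken over the rules of all non-terminals; the superfluous ones only enlarge
    -- it.
    refine ⟨G.rules.sup (fun r => f r.2) + 1, .prover _ _ (not_isTerminal_split _ _ _)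
      ((turn_split _ _ _).trans ho) fun β hs => ?_⟩
    obtain ⟨η, hη, rfl⟩ := (step_split _ _ _ _).1 hs
    exact (hf η hη).mono (Finset.le_sup (f := fun r : N × List (N ⊕ T) => f r.2) hη)

theorem WinIn.win {P : List T → Prop} {n : ℕ} {α : List (N ⊕ T)} (h : WinIn G P n α) :
    Win G P α := by
  induction h with
  | word n w hw => exact .word w hw
  | refuter n α β ht hs _ ih => exact (win_refuter_iff hs.not_isTerminal ht).2 ⟨β, hs, ih⟩
  | prover n α h ht _ ih => exact (win_prover_iff h ht).2 ih

theorem WinIn.step {P : List T → Prop} {n : ℕ} {α : List (N ⊕ T)} (h : WinIn G P n α)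
    (hα : ¬ IsTerminal α) :
    ∃ m < n, (G.turn α = .refuter → ∃ β, G.Step α β ∧ WinIn G P m β) ∧
      (G.turn α = .prover → ∀ β, G.Step α β → WinIn G P m β) := by
  cases h with
  | word n w hw => exact absurd ⟨w, rfl⟩ hα
  | refuter n α β ht hs h =>
    exact ⟨n, by omega, fun _ => ⟨β, hs, h⟩, fun h' => by rw [ht] at h'; cases h'⟩
  | prover n α _ ht h =>
    exact ⟨n, by omega, fun h' => (by rw [ht] at h'; cases h'), fun _ => h⟩

open Classical in
/-- The number of moves that refuter needs. -/
noncomputable def winRank (G : Grammar N T) (P : List T → Prop) (α : List (N ⊕ T)) : ℕ :=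
  if h : ∃ n, WinIn G P n α then Nat.find h else 0

theorem winIn_winRank {P : List T → Prop} {α : List (N ⊕ T)} (h : Win G P α) :
    WinIn G P (winRank G P α) α := by
  classical
  have h' := h.exists_winIn
  rw [winRank, dif_pos h']
  exact Nat.find_spec h'

theorem winRank_le {P : List T → Prop} {n : ℕ} {α : List (N ⊕ T)} (h : WinIn G P n α) :
    winRank G P α ≤ n := by
  classical
  have h' : ∃ n, WinIn G P n α := ⟨n, h⟩
  rw [winRank, dif_pos h']
  exact Nat.find_min' h' h

/-- Refuter plays positionally and decreases `winRank`. Every move of prover decreases it too, so a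
conforming play stays in `Win` and cannot be infinite. -/
theorem refuterWins_of_win {α : List (N ⊕ T)} (h : Win G (fun w => w ∉ A.accepts) α) :
    RefuterWins G A α := by
  classical
  set P : List T → Prop := fun w => w ∉ A.accepts with hP
  let good : List (N ⊕ T) → List (N ⊕ T) → Prop := fun β γ =>
    G.Step β γ ∧ Win G P γ ∧ winRank G P γ < winRank G P β
  -- A strategy has to answer every finite play. Where no rank-decreasing move exists an arbitrary
  -- legal move is taken, and `[]` is a dummy where there is no move at all.
  let move : List (N ⊕ T) → List (N ⊕ T) := fun β =>
    if h : ∃ γ, good β γ then h.choose else if h : ∃ γ, G.Step β γ then h.choose else []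
  have hmove : ∀ β, ¬ IsTerminal β → G.Step β (move β) := by
    intro β hβ
    by_cases h : ∃ γ, good β γ
    · simp only [move, dif_pos h]; exact h.choose_spec.1
    · have h' : ∃ γ, G.Step β γ := exists_step hβ
      simp only [move, dif_neg h, dif_pos h']; exact h'.choose_spec
  have hgood : ∀ β γ, Win G P β → G.Step β γ → (G.turn β = .refuter → γ = move β) →
      Win G P γ ∧ winRank G P γ < winRank G P β := by
    intro β γ hw hs hm
    obtain ⟨m, hm', h₁, h₂⟩ := (winIn_winRank hw).step hs.not_isTerminal
    cases ht : G.turn β with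
    | refuter =>
      obtain ⟨δ, hδ, hw'⟩ := h₁ ht
      have hex : ∃ γ, good β γ := ⟨δ, hδ, hw'.win, (winRank_le hw').trans_lt hm'⟩
      have : γ = hex.choose := by rw [hm ht]; simp only [move, dif_pos hex]
      rw [this]; exact hex.choose_spec.2
    | prover =>
      have := h₂ ht γ hs
      exact ⟨this.win, (winRank_le this).trans_lt hm'⟩
  refine ⟨fun l => move (l.getLast?.getD []), ?_, ?_⟩
  · intro l β _ hl hβ _
    simpa [hl] using hmove β hβ
  · rintro (l | p) hmax hconf
    · obtain ⟨⟨hne, hstep⟩, hhead, β, hlast, w, rfl⟩ := hmax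
      have hall : ∀ (i : ℕ) (hi : i < l.length), Win G P l[i] := by
        intro i
        induction i with
        | zero =>
          intro hi
          rw [List.head?_eq_getElem?, List.getElem?_eq_getElem hi] at hhead
          rw [Option.some.inj hhead]; exact h
        | succ i ih =>
          intro hi
          refine (hgood _ _ (ih (by omega)) (hstep i hi) fun ht => ?_).1
          have := hconf i hi ht
          rw [this]
          dsimp only
          rw [List.getLast?_take]
          simp [List.getElem?_eq_getElem (show i < l.length by omega)]
      refine ⟨w, hlast, ?_⟩
      have hpos : 0 < l.length := List.length_pos_iff.2 hne
      have := hall (l.length - 1) (by omega)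
      rw [List.getLast?_eq_getElem?, List.getElem?_eq_getElem (by omega)] at hlast
      rw [Option.some.inj hlast] at this
      exact (win_word_iff w).1 this
    · obtain ⟨h0, hstep⟩ := hmax
      have hall : ∀ i, Win G P (p i) ∧ winRank G P (p i) + i ≤ winRank G P (p 0) := by
        intro i
        induction i with
        | zero => exact ⟨h0 ▸ h, le_rfl⟩
        | succ i ih =>
          have := hgood _ _ ih.1 (hstep i) fun ht => by
            rw [hconf i ht]; simp [List.range_succ]
          exact ⟨this.1, by omega⟩
      have := (hall (winRank G P (p 0) + 1)).2
      omega

theorem Grammar.IsFinitePlay.append_singleton {l : List (List (N ⊕ T))} {β γ : List (N ⊕ T)}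
    (hl : G.IsFinitePlay l) (hβ : l.getLast? = some β) (h : G.Step β γ) :
    G.IsFinitePlay (l ++ [γ]) := by
  refine ⟨by simp, fun i hi => ?_⟩
  simp only [List.length_append, List.length_singleton] at hi
  by_cases hi' : i + 1 < l.length
  · rw [List.getElem_append_left hi', List.getElem_append_left (by omega)]
    exact hl.2 i hi'
  · have : i + 1 = l.length := by omega
    rw [List.getElem_append_left (by omega), List.getElem_append_right (by omega)]
    rw [List.getLast?_eq_getElem?, List.getElem?_eq_getElem (by omega)] at hβ
    have hi2 : i = l.length - 1 := by omega
    subst hi2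
    rw [Option.some.inj hβ]
    simpa using h

/-- From a position outside `Win`, every answer of refuter stays outside and prover has a move that
stays outside. Playing this against the given strategy yields an infinite conforming play, which
refuter does not win. -/
theorem win_of_refuterWins {α : List (N ⊕ T)} (h : RefuterWins G A α) :
    Win G (fun w => w ∉ A.accepts) α := by
  obtain ⟨s, hs, hwin⟩ := h
  by_contra hα
  set P : List T → Prop := fun w => w ∉ A.accepts with hP
  let bad : List (List (N ⊕ T)) → Prop := fun l =>
    G.IsFinitePlay l ∧ l.head? = some α ∧ G.Conforms .refuter s (.fin l) ∧
      ∃ β, l.getLast? = some β ∧ ¬ Win G P β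
  have hext : ∀ l, bad l → ∃ γ, bad (l ++ [γ]) := by
    rintro l ⟨hl, hhead, hconf, β, hβ, hlose⟩
    -- A terminal end would make the play maximal. The strategy would then win it, and its last
    -- position would lie in `Win`.
    have hterm : ¬ IsTerminal β := by
      rintro ⟨w, rfl⟩
      obtain ⟨w', hw', hacc⟩ := hwin (.fin l) ⟨hl, hhead, _, hβ, w, rfl⟩ hconf
      rw [hβ] at hw'
      rw [Option.some.inj hw'] at hlose
      exact hlose (.word w' hacc)
    obtain ⟨γ, hγ, hlose', hγs⟩ : ∃ γ, G.Step β γ ∧ ¬ Win G P γ ∧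
        (G.turn β = .refuter → γ = s l) := by
      cases ht : G.turn β with
      | refuter =>
        have h₁ := hs l β hl hβ hterm ht
        exact ⟨s l, h₁, fun hw => hlose ((win_refuter_iff hterm ht).2 ⟨_, h₁, hw⟩), fun _ => rfl⟩
      | prover =>
        rw [win_prover_iff hterm ht] at hlose
        push Not at hlose
        obtain ⟨γ, h₁, h₂⟩ := hlose
        exact ⟨γ, h₁, h₂, fun h => by cases h⟩
    refine ⟨γ, hl.append_singleton hβ hγ, ?_, ?_, γ, by simp, hlose'⟩
    · rw [List.head?_append, hhead]; rfl
    · intro i hi ht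
      simp only [List.length_append, List.length_singleton] at hi
      by_cases hi' : i + 1 < l.length
      · rw [List.getElem_append_left hi']
        rw [List.getElem_append_left (by omega)] at ht
        rw [List.take_append_of_le_length (by omega)]
        exact hconf i hi' ht
      · have hi2 : i = l.length - 1 := by omega
        have hpos : 0 < l.length := List.length_pos_iff.2 hl.1
        subst hi2
        rw [List.getElem_append_left (by omega)] at ht
        rw [List.getLast?_eq_getElem?, List.getElem?_eq_getElem (by omega)] at hβ
        rw [Option.some.inj hβ] at ht
        rw [List.getElem_append_right (by omega)]
        have : l.length - 1 + 1 = l.length := by omega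
        simp [this, hγs ht]
  choose! ext hextend using hext
  let f : ℕ → List (List (N ⊕ T)) := fun n => Nat.rec [α] (fun _ l => l ++ [ext l]) n
  have hf : ∀ n, f (n + 1) = f n ++ [ext (f n)] := fun _ => rfl
  have hbad : ∀ n, bad (f n) := by
    intro n
    induction n with
    | zero =>
      refine ⟨⟨by simp [f], fun i hi => ?_⟩, rfl, fun i hi => ?_, α, rfl, hα⟩ <;>
      · simp [f] at hi
    | succ n ih => exact hextend _ ih
  -- The plays `f n` are prefixes of each other, and the sequence of their last positions is the
  -- limit play.
  let p : ℕ → List (N ⊕ T) := fun n => (f n).getLast?.getD []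
  have hp : ∀ n, f n = (List.range (n + 1)).map p := by
    intro n
    induction n with
    | zero => rfl
    | succ n ih =>
      rw [List.range_succ, List.map_append, ← ih, hf]
      simp [p, hf]
  refine hwin (.inf p) ⟨rfl, fun i => ?_⟩ fun i ht => ?_
  · have := (hbad (i + 1)).1.2 i (by simp [hp])
    simpa [hp] using this
  · have := (hbad (i + 1)).2.2.1 i (by simp [hp]) (by simpa [hp] using ht)
    rw [← hp i]
    have h2 : (f (i + 1)).take (i + 1) = f i := by
      rw [hf, List.take_append_of_le_length (by simp [hp]), List.take_of_length_le (by simp [hp])]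
    rw [h2] at this
    rw [← this]
    simp [hp]

theorem refuterWins_iff_win {α : List (N ⊕ T)} :
    RefuterWins G A α ↔ Win G (fun w => w ∉ A.accepts) α :=
  ⟨win_of_refuterWins, refuterWins_of_win⟩

end

/-! ## Program logic -/

/-- The analysis is syntactic and Boolean valued, so that frame conditions of concrete programs are
settled by evaluation. The default arguments of `Frame.reg` and `Frame.arr` rely on this. -/
def Cmd.writesReg : Cmd → Reg → Bool
  | .skip, _ => false
  | .set y _, x => decide (x = y)
  | .store _ _ _, _ => false
  | .seq c d, x => c.writesReg x || d.writesReg x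
  | .ite _ c d, x => c.writesReg x || d.writesReg x
  | .loop _ c, x => c.writesReg x

def Cmd.writesArr : Cmd → Arr → Bool
  | .skip, _ => false
  | .set _ _, _ => false
  | .store b _ _, a => decide (a = b)
  | .seq c d, a => c.writesArr a || d.writesArr a
  | .ite _ c d, a => c.writesArr a || d.writesArr a
  | .loop _ c, a => c.writesArr a

/-- What `c` does not write is the same in `σ` and `τ`. -/
structure Frame (c : Cmd) (σ τ : Store) : Prop where
  reg_eq : ∀ x, c.writesReg x = false → τ.reg x = σ.reg x
  arr_eq : ∀ a, c.writesArr a = false → τ.arr a = σ.arr a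

theorem Frame.reg {c : Cmd} {σ τ : Store} (h : Frame c σ τ) (x : Reg)
    (hx : c.writesReg x = false := by first | decide | rfl) : τ.reg x = σ.reg x := h.reg_eq x hx

theorem Frame.arr {c : Cmd} {σ τ : Store} (h : Frame c σ τ) (a : Arr)
    (ha : c.writesArr a = false := by first | decide | rfl) : τ.arr a = σ.arr a := h.arr_eq a ha

theorem Frame.refl (c : Cmd) (σ : Store) : Frame c σ σ := ⟨fun _ _ => rfl, fun _ _ => rfl⟩

theorem Frame.trans {c : Cmd} {σ τ υ : Store} (h : Frame c σ τ) (h' : Frame c τ υ) :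
    Frame c σ υ :=
  ⟨fun x hx => (h'.reg_eq x hx).trans (h.reg_eq x hx),
    fun a ha => (h'.arr_eq a ha).trans (h.arr_eq a ha)⟩

theorem Frame.weaken {c d : Cmd} {σ τ : Store} (h : Frame c σ τ)
    (hr : ∀ x, d.writesReg x = false → c.writesReg x = false)
    (ha : ∀ a, d.writesArr a = false → c.writesArr a = false) : Frame d σ τ :=
  ⟨fun x hx => h.reg_eq x (hr x hx), fun a h' => h.arr_eq a (ha a h')⟩

@[simp] theorem Store.setReg_arr (σ : Store) (x : Reg) (v : ℕ) : (σ.setReg x v).arr = σ.arr := rfl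

@[simp] theorem Store.setReg_reg_self (σ : Store) (x : Reg) (v : ℕ) :
    (σ.setReg x v).reg x = v := Function.update_self _ _ _

theorem Store.setReg_reg_of_ne (σ : Store) {x y : Reg} (v : ℕ) (h : y ≠ x) :
    (σ.setReg x v).reg y = σ.reg y := Function.update_of_ne h _ _

theorem Store.setReg_reg (σ : Store) (x y : Reg) (v : ℕ) :
    (σ.setReg x v).reg y = if y = x then v else σ.reg y := Function.update_apply _ _ _ _

@[simp] theorem Store.setArr_arr_self (σ : Store) (a : Arr) (i v : ℕ) :
    (σ.setArr a i v).arr a = Function.update (σ.arr a) i v := Function.update_self _ _ _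

theorem Store.setArr_arr_of_ne (σ : Store) {a b : Arr} (i v : ℕ) (h : b ≠ a) :
    (σ.setArr a i v).arr b = σ.arr b := Function.update_of_ne h _ _

/-- Since the frame comes for free with every execution, `Triple.conseq` and `Triple.seq` hand it
on, and specifications need to mention only what changes. -/
theorem Exec.frame {c : Cmd} {σ τ : Store} {t : ℕ} (h : Exec c σ τ t) : Frame c σ τ := by
  induction h with
  | skip => exact Frame.refl _ _
  | set x e σ =>
    exact ⟨fun y hy => Store.setReg_reg_of_ne _ _ (by simpa [Cmd.writesReg] using hy),
      fun _ _ => rfl⟩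
  | store a e f σ =>
    exact ⟨fun _ _ => rfl,
      fun b hb => Store.setArr_arr_of_ne _ _ _ (by simpa [Cmd.writesArr] using hb)⟩
  | seq _ _ ih₁ ih₂ =>
    exact (ih₁.weaken (by simp +contextual [Cmd.writesReg])
      (by simp +contextual [Cmd.writesArr])).trans
      (ih₂.weaken (by simp +contextual [Cmd.writesReg]) (by simp +contextual [Cmd.writesArr]))
  | iteTrue _ _ ih =>
    exact ih.weaken (by simp +contextual [Cmd.writesReg]) (by simp +contextual [Cmd.writesArr])
  | iteFalse _ _ ih =>
    exact ih.weaken (by simp +contextual [Cmd.writesReg]) (by simp +contextual [Cmd.writesArr])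
  | loopTrue _ _ _ ih₁ ih₂ =>
    exact (ih₁.weaken (by simp [Cmd.writesReg]) (by simp [Cmd.writesArr])).trans ih₂
  | loopFalse => exact Frame.refl _ _

/-- Started in `σ`, the command `c` halts within `B` steps in a state that satisfies `R`. -/
def Triple (σ : Store) (c : Cmd) (B : ℕ) (R : Store → Prop) : Prop :=
  ∃ τ t, Exec c σ τ t ∧ t ≤ B ∧ R τ

namespace Triple

variable {σ : Store} {c d : Cmd} {B B' : ℕ} {R R' : Store → Prop}

theorem conseq (h : Triple σ c B R) (hB : B ≤ B') (hR : ∀ τ, Frame c σ τ → R τ → R' τ) :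
    Triple σ c B' R' := by
  obtain ⟨τ, t, he, ht, hr⟩ := h
  exact ⟨τ, t, he, ht.trans hB, hR τ he.frame hr⟩

theorem skip (h : R σ) : Triple σ .skip 1 R := ⟨σ, 1, .skip σ, le_rfl, h⟩

theorem set {x : Reg} {e : Expr} (h : R (σ.setReg x (e.eval σ))) :
    Triple σ (.set x e) (e.cost + 1) R := ⟨_, _, .set x e σ, le_rfl, h⟩

theorem store {a : Arr} {e f : Expr} (h : R (σ.setArr a (e.eval σ) (f.eval σ))) :
    Triple σ (.store a e f) (e.cost + f.cost + 1) R := ⟨_, _, .store a e f σ, le_rfl, h⟩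

theorem seq (h : Triple σ c B R') (h' : ∀ τ, Frame c σ τ → R' τ → Triple τ d B' R) :
    Triple σ (.seq c d) (B + B') R := by
  obtain ⟨τ, t, he, ht, hr⟩ := h
  obtain ⟨υ, u, he', hu, hr'⟩ := h' τ he.frame hr
  exact ⟨υ, t + u, .seq he he', by omega, hr'⟩

theorem ite {e : Expr} (h : e.eval σ ≠ 0 → Triple σ c B R) (h' : e.eval σ = 0 → Triple σ d B' R) :
    Triple σ (.ite e c d) (e.cost + 1 + B + B') R := by
  by_cases he : e.eval σ = 0
  · obtain ⟨τ, t, hx, ht, hr⟩ := h' he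
    exact ⟨τ, _, .iteFalse he hx, by omega, hr⟩
  · obtain ⟨τ, t, hx, ht, hr⟩ := h he
    exact ⟨τ, _, .iteTrue he hx, by omega, hr⟩

/-- The induction is on the number `k` of rounds that remain. Each round has its own bound `b i`,
because rounds of the loop over the rules differ in cost. -/
theorem loop_count {e : Expr} {c : Cmd} {b : ℕ → ℕ} (n : ℕ) (Inv : ℕ → Store → Prop)
    (hs : ∀ i < n, ∀ τ, Inv i τ → e.eval τ ≠ 0 ∧ Triple τ c (b i) (Inv (i + 1)))
    (hn : ∀ τ, Inv n τ → e.eval τ = 0) :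
    ∀ k ≤ n, ∀ τ, Inv (n - k) τ →
      Triple τ (.loop e c) (∑ i ∈ Finset.Ico (n - k) n, (b i + e.cost + 1) + e.cost + 1)
        (Inv n) := by
  intro k
  induction k with
  | zero =>
    intro _ τ hτ
    exact ⟨τ, _, .loopFalse (hn τ hτ), by simp, hτ⟩
  | succ k ih =>
    intro hk τ hτ
    obtain ⟨he, υ, t, hx, ht, hυ⟩ := hs _ (by omega) τ hτ
    have h1 : n - (k + 1) + 1 = n - k := by omega
    rw [h1] at hυ
    obtain ⟨ω, u, hx', hu, hω⟩ := ih (by omega) υ hυ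
    refine ⟨ω, _, .loopTrue he hx hx', ?_, hω⟩
    rw [Finset.sum_eq_sum_Ico_succ_bot (by omega), h1]
    omega

/-- The frame of the whole loop is added to the invariant, so every round may use that the data not
written by the loop are still those of `σ`. -/
theorem loop {e : Expr} {b : ℕ → ℕ} (n : ℕ) (Inv : ℕ → Store → Prop) (h0 : Inv 0 σ)
    (hs : ∀ i < n, ∀ τ, Frame (.loop e c) σ τ → Inv i τ →
      e.eval τ ≠ 0 ∧ Triple τ c (b i) (Inv (i + 1)))
    (hn : ∀ τ, Frame (.loop e c) σ τ → Inv n τ → e.eval τ = 0) :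
    Triple σ (.loop e c) (∑ i ∈ Finset.range n, (b i + e.cost + 1) + e.cost + 1) (Inv n) := by
  have := loop_count (e := e) (c := c) (b := b) n (fun i τ => Frame (.loop e c) σ τ ∧ Inv i τ)
    (fun i hi τ hτ => ⟨(hs i hi τ hτ.1 hτ.2).1, (hs i hi τ hτ.1 hτ.2).2.conseq le_rfl
      fun υ hf hυ => ⟨hτ.1.trans (hf.weaken (by simp [Cmd.writesReg]) (by simp [Cmd.writesArr])),
        hυ⟩⟩)
    (fun τ hτ => hn τ hτ.1 hτ.2) n le_rfl σ (by simpa using ⟨Frame.refl _ _, h0⟩)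
  refine this.conseq ?_ fun τ _ h => h.2
  rw [Nat.sub_self, Finset.range_eq_Ico]

/-- The constants are the costs of `x := 0` (2 steps), of `x := x + 1` (4 steps) and of the test
(`e.cost + 2`). The invariant is re-established after the increment of the counter. -/
theorem forTo {x : Reg} {e : Expr} {b : ℕ → ℕ} (n : ℕ) (hx : c.writesReg x = false)
    (he : ∀ τ, Frame (forTo x e c) σ τ → e.eval τ = n) (Inv : ℕ → Store → Prop)
    (h0 : Inv 0 (σ.setReg x 0))
    (hs : ∀ i < n, ∀ τ, Frame (InclusionGame.forTo x e c) σ τ → τ.reg x = i → Inv i τ →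
      Triple τ c (b i) (fun υ => Inv (i + 1) (υ.setReg x (i + 1)))) :
    Triple σ (InclusionGame.forTo x e c)
      (2 + (∑ i ∈ Finset.range n, (b i + 4 + (e.cost + 2) + 1) + (e.cost + 2) + 1)) (Inv n) := by
  refine seq (B := 2) (R' := fun τ => τ = σ.setReg x 0) (set rfl) ?_
  rintro _ - rfl
  have hf0 : Frame (InclusionGame.forTo x e c) σ (σ.setReg x 0) :=
    (Exec.set x (.lit 0) σ).frame.weaken
      (by simp +contextual [InclusionGame.forTo, Cmd.writesReg])
      (by simp +contextual [Cmd.writesArr])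
  have hf1 : ∀ τ, Frame (.loop (.lt (.reg x) e) (c ;; .set x (.add (.reg x) (.lit 1))))
      (σ.setReg x 0) τ → Frame (InclusionGame.forTo x e c) σ τ := fun τ h =>
    hf0.trans (h.weaken (by simp +contextual [InclusionGame.forTo, Cmd.writesReg])
      (by simp +contextual [InclusionGame.forTo, Cmd.writesArr]))
  refine (loop (b := fun i => b i + 4) n (fun i τ => τ.reg x = i ∧ Inv i τ)
    ⟨by simp, h0⟩ ?_ ?_).conseq
      (le_of_eq (by simp only [Expr.cost, Nat.add_comm 1 e.cost, add_assoc, Nat.reduceAdd]))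
      fun τ _ h => h.2
  · rintro i hi τ hf ⟨hxi, hinv⟩
    refine ⟨by simp [Expr.eval, hxi, he τ (hf1 τ hf), hi], ?_⟩
    refine seq (hs i hi τ (hf1 τ hf) hxi hinv) fun υ hf' hυ => set ?_
    have : υ.reg x = i := (hf'.reg_eq x hx).trans hxi
    simp only [Expr.eval, this, Store.setReg_reg_self, true_and]
    exact hυ
  · rintro τ hf ⟨hxi, -⟩
    simp [Expr.eval, hxi, he τ (hf1 τ hf)]

end Triple

/-- An upper bound on the running time if every loop is executed at most `M` times. -/
def Cmd.bound (M : ℕ) : Cmd → ℕ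
  | .skip => 1
  | .set _ e => e.cost + 1
  | .store _ e f => e.cost + f.cost + 1
  | .seq c d => c.bound M + d.bound M
  | .ite e c d => e.cost + 1 + c.bound M + d.bound M
  | .loop e c => M * (c.bound M + e.cost + 1) + e.cost + 1

/-- `f` is bounded by a monomial on the positive numbers. -/
def PolyBounded (f : ℕ → ℕ) : Prop := ∃ C d, ∀ M, 1 ≤ M → f M ≤ C * M ^ d

theorem PolyBounded.const (n : ℕ) : PolyBounded fun _ => n := ⟨n, 0, by simp⟩

theorem PolyBounded.id : PolyBounded fun M => M := ⟨1, 1, by simp⟩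

theorem PolyBounded.add {f g : ℕ → ℕ} (hf : PolyBounded f) (hg : PolyBounded g) :
    PolyBounded fun M => f M + g M := by
  obtain ⟨C, d, hf⟩ := hf
  obtain ⟨D, e, hg⟩ := hg
  refine ⟨C + D, max d e, fun M hM => ?_⟩
  rw [add_mul]
  exact add_le_add
    ((hf M hM).trans (Nat.mul_le_mul_left _ (Nat.pow_le_pow_right hM (le_max_left _ _))))
    ((hg M hM).trans (Nat.mul_le_mul_left _ (Nat.pow_le_pow_right hM (le_max_right _ _))))

theorem PolyBounded.mul {f g : ℕ → ℕ} (hf : PolyBounded f) (hg : PolyBounded g) :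
    PolyBounded fun M => f M * g M := by
  obtain ⟨C, d, hf⟩ := hf
  obtain ⟨D, e, hg⟩ := hg
  refine ⟨C * D, d + e, fun M hM => (Nat.mul_le_mul (hf M hM) (hg M hM)).trans_eq ?_⟩
  ring

/-- Each loop contributes one factor `M`, so the nesting depth of loops serves as the degree. It
depends on the command only, not on the input. -/
theorem Cmd.polyBounded_bound (c : Cmd) : PolyBounded fun M => c.bound M := by
  induction c with
  | skip => exact .const _
  | set x e => exact .const _
  | store a e f => exact .const _
  | seq c d ih₁ ih₂ => exact ih₁.add ih₂
  | ite e c d ih₁ ih₂ => exact ((PolyBounded.const _).add ih₁).add ih₂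
  | loop e c ih =>
    exact ((PolyBounded.id.mul ((ih.add (.const _)).add (.const _))).add (.const _)).add (.const _)

/-- Halting in a state that satisfies `R`, within the time bound for loops of at most `M` rounds. -/
def Spec (M : ℕ) (σ : Store) (c : Cmd) (R : Store → Prop) : Prop := Triple σ c (c.bound M) R

namespace Spec

variable {M : ℕ} {σ : Store} {c d : Cmd} {R R' : Store → Prop}

theorem conseq (h : Spec M σ c R) (hR : ∀ τ, Frame c σ τ → R τ → R' τ) : Spec M σ c R' :=
  Triple.conseq h le_rfl hR

theorem skip (h : R σ) : Spec M σ .skip R := Triple.skip h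

theorem set {x : Reg} {e : Expr} (h : R (σ.setReg x (e.eval σ))) : Spec M σ (.set x e) R :=
  Triple.set h

theorem store {a : Arr} {e f : Expr} (h : R (σ.setArr a (e.eval σ) (f.eval σ))) :
    Spec M σ (.store a e f) R := Triple.store h

theorem seq (h : Spec M σ c R') (h' : ∀ τ, Frame c σ τ → R' τ → Spec M τ d R) :
    Spec M σ (.seq c d) R := Triple.seq h h'

/-- Sequences associate to the right, so a named subprogram consisting of the first two commands is
not a subterm; rebracketing keeps the time bound. -/
theorem seq_assoc {c' : Cmd} (h : Spec M σ (.seq (.seq c d) c') R) :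
    Spec M σ (.seq c (.seq d c')) R := by
  obtain ⟨τ, t, he, ht, hr⟩ := h
  cases he with
  | seq he h₃ =>
    cases he with
    | seq h₁ h₂ =>
      refine ⟨τ, _, .seq h₁ (.seq h₂ h₃), ?_, hr⟩
      simp only [Cmd.bound] at ht ⊢
      omega

theorem set_seq {x : Reg} {e : Expr}
    (h : ∀ τ, Frame (.set x e) σ τ → τ.reg x = e.eval σ → Spec M τ d R) :
    Spec M σ (.seq (.set x e) d) R :=
  seq (R' := fun τ => τ.reg x = e.eval σ) (set (by simp)) h

theorem store_seq {a : Arr} {e f : Expr}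
    (h : ∀ τ, Frame (.store a e f) σ τ →
      τ.arr a = Function.update (σ.arr a) (e.eval σ) (f.eval σ) → Spec M τ d R) :
    Spec M σ (.seq (.store a e f) d) R :=
  seq (R' := fun τ => τ.arr a = Function.update (σ.arr a) (e.eval σ) (f.eval σ))
    (store (by simp)) h

theorem ite {e : Expr} (h : e.eval σ ≠ 0 → Spec M σ c R) (h' : e.eval σ = 0 → Spec M σ d R) :
    Spec M σ (.ite e c d) R := Triple.ite h h'

theorem when {e : Expr} (h : e.eval σ ≠ 0 → Spec M σ c R) (h' : e.eval σ = 0 → R σ) :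
    Spec M σ (InclusionGame.when e c) R := ite h fun h => skip (h' h)

theorem forTo {x : Reg} {e : Expr} (n : ℕ) (hn : n ≤ M)
    (he : ∀ τ, Frame (forTo x e c) σ τ → e.eval τ = n) (Inv : ℕ → Store → Prop)
    (h0 : Inv 0 (σ.setReg x 0))
    (hs : ∀ i < n, ∀ τ, Frame (InclusionGame.forTo x e c) σ τ → τ.reg x = i → Inv i τ →
      Spec M τ c (fun υ => Inv (i + 1) (υ.setReg x (i + 1))))
    (hx : c.writesReg x = false := by first | decide | rfl) :
    Spec M σ (InclusionGame.forTo x e c) (Inv n) := by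
  refine (Triple.forTo n hx he Inv h0 hs).conseq ?_ fun _ _ h => h
  rw [Finset.sum_const, Finset.card_range, smul_eq_mul]
  have h := Nat.mul_le_mul_right (c.bound M + 4 + (e.cost + 2) + 1) hn
  simp only [InclusionGame.forTo, Cmd.bound, Expr.cost]
  have h2 : c.bound M + (1 + 1 + 1 + 1) + (1 + e.cost + 1) + 1
    = c.bound M + 4 + (e.cost + 2) + 1 := by ring
  rw [h2]
  omega

theorem forReg {x y : Reg} (n : ℕ) (hn : n ≤ M) (hy : σ.reg y = n) (Inv : ℕ → Store → Prop)
    (h0 : Inv 0 (σ.setReg x 0))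
    (hs : ∀ i < n, ∀ τ, Frame (InclusionGame.forTo x (.reg y) c) σ τ → τ.reg x = i → Inv i τ →
      Spec M τ c (fun υ => Inv (i + 1) (υ.setReg x (i + 1))))
    (hR : ∀ τ, Frame (InclusionGame.forTo x (.reg y) c) σ τ → Inv n τ → R τ)
    (hx : c.writesReg x = false := by first | decide | rfl)
    (hyx : (InclusionGame.forTo x (.reg y) c).writesReg y = false := by first | decide | rfl) :
    Spec M σ (InclusionGame.forTo x (.reg y) c) R :=
  (Spec.forTo n hn (fun _ hf => (hf.reg_eq y hyx).trans hy) Inv h0 hs hx).conseq hR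

end Spec

/-! ## Codes of boxes and clauses -/

/-- Surjectivity of the codings of boxes and of clauses both rest on this. -/
theorem exists_testBit_eq (n : ℕ) (s : Set ℕ) :
    ∃ b < 2 ^ n, ∀ i < n, (b.testBit i = true ↔ i ∈ s) := by
  classical
  refine ⟨Nat.ofBits (n := n) fun i => decide ((i : ℕ) ∈ s), Nat.ofBits_lt_two_pow _, ?_⟩
  intro i hi
  rw [Nat.testBit_ofBits_lt _ _ hi]
  simp

/-- The number of boxes. -/
abbrev numBoxes (Q : Type) [Fintype Q] : ℕ := 2 ^ (Fintype.card Q * Fintype.card Q)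

/-- The number of clauses. -/
abbrev numClauses (Q : Type) [Fintype Q] : ℕ := 2 ^ numBoxes Q

section

variable {N T Q : Type} [Fintype N] [Fintype T] [Fintype Q] {G : Grammar N T} {A : NFA T Q}
variable (P : Presentation G Q)

theorem card_mul_card_lt_numBoxes : Fintype.card Q * Fintype.card Q < numBoxes Q :=
  Nat.lt_two_pow_self

theorem numBoxes_lt_numClauses : numBoxes Q < numClauses Q := Nat.lt_two_pow_self

theorem card_le_numClauses : Fintype.card Q ≤ numClauses Q :=
  (Nat.le_mul_self _).trans
    (card_mul_card_lt_numBoxes.le.trans numBoxes_lt_numClauses.le)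

theorem row_add_lt {i j n : ℕ} (hi : i < n) (hj : j < n) : i * n + j < n * n := by
  have : (i + 1) * n ≤ n * n := Nat.mul_le_mul_right _ hi
  rw [add_mul] at this; omega

theorem row_add_inj {n i j i' j' : ℕ} (hj : j < n) (hj' : j' < n) :
    i * n + j = i' * n + j' ↔ i = i' ∧ j = j' := by
  constructor
  · intro h
    have h1 := congrArg (· / n) h
    have h2 := congrArg (· % n) h
    have hn : 0 < n := by omega
    simp only [Nat.mul_comm _ n, Nat.mul_add_div hn,
      Nat.div_eq_of_lt hj, Nat.div_eq_of_lt hj', Nat.mul_add_mod, Nat.mod_eq_of_lt hj,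
      Nat.mod_eq_of_lt hj'] at h1 h2
    exact ⟨h1, h2⟩
  · rintro ⟨rfl, rfl⟩; rfl

namespace Presentation

theorem mem_boxOf {b : ℕ} {x : Q × Q} : x ∈ P.boxOf b ↔
    b.testBit ((P.eQ x.1 : ℕ) * Fintype.card Q + (P.eQ x.2 : ℕ)) = true := Iff.rfl

theorem exists_state {i : ℕ} (hi : i < Fintype.card Q) : ∃ p, (P.eQ p : ℕ) = i :=
  ⟨P.eQ.symm ⟨i, hi⟩, by simp⟩

theorem state_inj {p p' : Q} : (P.eQ p : ℕ) = P.eQ p' ↔ p = p' := by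
  rw [← Fin.ext_iff, P.eQ.injective.eq_iff]

theorem boxOf_zero : P.boxOf 0 = ∅ := by
  ext x; simp [mem_boxOf]

theorem boxOf_or (b c : ℕ) : P.boxOf (b ||| c) = P.boxOf b ∪ P.boxOf c := by
  ext x; simp [mem_boxOf, Nat.testBit_or]

theorem boxOf_two_pow {i j : ℕ} (hj : j < Fintype.card Q) :
    P.boxOf (2 ^ (i * Fintype.card Q + j)) = {x | (P.eQ x.1 : ℕ) = i ∧ (P.eQ x.2 : ℕ) = j} := by
  ext x
  simp only [mem_boxOf, Nat.testBit_two_pow, decide_eq_true_eq, Set.mem_ofPred_eq]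
  rw [row_add_inj hj (P.eQ x.2).2]
  exact and_congr eq_comm eq_comm

theorem exists_boxOf_eq (ρ : Box Q) : ∃ b < numBoxes Q, P.boxOf b = ρ := by
  obtain ⟨b, hb, h⟩ := exists_testBit_eq (Fintype.card Q * Fintype.card Q)
    {n | ∃ x ∈ ρ, (P.eQ x.1 : ℕ) * Fintype.card Q + (P.eQ x.2 : ℕ) = n}
  refine ⟨b, hb, ?_⟩
  ext ⟨p, p'⟩
  rw [mem_boxOf, h _ (row_add_lt (P.eQ p).2 (P.eQ p').2)]
  constructor
  · rintro ⟨⟨r, r'⟩, hx, he⟩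
    obtain ⟨h1, h2⟩ := (row_add_inj (P.eQ r').2 (P.eQ p').2).1 he
    rw [P.state_inj] at h1 h2
    subst h1; subst h2; exact hx
  · exact fun hx => ⟨_, hx, rfl⟩

/-- By division with remainder, every bit below `|Q| * |Q|` belongs to a pair of states; all higher
bits vanish by the bounds on the codes. -/
theorem boxOf_inj {b c : ℕ} (hb : b < numBoxes Q) (hc : c < numBoxes Q) :
    P.boxOf b = P.boxOf c ↔ b = c := by
  refine ⟨fun h => ?_, fun h => h ▸ rfl⟩
  refine Nat.eq_of_testBit_eq fun i => ?_
  by_cases hi : i < Fintype.card Q * Fintype.card Q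
  · have hq : 0 < Fintype.card Q := Nat.pos_of_ne_zero fun h0 => by simp [h0] at hi
    obtain ⟨p, hp⟩ := P.exists_state (Nat.div_lt_of_lt_mul hi)
    obtain ⟨p', hp'⟩ := P.exists_state (Nat.mod_lt i hq)
    have := Set.ext_iff.1 h (p, p')
    rw [mem_boxOf, mem_boxOf] at this
    simp only [hp, hp', Nat.div_add_mod'] at this
    exact Bool.eq_iff_iff.2 this
  · push Not at hi
    have hle := Nat.pow_le_pow_right (show 0 < 2 by norm_num) hi
    rw [Nat.testBit_lt_two_pow (hb.trans_le hle), Nat.testBit_lt_two_pow (hc.trans_le hle)]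

/-- The clause of those boxes in the clause with code `c` whose codes are less than `n`. -/
def clauseBelow (n c : ℕ) : Clause Q := {ρ | ∃ b < n, c.testBit b = true ∧ P.boxOf b = ρ}

theorem clauseBelow_zero (c : ℕ) : P.clauseBelow 0 c = ∅ := by
  ext; simp [clauseBelow]

theorem clauseBelow_succ_of_testBit {n c : ℕ} (h : c.testBit n = true) :
    P.clauseBelow (n + 1) c = insert (P.boxOf n) (P.clauseBelow n c) := by
  ext ρ
  simp only [clauseBelow, Set.mem_ofPred_eq, Set.mem_insert_iff, Nat.lt_succ_iff_lt_or_eq]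
  constructor
  · rintro ⟨b, hb | rfl, h1, rfl⟩
    · exact .inr ⟨b, hb, h1, rfl⟩
    · exact .inl rfl
  · rintro (rfl | ⟨b, hb, h1, rfl⟩)
    · exact ⟨n, .inr rfl, h, rfl⟩
    · exact ⟨b, .inl hb, h1, rfl⟩

theorem clauseBelow_succ_of_not_testBit {n c : ℕ} (h : ¬ c.testBit n = true) :
    P.clauseBelow (n + 1) c = P.clauseBelow n c := by
  ext ρ
  simp only [clauseBelow, Set.mem_ofPred_eq, Nat.lt_succ_iff_lt_or_eq]
  constructor
  · rintro ⟨b, hb | rfl, h1, rfl⟩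
    · exact ⟨b, hb, h1, rfl⟩
    · exact absurd h1 h
  · rintro ⟨b, hb, h1, rfl⟩
    exact ⟨b, .inl hb, h1, rfl⟩

/-- A loop over a clause meets every box only once, as `clauseComp_insert` requires. -/
theorem boxOf_notMem_clauseBelow {n c : ℕ} (hn : n < numBoxes Q) :
    P.boxOf n ∉ P.clauseBelow n c := by
  rintro ⟨b, hb, -, h⟩
  rw [P.boxOf_inj (hb.trans hn) hn] at h
  omega

theorem boxOf_mem_clauseOf {b c : ℕ} (hb : b < numBoxes Q) :
    P.boxOf b ∈ P.clauseOf c ↔ c.testBit b = true := by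
  constructor
  · rintro ⟨b', hb', h, he⟩
    rw [P.boxOf_inj hb' hb] at he
    exact he ▸ h
  · exact fun h => ⟨b, hb, h, rfl⟩

theorem clauseOf_zero : P.clauseOf 0 = ∅ := by
  ext x; simp [clauseOf]

theorem clauseOf_or (b c : ℕ) : P.clauseOf (b ||| c) = P.clauseOf b ∪ P.clauseOf c := by
  ext ρ
  obtain ⟨r, hr, rfl⟩ := P.exists_boxOf_eq ρ
  simp only [Set.mem_union, P.boxOf_mem_clauseOf hr, Nat.testBit_or, Bool.or_eq_true]

theorem clauseOf_two_pow {b : ℕ} (hb : b < numBoxes Q) : P.clauseOf (2 ^ b) = {P.boxOf b} := by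
  ext ρ
  obtain ⟨r, hr, rfl⟩ := P.exists_boxOf_eq ρ
  rw [P.boxOf_mem_clauseOf hr, Set.mem_singleton_iff, P.boxOf_inj hr hb, Nat.testBit_two_pow,
    decide_eq_true_eq, eq_comm]

theorem exists_clauseOf_eq (K : Clause Q) : ∃ c < numClauses Q, P.clauseOf c = K := by
  obtain ⟨c, hc, h⟩ := exists_testBit_eq (numBoxes Q) {b | P.boxOf b ∈ K}
  refine ⟨c, hc, ?_⟩
  ext ρ
  obtain ⟨r, hr, rfl⟩ := P.exists_boxOf_eq ρ
  rw [P.boxOf_mem_clauseOf hr, h r hr]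
  rfl

theorem clauseOf_inj {b c : ℕ} (hb : b < numClauses Q) (hc : c < numClauses Q) :
    P.clauseOf b = P.clauseOf c ↔ b = c := by
  refine ⟨fun h => ?_, fun h => h ▸ rfl⟩
  refine Nat.eq_of_testBit_eq fun i => ?_
  by_cases hi : i < numBoxes Q
  · rw [Bool.eq_iff_iff, ← P.boxOf_mem_clauseOf hi, ← P.boxOf_mem_clauseOf hi, h]
  · push Not at hi
    have hle := Nat.pow_le_pow_right (show 0 < 2 by norm_num) hi
    rw [Nat.testBit_lt_two_pow (hb.trans_le hle), Nat.testBit_lt_two_pow (hc.trans_le hle)]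

/-- Justifies the inclusion test by bitwise or in `impliesCmd`. -/
theorem clauseOf_subset {b c : ℕ} (hb : b < numClauses Q) (hc : c < numClauses Q) :
    P.clauseOf b ⊆ P.clauseOf c ↔ b ||| c = c := by
  rw [← P.clauseOf_inj (Nat.or_lt_two_pow hb hc) hc, P.clauseOf_or, Set.union_eq_right]

/-- The clauses of `F` whose codes are less than `n`. -/
def cnfBelow (n : ℕ) (F : CNF Q) : CNF Q := {K | ∃ c < n, P.clauseOf c = K ∧ K ∈ F}

theorem cnfBelow_zero (F : CNF Q) : P.cnfBelow 0 F = ∅ := by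
  ext; simp [cnfBelow]

theorem cnfBelow_numClauses (F : CNF Q) : P.cnfBelow (numClauses Q) F = F := by
  ext K
  obtain ⟨c, hc, rfl⟩ := P.exists_clauseOf_eq K
  exact ⟨fun ⟨_, _, _, h⟩ => h, fun h => ⟨c, hc, rfl, h⟩⟩

theorem cnfBelow_succ_of_mem {n : ℕ} {F : CNF Q} (h : P.clauseOf n ∈ F) :
    P.cnfBelow (n + 1) F = insert (P.clauseOf n) (P.cnfBelow n F) := by
  ext K
  simp only [cnfBelow, Set.mem_ofPred_eq, Set.mem_insert_iff, Nat.lt_succ_iff_lt_or_eq]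
  constructor
  · rintro ⟨b, hb | rfl, rfl, h1⟩
    · exact .inr ⟨b, hb, rfl, h1⟩
    · exact .inl rfl
  · rintro (rfl | ⟨b, hb, rfl, h1⟩)
    · exact ⟨n, .inr rfl, rfl, h⟩
    · exact ⟨b, .inl hb, rfl, h1⟩

theorem cnfBelow_succ_of_notMem {n : ℕ} {F : CNF Q} (h : P.clauseOf n ∉ F) :
    P.cnfBelow (n + 1) F = P.cnfBelow n F := by
  ext K
  simp only [cnfBelow, Set.mem_ofPred_eq, Nat.lt_succ_iff_lt_or_eq]
  constructor
  · rintro ⟨b, hb | rfl, rfl, h1⟩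
    · exact ⟨b, hb, rfl, h1⟩
    · exact absurd h1 h
  · rintro ⟨b, hb, rfl, h1⟩
    exact ⟨b, .inl hb, rfl, h1⟩

open Classical in
/-- The array `a` holds the table of `F` from address `base` on. -/
def Holds (a : ℕ → ℕ) (base : ℕ) (F : CNF Q) : Prop :=
  ∀ c < numClauses Q, a (base + c) = if P.clauseOf c ∈ F then 1 else 0

variable {P}

theorem Holds.formulaOf_eq {a : ℕ → ℕ} {base : ℕ} {F : CNF Q} (h : P.Holds a base F) :
    P.formulaOf a base = F := by
  ext K
  obtain ⟨c, hc, rfl⟩ := P.exists_clauseOf_eq K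
  constructor
  · rintro ⟨c', hc', h1, he⟩
    rw [h c' hc'] at h1
    rw [← he]
    by_contra hn
    simp [hn] at h1
  · intro hm
    exact ⟨c, hc, by rw [h c hc, if_pos hm], rfl⟩

theorem Holds.ne_zero_iff {a : ℕ → ℕ} {base : ℕ} {F : CNF Q} (h : P.Holds a base F) {c : ℕ}
    (hc : c < numClauses Q) : a (base + c) ≠ 0 ↔ P.clauseOf c ∈ F := by
  rw [h c hc]; simp

theorem Holds.ne_zero_iff' {a : ℕ → ℕ} {F : CNF Q} (h : P.Holds a 0 F) {c : ℕ}
    (hc : c < numClauses Q) : a c ≠ 0 ↔ P.clauseOf c ∈ F := by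
  simpa using h.ne_zero_iff hc

theorem Holds.insert {a : ℕ → ℕ} {base : ℕ} {F : CNF Q} (h : P.Holds a base F) {c : ℕ}
    (hc : c < numClauses Q) :
    P.Holds (Function.update a (base + c) 1) base (insert (P.clauseOf c) F) := by
  intro c' hc'
  rw [Function.update_apply]
  have hm : P.clauseOf c' ∈ Insert.insert (P.clauseOf c) F ↔ c' = c ∨ P.clauseOf c' ∈ F := by
    rw [Set.mem_insert_iff, P.clauseOf_inj hc' hc]
  by_cases he : c' = c
  · rw [if_pos (by rw [he]), if_pos (hm.2 (.inl he))]
  · rw [if_neg (by omega), h c' hc']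
    by_cases hF : P.clauseOf c' ∈ F
    · rw [if_pos hF, if_pos (hm.2 (.inr hF))]
    · rw [if_neg hF, if_neg fun h => (hm.1 h).elim he hF]

theorem Holds.insert' {a : ℕ → ℕ} {F : CNF Q} (h : P.Holds a 0 F) {c : ℕ}
    (hc : c < numClauses Q) :
    P.Holds (Function.update a c 1) 0 (Insert.insert (P.clauseOf c) F) := by
  simpa using h.insert hc

theorem Holds.congr {a b : ℕ → ℕ} {base base' : ℕ} {F : CNF Q} (h : P.Holds a base F)
    (hab : ∀ c < numClauses Q, b (base' + c) = a (base + c)) : P.Holds b base' F :=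
  fun c hc => (hab c hc).trans (h c hc)

end Presentation

end

/-! ## Correctness of the building blocks -/

/-- The registers and the table that `setup` computes. -/
structure Ctx (Q : Type) [Fintype Q] (σ : Store) : Prop where
  nQ : σ.reg .nQ = Fintype.card Q
  sq : σ.reg .sq = Fintype.card Q * Fintype.card Q
  k : σ.reg .k = numBoxes Q
  M : σ.reg .M = numClauses Q
  pow : ∀ i ≤ numBoxes Q, σ.arr .pow i = 2 ^ i

section

variable {N T Q : Type} [Fintype N] [Fintype T] [Fintype Q] {G : Grammar N T} {A : NFA T Q}
variable {P : Presentation G Q} {σ : Store}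

theorem Ctx.frame {c : Cmd} {τ : Store} (h : Ctx Q σ) (hf : Frame c σ τ)
    (hc : (c.writesReg .nQ || c.writesReg .sq || c.writesReg .k || c.writesReg .M ||
      c.writesArr .pow) = false := by first | decide | rfl) : Ctx Q τ := by
  simp only [Bool.or_eq_false_iff] at hc
  obtain ⟨⟨⟨⟨h1, h2⟩, h3⟩, h4⟩, h5⟩ := hc
  exact ⟨(hf.reg_eq _ h1).trans h.nQ, (hf.reg_eq _ h2).trans h.sq, (hf.reg_eq _ h3).trans h.k,
    (hf.reg_eq _ h4).trans h.M, fun i hi => by rw [hf.arr_eq _ h5, h.pow i hi]⟩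

/-- The second factor is the number of rounds, so only `v` has to be at most `M`. The first factor
may be the number of a non-terminal or terminal, which `M` does not bound. -/
theorem mulTo_spec {M u v : ℕ} {x : Reg} {e f : Expr} (hv : v ≤ M)
    (he : ∀ τ, Frame (mulTo x e f) σ τ → e.eval τ = u)
    (hf : ∀ τ, Frame (mulTo x e f) σ τ → f.eval τ = v) (hx : x ≠ .m) :
    Spec M σ (mulTo x e f) (fun τ => τ.reg x = u * v) := by
  refine Spec.set_seq fun σ₁ f₁ hσ₁ => ?_
  have h0 : Frame (mulTo x e f) σ σ₁ :=
    f₁.weaken (by simp +contextual [mulTo, forTo, Cmd.writesReg])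
      (by simp +contextual [mulTo, forTo, Cmd.writesArr])
  have h1 : ∀ τ, Frame (forTo .m f (.set x (.add (.reg x) e))) σ₁ τ →
      Frame (mulTo x e f) σ τ := fun τ h => h0.trans
    (h.weaken (by simp +contextual [mulTo, forTo, Cmd.writesReg])
      (by simp +contextual [mulTo, forTo, Cmd.writesArr]))
  refine Spec.forTo v hv (fun τ h => hf τ (h1 τ h)) (fun i τ => τ.reg x = u * i) ?_ ?_ ?_
  · simp [Store.setReg_reg, Expr.eval, hx, hσ₁]
  · intro i hi τ hτ _ h
    refine Spec.set ?_
    simp [Store.setReg_reg, Expr.eval, hx, h, he τ (h1 τ hτ), mul_add]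
  · simpa [Cmd.writesReg] using hx.symm

theorem clearArr_spec (hC : Ctx Q σ) (a : Arr) :
    Spec (numClauses Q) σ (clearArr a) (fun τ => P.Holds (τ.arr a) 0 ∅) := by
  refine Spec.forReg (numClauses Q) le_rfl hC.M (fun i τ => ∀ c < i, τ.arr a c = 0) (by simp) ?_ ?_
  · intro i hi τ hf hx h
    refine Spec.store ?_
    intro c hc
    simp only [Store.setReg_arr, Store.setArr_arr_self, Expr.eval, hx, Function.update_apply]
    split_ifs with h1
    · rfl
    · exact h c (by omega)
  · intro τ _ h c hc
    simp [h c hc]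

theorem copyArr_spec (hC : Ctx Q σ) {a b : Arr} (hab : b ≠ a) :
    Spec (numClauses Q) σ (copyArr a b)
      (fun τ => ∀ c < numClauses Q, τ.arr a c = σ.arr b c) := by
  refine Spec.forReg (numClauses Q) le_rfl hC.M
    (fun i τ => ∀ c < i, τ.arr a c = σ.arr b c) (by simp) ?_ fun τ _ h => h
  intro i hi τ hf hx h
  refine Spec.store ?_
  intro c hc
  have hb := hf.arr_eq b (by simpa [forTo, Cmd.writesArr] using hab)
  simp only [Store.setReg_arr, Store.setArr_arr_self, Expr.eval, hx, Function.update_apply, hb]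
  split_ifs with h1
  · rw [h1]
  · exact h c (by omega)

theorem copyArr_holds (hC : Ctx Q σ) {a b : Arr} (hab : b ≠ a) {F : CNF Q}
    (h : P.Holds (σ.arr b) 0 F) :
    Spec (numClauses Q) σ (copyArr a b) (fun τ => P.Holds (τ.arr a) 0 F) :=
  (copyArr_spec hC hab).conseq fun τ _ hτ => h.congr fun c hc => by simpa using hτ c hc

theorem loadArr_spec (hC : Ctx Q σ) {a b : Arr} (hab : b ≠ a) {F : CNF Q}
    (hF : P.Holds (σ.arr b) (σ.reg .base) F) :
    Spec (numClauses Q) σ (loadArr a b) (fun τ => P.Holds (τ.arr a) 0 F) := by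
  refine Spec.forReg (numClauses Q) le_rfl hC.M
    (fun i τ => ∀ c < i, τ.arr a c = σ.arr b (σ.reg .base + c)) (by simp) ?_ ?_
  · intro i hi τ hf hx h
    refine Spec.store ?_
    intro c hc
    have hb := hf.arr_eq b (by simpa [forTo, Cmd.writesArr] using hab)
    have hbase : τ.reg .base = σ.reg .base := hf.reg .base rfl
    simp only [Store.setReg_arr, Store.setArr_arr_self, Expr.eval, hx, Function.update_apply, hb,
      hbase]
    split_ifs with h1
    · rw [h1]
    · exact h c (by omega)
  · exact fun τ _ hτ => hF.congr fun c hc => by simpa using hτ c hc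

/-- Writing the cells `base, ..., base + numClauses - 1` of `b`, with values given by `e`. -/
theorem fill_spec (hC : Ctx Q σ) {b : Arr} {e : Expr} {v : ℕ → ℕ}
    (he : ∀ τ i, Frame (forTo .i (.reg .M) (.store b (.add (.reg .base) (.reg .i)) e)) σ τ →
      τ.reg .i = i → e.eval τ = v i) :
    Spec (numClauses Q) σ (forTo .i (.reg .M) (.store b (.add (.reg .base) (.reg .i)) e))
      (fun τ => (∀ c < numClauses Q, τ.arr b (σ.reg .base + c) = v c) ∧
        ∀ c, ¬ (σ.reg .base ≤ c ∧ c < σ.reg .base + numClauses Q) →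
          τ.arr b c = σ.arr b c) := by
  refine Spec.forReg (numClauses Q) le_rfl hC.M
    (fun i τ => (∀ c < i, τ.arr b (σ.reg .base + c) = v c) ∧
        ∀ c, ¬ (σ.reg .base ≤ c ∧ c < σ.reg .base + i) → τ.arr b c = σ.arr b c)
    ⟨by simp, by simp⟩ ?_ fun τ _ h => h
  rintro i hi τ hf hx ⟨h, h'⟩
  refine Spec.store ?_
  have hv := he τ i hf hx
  have hbase : τ.reg .base = σ.reg .base := hf.reg .base rfl
  simp only [Store.setReg_arr, Store.setArr_arr_self, Expr.eval, hx, Function.update_apply,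
    hbase, hv]
  constructor
  · intro c hc
    split_ifs with h1
    · rw [Nat.add_left_cancel h1]
    · exact h c (by omega)
  · intro c hc
    rw [if_neg (by omega)]
    exact h' c (by omega)

theorem saveArr_spec (hC : Ctx Q σ) {a b : Arr} (hab : a ≠ b) :
    Spec (numClauses Q) σ (saveArr b a)
      (fun τ => (∀ c < numClauses Q, τ.arr b (σ.reg .base + c) = σ.arr a c) ∧
        ∀ c, ¬ (σ.reg .base ≤ c ∧ c < σ.reg .base + numClauses Q) →
          τ.arr b c = σ.arr b c) := by
  refine fill_spec hC fun τ i hf hi => ?_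
  simp [Expr.eval, hi, hf.arr_eq a (by simpa [forTo, Cmd.writesArr] using hab)]

/-- Composition of the pair `(p, p')` with the box `tau`. -/
def pairCompCmd : Cmd :=
  forTo .p3 (.reg .nQ)
    (when (.bit (.reg .tau) (.add (.reg .row2) (.reg .p3)))
      (.set .box (.lor (.reg .box) (.read .pow (.add (.reg .row1) (.reg .p3))))))

theorem pairCompCmd_spec (hC : Ctx Q σ) {p p' : Q} (hp : σ.reg .row1 = P.eQ p * Fintype.card Q)
    (hp' : σ.reg .row2 = P.eQ p' * Fintype.card Q) (hbox : σ.reg .box < numBoxes Q) :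
    Spec (numClauses Q) σ pairCompCmd (fun τ => τ.reg .box < numBoxes Q ∧
      P.boxOf (τ.reg .box) = P.boxOf (σ.reg .box) ∪
        {x | x.1 = p ∧ (p', x.2) ∈ P.boxOf (σ.reg .tau)}) := by
  refine Spec.forReg (Fintype.card Q) card_le_numClauses hC.nQ
    (fun i τ => τ.reg .box < numBoxes Q ∧ P.boxOf (τ.reg .box) = P.boxOf (σ.reg .box) ∪
        {x | x.1 = p ∧ (P.eQ x.2 : ℕ) < i ∧ (p', x.2) ∈ P.boxOf (σ.reg .tau)}) ?_ ?_ ?_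
  · simpa [Store.setReg_reg] using hbox
  · rintro i hi τ f hp3 ⟨h1, h2⟩
    obtain ⟨p'', rfl⟩ := P.exists_state hi
    have hrow1 := (f.reg .row1).trans hp
    have hrow2 := (f.reg .row2).trans hp'
    have hlt : (P.eQ p : ℕ) * Fintype.card Q + P.eQ p'' < Fintype.card Q * Fintype.card Q :=
      row_add_lt (P.eQ p).2 (P.eQ p'').2
    have hpow : τ.arr .pow (P.eQ p * Fintype.card Q + P.eQ p'') =
        2 ^ (P.eQ p * Fintype.card Q + P.eQ p'' : ℕ) :=
      (hC.frame f).pow _ (hlt.le.trans card_mul_card_lt_numBoxes.le)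
    have hbit : (Expr.bit (.reg .tau) (.add (.reg .row2) (.reg .p3))).eval τ ≠ 0 ↔
        (p', p'') ∈ P.boxOf (σ.reg .tau) := by
      simp [Expr.eval, f.reg .tau, hrow2, hp3, Presentation.mem_boxOf]
    refine Spec.when (fun h => Spec.set ?_) fun h => ?_
    · rw [hbit] at h
      simp only [Store.setReg_reg, reduceCtorEq, if_false, if_true, Expr.eval, hrow1, hp3, hpow]
      refine ⟨Nat.or_lt_two_pow h1 (Nat.pow_lt_pow_right (by norm_num) hlt), ?_⟩
      rw [P.boxOf_or, h2, P.boxOf_two_pow (P.eQ p'').2, Set.union_assoc]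
      congr 1
      ext ⟨x, y⟩
      simp only [Set.mem_union, Set.mem_ofPred_eq, Nat.lt_succ_iff_lt_or_eq, P.state_inj]
      constructor
      · rintro (⟨rfl, h3, h4⟩ | ⟨rfl, rfl⟩)
        · exact ⟨rfl, .inl h3, h4⟩
        · exact ⟨rfl, .inr rfl, h⟩
      · rintro ⟨rfl, h3 | rfl, h4⟩
        · exact .inl ⟨rfl, h3, h4⟩
        · exact .inr ⟨rfl, rfl⟩
    · have h := mt hbit.2 (not_not.2 h)
      simp only [Store.setReg_reg, reduceCtorEq, if_false]
      refine ⟨h1, h2.trans ?_⟩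
      congr 1
      ext ⟨x, y⟩
      simp only [Set.mem_ofPred_eq, Nat.lt_succ_iff_lt_or_eq, P.state_inj]
      constructor
      · rintro ⟨rfl, h3, h4⟩
        exact ⟨rfl, .inl h3, h4⟩
      · rintro ⟨rfl, h3 | rfl, h4⟩
        · exact ⟨rfl, h3, h4⟩
        · exact absurd h4 h
  · rintro τ - ⟨h1, h2⟩
    refine ⟨h1, h2.trans ?_⟩
    simp

/-- Composition of the pairs in row `p` of the box `rho` with the box `tau`. -/
def rowCompCmd : Cmd :=
  .set .row2 (.lit 0) ;;
  forTo .p2 (.reg .nQ) (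
    when (.bit (.reg .rho) (.add (.reg .row1) (.reg .p2))) pairCompCmd ;;
    .set .row2 (.add (.reg .row2) (.reg .nQ)))

theorem rowCompCmd_spec (hC : Ctx Q σ) {p : Q} (hp : σ.reg .row1 = P.eQ p * Fintype.card Q)
    (hbox : σ.reg .box < numBoxes Q) :
    Spec (numClauses Q) σ rowCompCmd (fun τ => τ.reg .box < numBoxes Q ∧
      P.boxOf (τ.reg .box) = P.boxOf (σ.reg .box) ∪
        {x | x.1 = p ∧ x ∈ boxComp (P.boxOf (σ.reg .rho)) (P.boxOf (σ.reg .tau))}) := by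
  refine Spec.set_seq fun σ₁ f₁ hrow2 => ?_
  have hC₁ := hC.frame f₁
  rw [← f₁.reg .rho, ← f₁.reg .tau, ← f₁.reg .box]
  rw [← f₁.reg .row1] at hp
  rw [← f₁.reg .box] at hbox
  refine Spec.forReg (Fintype.card Q) card_le_numClauses hC₁.nQ
    (fun i τ => τ.reg .row2 = i * Fintype.card Q ∧ τ.reg .box < numBoxes Q ∧
      P.boxOf (τ.reg .box) = P.boxOf (σ₁.reg .box) ∪
        {x | x.1 = p ∧ ∃ y, (P.eQ y : ℕ) < i ∧ (x.1, y) ∈ P.boxOf (σ₁.reg .rho) ∧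
          (y, x.2) ∈ P.boxOf (σ₁.reg .tau)}) ?_ ?_ ?_
  · simpa [Store.setReg_reg, hrow2, Expr.eval] using hbox
  · rintro i hi τ f hp2 ⟨hrow, h1, h2⟩
    obtain ⟨p', rfl⟩ := P.exists_state hi
    have hbit : (Expr.bit (.reg .rho) (.add (.reg .row1) (.reg .p2))).eval τ ≠ 0 ↔
        (p, p') ∈ P.boxOf (σ₁.reg .rho) := by
      simp [Expr.eval, f.reg .rho, f.reg .row1, hp, hp2, Presentation.mem_boxOf]
    refine Spec.seq (R' := fun τ => τ.reg .box < numBoxes Q ∧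
      P.boxOf (τ.reg .box) = P.boxOf (σ₁.reg .box) ∪
        {x | x.1 = p ∧ ∃ y, (P.eQ y : ℕ) < P.eQ p' + 1 ∧ (x.1, y) ∈ P.boxOf (σ₁.reg .rho) ∧
          (y, x.2) ∈ P.boxOf (σ₁.reg .tau)}) (Spec.when (fun h => ?_) fun h => ?_) ?_
    · rw [hbit] at h
      refine (pairCompCmd_spec (hC₁.frame f) ((f.reg .row1).trans hp) hrow h1).conseq ?_
      rintro υ - ⟨h3, h4⟩
      refine ⟨h3, h4.trans ?_⟩
      rw [h2, f.reg .tau, Set.union_assoc]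
      congr 1
      ext ⟨x, y⟩
      simp only [Set.mem_union, Set.mem_ofPred_eq, Nat.lt_succ_iff_lt_or_eq, P.state_inj]
      constructor
      · rintro (⟨rfl, z, h5, h6⟩ | ⟨rfl, h5⟩)
        · exact ⟨rfl, z, .inl h5, h6⟩
        · exact ⟨rfl, p', .inr rfl, h, h5⟩
      · rintro ⟨rfl, z, h5 | rfl, h6⟩
        · exact .inl ⟨rfl, z, h5, h6⟩
        · exact .inr ⟨rfl, h6.2⟩
    · have h := mt hbit.2 (not_not.2 h)
      refine ⟨h1, h2.trans ?_⟩
      congr 1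
      ext ⟨x, y⟩
      simp only [Set.mem_ofPred_eq, Nat.lt_succ_iff_lt_or_eq, P.state_inj]
      constructor
      · rintro ⟨rfl, z, h5, h6⟩
        exact ⟨rfl, z, .inl h5, h6⟩
      · rintro ⟨rfl, z, h5 | rfl, h6⟩
        · exact ⟨rfl, z, h5, h6⟩
        · exact absurd h6.1 h
    · rintro υ f' ⟨h3, h4⟩
      refine Spec.set ?_
      simp [Store.setReg_reg, Expr.eval, h3, h4, (f'.reg .row2).trans hrow,
        ((hC₁.frame f).frame f').nQ, add_mul]
  · rintro τ - ⟨-, h1, h2⟩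
    refine ⟨h1, h2.trans ?_⟩
    simp [boxComp]

theorem boxCompCmd_spec (hC : Ctx Q σ) :
    Spec (numClauses Q) σ boxCompCmd (fun τ => τ.reg .box < numBoxes Q ∧
      P.boxOf (τ.reg .box) = boxComp (P.boxOf (σ.reg .rho)) (P.boxOf (σ.reg .tau))) := by
  refine Spec.set_seq fun σ₁ f₁ hbox₁ => Spec.set_seq fun σ₂ f₂ hrow₂ => ?_
  have hC₂ : Ctx Q σ₂ := (hC.frame f₁).frame f₂
  have hbox₂ : σ₂.reg .box = 0 := (f₂.reg .box).trans hbox₁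
  rw [← f₁.reg .rho, ← f₁.reg .tau, ← f₂.reg .rho, ← f₂.reg .tau]
  refine Spec.forReg (Fintype.card Q) card_le_numClauses hC₂.nQ
    (fun i τ => τ.reg .row1 = i * Fintype.card Q ∧ τ.reg .box < numBoxes Q ∧
      P.boxOf (τ.reg .box) = {x | (P.eQ x.1 : ℕ) < i ∧
        x ∈ boxComp (P.boxOf (σ₂.reg .rho)) (P.boxOf (σ₂.reg .tau))}) ?_ ?_ ?_
  · simp [Store.setReg_reg, Expr.eval, P.boxOf_zero, hrow₂, hbox₂]
  · rintro i hi τ f - ⟨hrow, hlt, hbox⟩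
    obtain ⟨p, rfl⟩ := P.exists_state hi
    -- The body of the loop is `rowCompCmd` followed by an assignment, but bracketed differently.
    refine Spec.seq_assoc (Spec.seq (rowCompCmd_spec (hC₂.frame f) hrow hlt) ?_)
    rintro υ f' ⟨h1, h2⟩
    refine Spec.set ?_
    rw [f.reg .rho, f.reg .tau] at h2
    have hr : υ.reg .row1 = P.eQ p * Fintype.card Q := (f'.reg .row1).trans hrow
    simp only [Store.setReg_reg, reduceCtorEq, if_false, if_true, Expr.eval, hr,
      ((hC₂.frame f).frame f').nQ, add_mul, one_mul, true_and]
    refine ⟨h1, h2.trans ?_⟩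
    rw [hbox]
    ext ⟨x, y⟩
    simp only [Set.mem_union, Set.mem_ofPred_eq, Nat.lt_succ_iff_lt_or_eq, P.state_inj]
    tauto
  · rintro τ - ⟨-, h1, h2⟩
    refine ⟨h1, h2.trans ?_⟩
    ext x; simp

theorem prefixCmd_spec (hC : Ctx Q σ) :
    Spec (numClauses Q) σ prefixCmd (fun τ => τ.reg .cl < numClauses Q ∧
      P.clauseOf (τ.reg .cl) =
        (fun τ => boxComp (P.boxOf (σ.reg .rho)) τ) '' P.clauseOf (σ.reg .H)) := by
  refine Spec.set_seq fun σ₁ f₁ hcl => ?_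
  have hC₁ := hC.frame f₁
  rw [← f₁.reg .rho, ← f₁.reg .H]
  refine Spec.forReg (numBoxes Q) numBoxes_lt_numClauses.le hC₁.k
    (fun i τ => τ.reg .cl < numClauses Q ∧ P.clauseOf (τ.reg .cl) =
      (fun τ => boxComp (P.boxOf (σ₁.reg .rho)) τ) '' P.clauseBelow i (σ₁.reg .H)) ?_ ?_ ?_
  · simp [Store.setReg_reg, Expr.eval, hcl, P.clauseOf_zero, P.clauseBelow_zero]
  · rintro i hi τ f htau ⟨h1, h2⟩
    have hbit : (Expr.bit (.reg .H) (.reg .tau)).eval τ ≠ 0 ↔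
        (σ₁.reg .H).testBit i = true := by
      simp [Expr.eval, f.reg .H, htau]
    refine Spec.when (fun h => ?_) fun h => ?_
    · rw [hbit] at h
      refine Spec.seq (boxCompCmd_spec (P := P) (hC₁.frame f)) ?_
      rintro υ f' ⟨h3, h4⟩
      refine Spec.set ?_
      have hpow : υ.arr .pow (υ.reg .box) = 2 ^ υ.reg .box :=
        ((hC₁.frame f).frame f').pow _ h3.le
      simp only [Store.setReg_reg, reduceCtorEq, if_false, if_true, Expr.eval, hpow,
        f'.reg .cl]
      refine ⟨Nat.or_lt_two_pow h1 (Nat.pow_lt_pow_right (by norm_num) h3), ?_⟩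
      rw [P.clauseOf_or, h2, P.clauseOf_two_pow h3, h4, htau, f.reg .rho,
        P.clauseBelow_succ_of_testBit h, Set.image_insert_eq, Set.union_singleton]
    · have h := mt hbit.2 (not_not.2 h)
      simp only [Store.setReg_reg, reduceCtorEq, if_false]
      exact ⟨h1, by rw [h2, P.clauseBelow_succ_of_not_testBit h]⟩
  · exact fun τ _ h => h

end

/-- The clauses that the clause `K` contributes to a relational composition with `F`. -/
def clauseComp {Q : Type} (K : Clause Q) (F : CNF Q) : CNF Q :=
  {C | ∃ z : Box Q → Clause Q, (∀ ρ ∈ K, z ρ ∈ F) ∧ C = ⋃ ρ ∈ K, (fun τ => boxComp ρ τ) '' z ρ}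

theorem cnfComp_eq {Q : Type} (F F' : CNF Q) : cnfComp F F' = ⋃ K ∈ F, clauseComp K F' := by
  ext C; simp [cnfComp, clauseComp]

theorem clauseComp_empty {Q : Type} (F : CNF Q) : clauseComp ∅ F = {∅} := by
  ext C
  simp only [clauseComp, Set.mem_ofPred_eq, Set.mem_singleton_iff]
  exact ⟨fun ⟨z, _, h⟩ => by simpa using h, fun h => ⟨fun _ => ∅, by simp, by simpa using h⟩⟩

/-- The recursion behind the array `part` in `compCmd`. A choice on `K` extends independently to a
new box; if `ρ` were already in `K`, changing the choice at `ρ` would alter the old part. -/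
theorem clauseComp_insert {Q : Type} {K : Clause Q} {ρ : Box Q} (hρ : ρ ∉ K) (F : CNF Q) :
    clauseComp (insert ρ K) F =
      Set.image2 (· ∪ ·) (clauseComp K F) ((fun H => (fun τ => boxComp ρ τ) '' H) '' F) := by
  classical
  ext C
  simp only [Set.mem_image2, clauseComp, Set.mem_ofPred_eq]
  constructor
  · rintro ⟨z, hz, rfl⟩
    refine ⟨_, ⟨z, fun ρ' h => hz ρ' (.inr h), rfl⟩, _, ⟨z ρ, hz ρ (.inl rfl), rfl⟩, ?_⟩
    rw [Set.biUnion_insert, Set.union_comm]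
  · rintro ⟨_, ⟨z, hz, rfl⟩, _, ⟨H, hH, rfl⟩, rfl⟩
    refine ⟨Function.update z ρ H, ?_, ?_⟩
    · rintro ρ' (rfl | h)
      · simpa using hH
      · rw [Function.update_of_ne (ne_of_mem_of_not_mem h hρ)]
        exact hz ρ' h
    · rw [Set.biUnion_insert, Set.union_comm, Function.update_self]
      congr 1
      refine Set.iUnion₂_congr fun ρ' h => ?_
      rw [Function.update_of_ne (ne_of_mem_of_not_mem h hρ)]

/-! ### Loops over clauses and boxes, and the operations on tables -/

section

variable {N T Q : Type} [Fintype N] [Fintype T] [Fintype Q] {G : Grammar N T} {A : NFA T Q}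
variable {P : Presentation G Q} {σ : Store}

/-- A loop over the clauses of `F`; the invariant depends on the set of the clauses visited. -/
theorem forClauses_spec {x : Reg} {e : Expr} {c : Cmd} {R : Store → Prop} (F : CNF Q)
    (hC : Ctx Q σ)
    (he : ∀ τ i, Frame (forTo x (.reg .M) (when e c)) σ τ → τ.reg x = i → i < numClauses Q →
      (e.eval τ ≠ 0 ↔ P.clauseOf i ∈ F))
    (Inv : CNF Q → Store → Prop) (hInv : ∀ S τ v, Inv S τ → Inv S (τ.setReg x v))
    (h0 : Inv ∅ σ)
    (hs : ∀ K ∈ F, ∀ S, ∀ τ, Frame (forTo x (.reg .M) (when e c)) σ τ →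
      τ.reg x < numClauses Q → P.clauseOf (τ.reg x) = K → Inv S τ →
      Spec (numClauses Q) τ c (Inv (insert K S)))
    (hR : ∀ τ, Frame (forTo x (.reg .M) (when e c)) σ τ → Inv F τ → R τ)
    (hx : (when e c).writesReg x = false := by first | decide | rfl)
    (hM : (forTo x (.reg .M) (when e c)).writesReg .M = false := by first | decide | rfl) :
    Spec (numClauses Q) σ (forTo x (.reg .M) (when e c)) R := by
  refine Spec.forReg (numClauses Q) le_rfl hC.M (fun i τ => Inv (P.cnfBelow i F) τ) ?_ ?_ ?_ hx hM
  · rw [P.cnfBelow_zero]; exact hInv _ _ _ h0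
  · intro i hi τ f hxi h
    refine Spec.when (fun h1 => ?_) fun h1 => ?_
    · rw [he τ i f hxi hi] at h1
      refine (hs _ h1 _ τ f (hxi ▸ hi) (by rw [hxi]) h).conseq fun υ _ hυ => ?_
      rw [P.cnfBelow_succ_of_mem h1]
      exact hInv _ _ _ hυ
    · have h1 := mt (he τ i f hxi hi).2 (not_not.2 h1)
      rw [P.cnfBelow_succ_of_notMem h1]
      exact hInv _ _ _ h
  · intro τ f h
    rw [P.cnfBelow_numClauses] at h
    exact hR τ f h

/-- A loop over the boxes of the clause in register `K`. -/
theorem forBoxes_spec {c : Cmd} {R : Store → Prop} (hC : Ctx Q σ)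
    (Inv : Clause Q → Store → Prop) (hInv : ∀ S τ v, Inv S τ → Inv S (τ.setReg .rho v))
    (h0 : Inv ∅ σ)
    (hs : ∀ ρ S, ρ ∉ S → ∀ τ,
      Frame (forTo .rho (.reg .k) (when (.bit (.reg .K) (.reg .rho)) c)) σ τ →
      τ.reg .rho < numBoxes Q → P.boxOf (τ.reg .rho) = ρ → Inv S τ →
      Spec (numClauses Q) τ c (Inv (insert ρ S)))
    (hR : ∀ τ, Frame (forTo .rho (.reg .k) (when (.bit (.reg .K) (.reg .rho)) c)) σ τ →
      Inv (P.clauseOf (σ.reg .K)) τ → R τ)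
    (hx : (when (.bit (.reg .K) (.reg .rho)) c).writesReg .rho = false := by first | decide | rfl)
    (hk : (forTo .rho (.reg .k) (when (.bit (.reg .K) (.reg .rho)) c)).writesReg .k = false
      := by first | decide | rfl)
    (hK : (forTo .rho (.reg .k) (when (.bit (.reg .K) (.reg .rho)) c)).writesReg .K = false
      := by first | decide | rfl) :
    Spec (numClauses Q) σ (forTo .rho (.reg .k) (when (.bit (.reg .K) (.reg .rho)) c)) R := by
  refine Spec.forReg (numBoxes Q) numBoxes_lt_numClauses.le hC.k
    (fun i τ => Inv (P.clauseBelow i (σ.reg .K)) τ) ?_ ?_ ?_ hx hk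
  · rw [P.clauseBelow_zero]; exact hInv _ _ _ h0
  · intro i hi τ f hxi h
    have hbit : (Expr.bit (.reg .K) (.reg .rho)).eval τ ≠ 0 ↔ (σ.reg .K).testBit i = true := by
      simp [Expr.eval, f.reg_eq _ hK, hxi]
    refine Spec.when (fun h1 => ?_) fun h1 => ?_
    · rw [hbit] at h1
      refine (hs (P.boxOf i) _ (P.boxOf_notMem_clauseBelow hi) τ f (hxi ▸ hi) (by rw [hxi])
        h).conseq fun υ _ hυ => ?_
      rw [P.clauseBelow_succ_of_testBit h1]
      exact hInv _ _ _ hυ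
    · have h1 := mt hbit.2 (not_not.2 h1)
      rw [P.clauseBelow_succ_of_not_testBit h1]
      exact hInv _ _ _ h
  · exact hR

theorem conjCmd_spec (hC : Ctx Q σ) {F F' : CNF Q} (hF : P.Holds (σ.arr .acc) 0 F)
    (hF' : P.Holds (σ.arr .arg) 0 F') :
    Spec (numClauses Q) σ conjCmd (fun τ => P.Holds (τ.arr .acc) 0 (F ∪ F')) := by
  refine forClauses_spec (P := P) F' hC ?_ (fun S τ => P.Holds (τ.arr .acc) 0 (F ∪ S))
    (fun _ _ _ h => h) (by simpa using hF) ?_ fun _ _ h => h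
  · rintro τ i f rfl hi
    simpa [Expr.eval, f.arr .arg] using hF'.ne_zero_iff' hi
  · rintro K - S τ f hlt rfl h
    refine Spec.store ?_
    simpa [Expr.eval] using h.insert' hlt

theorem disjCmd_spec (hC : Ctx Q σ) {F F' : CNF Q} (hF : P.Holds (σ.arr .acc) 0 F)
    (hF' : P.Holds (σ.arr .arg) 0 F') :
    Spec (numClauses Q) σ disjCmd
      (fun τ => P.Holds (τ.arr .acc) 0 (Set.image2 (· ∪ ·) F F')) := by
  refine Spec.seq (clearArr_spec (P := P) hC .tmp) fun σ₁ f₁ htmp => ?_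
  have hC₁ := hC.frame f₁
  rw [← f₁.arr .acc] at hF
  rw [← f₁.arr .arg] at hF'
  refine Spec.seq (forClauses_spec (P := P) F hC₁ ?_
    (fun S τ => P.Holds (τ.arr .tmp) 0 (Set.image2 (· ∪ ·) S F'))
    (fun _ _ _ h => h) (by simpa using htmp) ?_ fun _ _ h => h) ?_
  · rintro τ i f rfl hi
    simpa [Expr.eval, f.arr .acc] using hF.ne_zero_iff' hi
  · rintro K - S τ f hlt rfl h
    refine forClauses_spec (P := P) F' (hC₁.frame f) ?_
      (fun S' υ => P.Holds (υ.arr .tmp) 0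
        (Set.image2 (· ∪ ·) S F' ∪ (P.clauseOf (τ.reg .K) ∪ ·) '' S'))
      (fun _ _ _ h => h) (by simpa using h) ?_ ?_
    · rintro υ i f' rfl hi
      simpa [Expr.eval, f'.arr .arg, f.arr .arg] using hF'.ne_zero_iff' hi
    · rintro K' - S' υ f' hlt' rfl h
      refine Spec.store ?_
      have := h.insert' (Nat.or_lt_two_pow hlt hlt')
      rw [P.clauseOf_or] at this
      simpa [Expr.eval, f'.reg .K, Set.image_insert_eq] using this
    · intro υ _ h
      rwa [Set.image2_insert_left, Set.union_comm]
  · intro σ₂ f₂ h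
    exact copyArr_holds (hC₁.frame f₂) (by decide) h

/-- The outer loop unites the contributions `clauseComp K F'` of the clauses visited. For one `K`,
the loop over its boxes builds the contribution by `clauseComp_insert`; its two inner loops form all
unions of an old partial clause with a prefixed clause of `F'`. -/
theorem compCmd_spec (hC : Ctx Q σ) {F F' : CNF Q} (hF : P.Holds (σ.arr .acc) 0 F)
    (hF' : P.Holds (σ.arr .arg) 0 F') :
    Spec (numClauses Q) σ compCmd (fun τ => P.Holds (τ.arr .acc) 0 (cnfComp F F')) := by
  refine Spec.seq (clearArr_spec (P := P) hC .res) fun σ₁ f₁ hres => ?_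
  have hC₁ := hC.frame f₁
  rw [← f₁.arr .acc] at hF
  rw [← f₁.arr .arg] at hF'
  refine Spec.seq (forClauses_spec (P := P) F hC₁ ?_
    (fun S τ => P.Holds (τ.arr .res) 0 (⋃ K ∈ S, clauseComp K F'))
    (fun _ _ _ h => h) (by simpa using hres) ?_ fun _ _ h => h) ?_
  · rintro τ i f rfl hi
    simpa [Expr.eval, f.arr .acc] using hF.ne_zero_iff' hi
  · rintro K - S τ f hlt rfl hres
    have hC₂ := hC₁.frame f
    replace hF' : P.Holds (τ.arr .arg) 0 F' := by rwa [f.arr .arg]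
    clear f
    refine Spec.seq (clearArr_spec (P := P) hC₂ .part) fun τ₁ g₁ hpart => ?_
    refine Spec.store_seq fun τ₂ g₂ hpart₂ => ?_
    have hC₃ := (hC₂.frame g₁).frame g₂
    replace hF' : P.Holds (τ₂.arr .arg) 0 F' := by rwa [g₂.arr .arg, g₁.arr .arg]
    replace hres : P.Holds (τ₂.arr .res) 0 (⋃ K ∈ S, clauseComp K F') := by
      rwa [g₂.arr .res, g₁.arr .res]
    -- Before any box is visited, the only partial union is the empty clause, whose code is `0`.
    have hpart₃ : P.Holds (τ₂.arr .part) 0 (clauseComp ∅ F') := by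
      rw [hpart₂, clauseComp_empty, ← P.clauseOf_zero]
      simpa [Expr.eval] using hpart.insert' (Nat.two_pow_pos _)
    rw [← g₁.reg .K, ← g₂.reg .K]
    refine Spec.seq (forBoxes_spec (P := P) hC₃
      (fun S τ => P.Holds (τ.arr .part) 0 (clauseComp S F')) (fun _ _ _ h => h) hpart₃ ?_
      fun _ _ h => h) ?_
    · rintro ρ S hρ υ f hρlt rfl hpart
      have hC₄ := hC₃.frame f
      replace hF' : P.Holds (υ.arr .arg) 0 F' := by rwa [f.arr .arg]
      clear f
      refine Spec.seq (clearArr_spec (P := P) hC₄ .tmp) fun υ₁ g₁ htmp => ?_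
      have hC₅ := hC₄.frame g₁
      rw [← g₁.arr .part] at hpart
      rw [← g₁.arr .arg] at hF'
      rw [← g₁.reg .rho] at hρ ⊢
      refine Spec.seq (forClauses_spec (P := P) F' hC₅ ?_
        (fun S' τ => P.Holds (τ.arr .tmp) 0 (Set.image2 (· ∪ ·) (clauseComp S F')
          ((fun H => (fun τ => boxComp (P.boxOf (υ₁.reg .rho)) τ) '' H) '' S')))
        (fun _ _ _ h => h) (by simpa using htmp) ?_ fun _ _ h => h) ?_
      · rintro τ i f rfl hi
        simpa [Expr.eval, f.arr .arg] using hF'.ne_zero_iff' hi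
      · rintro H - S' ω f hlt' rfl htmp
        refine Spec.seq (prefixCmd_spec (P := P) (hC₅.frame f)) fun ω₁ f₁ hcl => ?_
        obtain ⟨hcl, hcl'⟩ := hcl
        have hpart₁ : P.Holds (ω₁.arr .part) 0 (clauseComp S F') := by
          rwa [f₁.arr .part, f.arr .part]
        refine forClauses_spec (P := P) (clauseComp S F') ((hC₅.frame f).frame f₁) ?_
          (fun S'' τ => P.Holds (τ.arr .tmp) 0 (Set.image2 (· ∪ ·) (clauseComp S F')
            ((fun H => (fun τ => boxComp (P.boxOf (υ₁.reg .rho)) τ) '' H) '' S') ∪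
              (· ∪ P.clauseOf (ω₁.reg .cl)) '' S''))
          (fun _ _ _ h => h) (by rw [← f₁.arr .tmp] at htmp; simpa using htmp) ?_ ?_
        · rintro τ i f rfl hi
          simpa [Expr.eval, f.arr .part] using hpart₁.ne_zero_iff' hi
        · rintro J - S'' τ f hlt'' rfl h
          refine Spec.store ?_
          have := h.insert' (Nat.or_lt_two_pow hlt'' hcl)
          rw [P.clauseOf_or] at this
          simpa [Expr.eval, f.reg .cl, Set.image_insert_eq] using this
        · intro τ _ h
          rw [hcl', f.reg .rho] at h
          rwa [Set.image_insert_eq, Set.image2_insert_right, Set.union_comm]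
      · intro υ₂ f₂ h
        rw [clauseComp_insert hρ]
        exact copyArr_holds (hC₅.frame f₂) (by decide) h
    · intro τ₃ f₃ hpart
      rw [← f₃.arr .res] at hres
      refine forClauses_spec (P := P) (clauseComp (P.clauseOf (τ₂.reg .K)) F') (hC₃.frame f₃) ?_
        (fun S' τ => P.Holds (τ.arr .res) 0 ((⋃ K ∈ S, clauseComp K F') ∪ S'))
        (fun _ _ _ h => h) (by simpa using hres) ?_ ?_
      · rintro τ i f rfl hi
        simpa [Expr.eval, f.arr .part] using hpart.ne_zero_iff' hi
      · rintro J - S'' τ f hlt'' rfl h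
        refine Spec.store ?_
        simpa [Expr.eval] using h.insert' hlt''
      · intro τ _ h
        rwa [Set.biUnion_insert, Set.union_comm]
  · intro σ₂ f₂ h
    rw [cnfComp_eq]
    exact copyArr_holds (hC₁.frame f₂) (by decide) h

end

/-- No register and no array of the input or of the result of `setup` is written. -/
def Cmd.preserves (c : Cmd) : Bool :=
  ([.nQ, .sq, .k, .M, .idb, .nN, .nR, .q0, .len] : List Reg).all (fun x => !c.writesReg x) &&
  ([.pow, .delta, .final, .owner, .lhs, .start, .sym, .alpha] : List Arr).all
    (fun a => !c.writesArr a)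

/-! ### Setup, and the formulas of symbols and sentential forms -/

section

variable {N T Q : Type} [Fintype N] [Fintype T] [Fintype Q] {G : Grammar N T} {A : NFA T Q}
variable {P : Presentation G Q} {q₀ : Q} {α : List (N ⊕ T)} {σ : Store}

/-- The input is in place and `setup` has been executed. -/
structure Env (P : Presentation G Q) (A : NFA T Q) (q₀ : Q) (α : List (N ⊕ T)) (σ : Store) :
    Prop where
  ctx : Ctx Q σ
  idb_lt : σ.reg .idb < numBoxes Q
  boxOf_idb : P.boxOf (σ.reg .idb) = boxId Q
  reg : ∀ x ∈ ([.nN, .nR, .q0, .len] : List Reg), σ.reg x = (P.input A q₀ α).reg x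
  arr : ∀ a ∈ ([.delta, .final, .owner, .lhs, .start, .sym, .alpha] : List Arr),
    σ.arr a = (P.input A q₀ α).arr a

theorem Env.frame {c : Cmd} {τ : Store} (h : Env P A q₀ α σ) (f : Frame c σ τ)
    (hc : c.preserves = true := by first | decide | rfl) : Env P A q₀ α τ := by
  simp only [Cmd.preserves, Bool.and_eq_true, List.all_eq_true, Bool.not_eq_true'] at hc
  obtain ⟨hr, ha⟩ := hc
  have hidb : τ.reg .idb = σ.reg .idb := f.reg_eq _ (hr _ (by simp))
  refine ⟨h.ctx.frame f ?_, hidb ▸ h.idb_lt, hidb ▸ h.boxOf_idb, fun x hx => ?_, fun a ha' => ?_⟩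
  · rw [hr .nQ (by simp), hr .sq (by simp), hr .k (by simp), hr .M (by simp), ha .pow (by simp)]
    rfl
  · rw [f.reg_eq x (hr x (by simp at hx ⊢; tauto)), h.reg x hx]
  · rw [f.arr_eq a (ha a (by simp at ha' ⊢; tauto)), h.arr a ha']

/-- Exponentials are obtained by doubling. The first pass yields `2 ^ sq = k`; the second extends
the same table far enough to read off `M = 2 ^ k`. -/
theorem double_spec {M n : ℕ} {y : Reg} (hy : σ.reg y = n) (hn : n ≤ M)
    (h0 : σ.arr .pow 0 = 1) (hyi : y ≠ .i) :
    Spec M σ (forTo .i (.reg y) (.store .pow (.add (.reg .i) (.lit 1))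
      (.add (.read .pow (.reg .i)) (.read .pow (.reg .i)))))
      (fun τ => ∀ i ≤ n, τ.arr .pow i = 2 ^ i) := by
  refine Spec.forReg n hn hy (fun i τ => ∀ j ≤ i, τ.arr .pow j = 2 ^ j) (by simpa using h0) ?_
    (fun _ _ h => h) rfl (by simpa [forTo, Cmd.writesReg] using hyi)
  intro i hi τ f hx h
  refine Spec.store ?_
  intro j hj
  simp only [Store.setReg_arr, Store.setArr_arr_self, Expr.eval, hx, Function.update_apply,
    h i le_rfl]
  split_ifs with h1
  · rw [h1]; ring
  · exact h j (by omega)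

theorem setup_spec (hσ : σ = P.input A q₀ α) :
    Spec (numClauses Q) σ setup (Env P A q₀ α) := by
  have hQ : σ.reg .nQ = Fintype.card Q := by rw [hσ]; rfl
  have hreg : ∀ {τ : Store}, Frame setup σ τ → ∀ x ∈ ([.nN, .nR, .q0, .len] : List Reg),
      τ.reg x = (P.input A q₀ α).reg x := by
    intro τ f x hx
    rw [f.reg_eq x (by revert hx; cases x <;> decide), hσ]
  have harr : ∀ {τ : Store}, Frame setup σ τ → ∀ a ∈
      ([.delta, .final, .owner, .lhs, .start, .sym, .alpha] : List Arr),
      τ.arr a = (P.input A q₀ α).arr a := by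
    intro τ f a ha
    rw [f.arr_eq a (by revert ha; cases a <;> decide), hσ]
  refine Spec.conseq (R := fun τ => Ctx Q τ ∧ τ.reg .idb < numBoxes Q ∧
    P.boxOf (τ.reg .idb) = boxId Q) ?_
    fun τ f h => ⟨h.1, h.2.1, h.2.2, hreg f, harr f⟩
  clear hreg harr
  refine Spec.seq (mulTo_spec card_le_numClauses (u := Fintype.card Q)
    (fun τ f => (f.reg .nQ).trans hQ) (fun τ f => (f.reg .nQ).trans hQ) (by decide)) ?_
  intro σ₁ f₁ hsq
  refine Spec.store_seq fun σ₂ f₂ hpow => ?_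
  replace hQ := (f₂.reg .nQ).trans ((f₁.reg .nQ).trans hQ)
  replace hsq := (f₂.reg .sq).trans hsq
  replace hpow : σ₂.arr .pow 0 = 1 := by simp [hpow, Expr.eval]
  clear f₁ f₂
  refine Spec.seq (double_spec hsq
    (card_mul_card_lt_numBoxes.le.trans numBoxes_lt_numClauses.le) hpow (by decide)) ?_
  intro σ₃ f₃ hpow₃
  refine Spec.set_seq fun σ₄ f₄ hk => ?_
  replace hQ := (f₄.reg .nQ).trans ((f₃.reg .nQ).trans hQ)
  replace hsq₃ := (f₃.reg .sq).trans hsq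
  replace hsq := (f₄.reg .sq).trans hsq₃
  replace hk : σ₄.reg .k = numBoxes Q := by
    rw [hk, Expr.eval, Expr.eval, hsq₃, hpow₃ _ le_rfl]
  replace hpow : σ₄.arr .pow 0 = 1 := by rw [f₄.arr .pow, hpow₃ _ (Nat.zero_le _)]; rfl
  clear f₃ f₄ hpow₃
  refine Spec.seq (double_spec hk numBoxes_lt_numClauses.le hpow (by decide)) ?_
  intro σ₅ f₅ hpow₅
  refine Spec.set_seq fun σ₆ f₆ hM => ?_
  have hC₆ : Ctx Q σ₆ := by
    have hk₅ := (f₅.reg .k).trans hk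
    refine ⟨(f₆.reg .nQ).trans ((f₅.reg .nQ).trans hQ), (f₆.reg .sq).trans ((f₅.reg .sq).trans hsq),
      (f₆.reg .k).trans hk₅, ?_, fun i hi => ?_⟩
    · rw [hM, Expr.eval, Expr.eval, hk₅, hpow₅ _ le_rfl]
    · rw [f₆.arr .pow, hpow₅ i hi]
  refine Spec.set_seq fun σ₇ f₇ hidb => Spec.set_seq fun σ₈ f₈ hrow => ?_
  have hC₈ := (hC₆.frame f₇).frame f₈
  refine Spec.forReg (Fintype.card Q) card_le_numClauses hC₈.nQ
    (fun i τ => τ.reg .row1 = i * Fintype.card Q ∧ τ.reg .idb < numBoxes Q ∧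
      P.boxOf (τ.reg .idb) = {x | (P.eQ x.1 : ℕ) < i ∧ x.1 = x.2}) ?_ ?_ ?_
  · simp [Store.setReg_reg, Expr.eval, hrow, f₈.reg .idb, hidb, P.boxOf_zero]
  · rintro i hi τ f hp1 ⟨h1, h2, h3⟩
    obtain ⟨p, rfl⟩ := P.exists_state hi
    have hC := hC₈.frame f
    have hlt : (P.eQ p : ℕ) * Fintype.card Q + P.eQ p < Fintype.card Q * Fintype.card Q :=
      row_add_lt (P.eQ p).2 (P.eQ p).2
    refine Spec.set_seq fun τ₁ f₁ h => Spec.set ?_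
    simp only [Expr.eval, h1, hp1, hC.pow _ (hlt.le.trans card_mul_card_lt_numBoxes.le)] at h
    simp only [Store.setReg_reg, reduceCtorEq, if_false, if_true, Expr.eval, (hC.frame f₁).nQ, h,
      f₁.reg .row1, h1, add_mul, one_mul, true_and]
    refine ⟨Nat.or_lt_two_pow h2 (Nat.pow_lt_pow_right (by norm_num) hlt), ?_⟩
    rw [P.boxOf_or, h3, P.boxOf_two_pow (P.eQ p).2]
    ext ⟨x, y⟩
    simp only [Set.mem_union, Set.mem_ofPred_eq, Nat.lt_succ_iff_lt_or_eq, P.state_inj]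
    constructor
    · rintro (⟨h5, rfl⟩ | ⟨rfl, rfl⟩)
      · exact ⟨.inl h5, rfl⟩
      · exact ⟨.inr rfl, rfl⟩
    · rintro ⟨h5 | rfl, rfl⟩
      · exact .inl ⟨h5, rfl⟩
      · exact .inr ⟨rfl, rfl⟩
  · rintro τ f ⟨-, h2, h3⟩
    exact ⟨hC₈.frame f, h2, h3.trans (by ext; simp [boxId])⟩

theorem input_delta (a : T) (p p' : Q) :
    (P.input A q₀ α).arr .delta (P.eT a * (Fintype.card Q * Fintype.card Q) +
      (P.eQ p * Fintype.card Q + P.eQ p')) ≠ 0 ↔ p' ∈ A.step p a := by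
  have hidx : ((P.eT a : ℕ) * (Fintype.card Q * Fintype.card Q) +
      (P.eQ p * Fintype.card Q + P.eQ p')) =
      ((P.eT a : ℕ) * Fintype.card Q + P.eQ p) * Fintype.card Q + P.eQ p' := by ring
  rw [hidx]
  simp only [Presentation.input, ne_eq, ite_eq_right_iff, one_ne_zero, imp_false, not_not]
  constructor
  · rintro ⟨b, r, r', h, he⟩
    obtain ⟨h1, h2⟩ := (row_add_inj (P.eQ p').2 (P.eQ r').2).1 he
    obtain ⟨h3, h4⟩ := (row_add_inj (P.eQ p).2 (P.eQ r).2).1 h1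
    rw [P.state_inj] at h2 h4
    rw [← Fin.ext_iff, P.eT.injective.eq_iff] at h3
    subst h2; subst h3; subst h4; exact h
  · exact fun h => ⟨a, p, p', h, rfl⟩

theorem symCmd_spec (hE : Env P A q₀ α σ) {v : N → CNF Q}
    (hv : ∀ X, P.Holds (σ.arr .cur) (P.eN X * numClauses Q) (v X)) {s : N ⊕ T}
    (hs : σ.reg .s = P.symCode s) :
    Spec (numClauses Q) σ symCmd (fun τ => P.Holds (τ.arr .arg) 0 (symFormula A v s)) := by
  have hnN : σ.reg .nN = Fintype.card N := hE.reg .nN (by simp)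
  have hcond : (Expr.lt (.reg .s) (.reg .nN)).eval σ ≠ 0 ↔ P.symCode s < Fintype.card N := by
    simp [Expr.eval, hs, hnN]
  refine Spec.ite (fun h => ?_) fun h => ?_
  · rw [hcond] at h
    cases s with
    | inr a => simp [Presentation.symCode] at h
    | inl X =>
      refine Spec.seq (mulTo_spec (u := P.eN X) (v := numClauses Q) le_rfl
        (fun τ f => (f.reg .s).trans hs) (fun τ f => (f.reg .M).trans hE.ctx.M) (by decide)) ?_
      intro σ₁ f₁ hbase
      refine loadArr_spec (hE.ctx.frame f₁) (by decide) ?_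
      rw [hbase, f₁.arr .cur]
      exact hv X
  · have h := mt hcond.2 (not_not.2 h)
    cases s with
    | inl X => exact absurd (P.eN X).2 h
    | inr a =>
      refine Spec.seq (clearArr_spec (P := P) hE.ctx .arg) fun σ₁ f₁ harg => ?_
      have hs' : σ.reg .s - σ.reg .nN = P.eT a := by simp [hs, hnN, Presentation.symCode]
      have hC₁ := hE.ctx.frame f₁
      refine Spec.seq (mulTo_spec (u := P.eT a) (v := Fintype.card Q * Fintype.card Q)
        (card_mul_card_lt_numBoxes.le.trans numBoxes_lt_numClauses.le)
        (fun τ f => by simp only [Expr.eval, f.reg .s, f.reg .nN, f₁.reg .s, f₁.reg .nN, hs'])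
        (fun τ f => (f.reg .sq).trans hC₁.sq) (by decide)) ?_
      intro σ₂ f₂ hptr
      refine Spec.set_seq fun σ₃ f₃ hbx => ?_
      have hE₃ := ((hE.frame f₁).frame f₂).frame f₃
      rw [← f₃.reg .ptr] at hptr
      rw [← f₂.arr .arg, ← f₃.arr .arg] at harg
      clear f₁ f₂ f₃
      refine Spec.seq (R' := fun τ => τ.reg .bx < numBoxes Q ∧
        P.boxOf (τ.reg .bx) = letterBox A a) (Spec.forReg (Fintype.card Q * Fintype.card Q)
        (card_mul_card_lt_numBoxes.le.trans numBoxes_lt_numClauses.le) hE₃.ctx.sq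
        -- Bit `j` of the box under construction copies cell `j` of the block of the letter in the
        -- transition table. Both use the same row-major order of pairs.
        (fun i τ => τ.reg .bx < numBoxes Q ∧ ∀ j, (τ.reg .bx).testBit j = true ↔
          j < i ∧ σ₃.arr .delta (σ₃.reg .ptr + j) ≠ 0) ?_ ?_ ?_) ?_
      · simp [Store.setReg_reg, hbx, Expr.eval]
      · rintro i hi τ f hx ⟨h1, h2⟩
        have hdelta : (Expr.read .delta (.add (.reg .ptr) (.reg .i))).eval τ =
            σ₃.arr .delta (σ₃.reg .ptr + i) := by
          simp only [Expr.eval, f.reg .ptr, f.arr .delta, hx]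
        refine Spec.when (fun h => Spec.set ?_) fun h => ?_
        · rw [hdelta] at h
          simp only [Store.setReg_reg, reduceCtorEq, if_false, if_true, Expr.eval, hx,
            (hE₃.ctx.frame f).pow i (hi.le.trans card_mul_card_lt_numBoxes.le)]
          refine ⟨Nat.or_lt_two_pow h1 (Nat.pow_lt_pow_right (by norm_num) hi), fun j => ?_⟩
          rw [Nat.testBit_or, Bool.or_eq_true, h2, Nat.testBit_two_pow, decide_eq_true_eq,
            Nat.lt_succ_iff_lt_or_eq]
          constructor
          · rintro (⟨h3, h4⟩ | rfl)
            · exact ⟨.inl h3, h4⟩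
            · exact ⟨.inr rfl, h⟩
          · rintro ⟨h3 | rfl, h4⟩
            · exact .inl ⟨h3, h4⟩
            · exact .inr rfl
        · rw [hdelta] at h
          simp only [Store.setReg_reg, reduceCtorEq, if_false]
          refine ⟨h1, fun j => ?_⟩
          rw [h2, Nat.lt_succ_iff_lt_or_eq]
          constructor
          · exact fun ⟨h3, h4⟩ => ⟨.inl h3, h4⟩
          · rintro ⟨h3 | rfl, h4⟩
            · exact ⟨h3, h4⟩
            · exact absurd h h4
      · rintro τ f ⟨h1, h2⟩
        refine ⟨h1, ?_⟩
        ext ⟨p, p'⟩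
        rw [P.mem_boxOf, h2, hptr, hE₃.arr .delta (by simp), input_delta]
        simp only [letterBox, Set.mem_ofPred_eq, and_iff_right_iff_imp]
        exact fun _ => row_add_lt (P.eQ p).2 (P.eQ p').2
      · rintro τ f ⟨h1, h2⟩
        refine Spec.store ?_
        have := harg.insert' (c := 2 ^ τ.reg .bx) (Nat.pow_lt_pow_right (by norm_num) h1)
        rw [P.clauseOf_two_pow h1, h2] at this
        simpa [Expr.eval, (hE₃.ctx.frame f).pow _ h1.le, f.arr .arg, symFormula] using this

/-- The number of rounds is the length of the form, which `M` does not bound; hence a `Triple` with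
an explicit factor instead of a `Spec`. The invariant follows the prefixes `l.take i`, as in the
left fold. -/
theorem formCmd_spec (hE : Env P A q₀ α σ) {v : N → CNF Q}
    (hv : ∀ X, P.Holds (σ.arr .cur) (P.eN X * numClauses Q) (v X)) {a : Arr}
    (ha : (formCmd a).writesArr a = false) {l : List (N ⊕ T)}
    (hl : ∀ (i : ℕ) (h : i < l.length), σ.arr a (σ.reg .j + i) = P.symCode l[i])
    (hhi : σ.reg .hi = σ.reg .j + l.length) :
    Triple σ (formCmd a) ((l.length + 1) * (formCmd a).bound (numClauses Q))
      (fun τ => P.Holds (τ.arr .acc) 0 (formFormula A v l)) := by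
  refine Triple.conseq (Triple.seq (clearArr_spec (P := P) hE.ctx .acc) fun σ₁ f₁ hacc =>
    Triple.seq (R' := fun τ => P.Holds (τ.arr .acc) 0 (formFormula A v []))
      (Triple.store ?_) fun σ₂ f₂ hacc₂ => Triple.loop l.length
        (fun i τ => τ.reg .j = σ.reg .j + i ∧
          P.Holds (τ.arr .acc) 0 (formFormula A v (l.take i))) ?_
        (b := fun _ => Cmd.bound (numClauses Q) (.set .s (.read a (.reg .j)) ;; symCmd ;;
          compCmd ;; .set .j (.add (.reg .j) (.lit 1)))) ?_ ?_)
    ?_ fun τ f h => by simpa using h.2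
  · have := hacc.insert' (c := 2 ^ σ.reg .idb) (Nat.pow_lt_pow_right (by norm_num) hE.idb_lt)
    rw [P.clauseOf_two_pow hE.idb_lt, hE.boxOf_idb] at this
    simpa [Expr.eval, f₁.reg .idb, f₁.arr .pow, hE.ctx.pow _ hE.idb_lt.le, formFormula] using this
  · exact ⟨(f₂.reg .j).trans (f₁.reg .j), by simpa using hacc₂⟩
  · rintro i hi τ f ⟨hj, hacc⟩
    have hE₃ := ((hE.frame f₁).frame f₂).frame f
    have hhi₃ : τ.reg .hi = σ.reg .j + l.length :=
      (f.reg .hi).trans ((f₂.reg .hi).trans ((f₁.reg .hi).trans hhi))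
    have hcur : τ.arr .cur = σ.arr .cur :=
      (f.arr .cur).trans ((f₂.arr .cur).trans (f₁.arr .cur))
    have hanacc : a ≠ .acc := by rintro rfl; revert ha; decide
    have harr : τ.arr a = σ.arr a := by
      simp only [formCmd, Cmd.writesArr, Bool.or_eq_false_iff] at ha
      rw [f.arr_eq a (by simp [Cmd.writesArr, ha]), f₂.arr_eq a (by simp [Cmd.writesArr, hanacc]),
        f₁.arr_eq a ha.1]
    refine ⟨by simp [Expr.eval, hj, hhi₃, hi], ?_⟩
    refine Spec.set_seq (M := numClauses Q) fun τ₁ g₁ hs => ?_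
    have hs : τ₁.reg .s = P.symCode l[i] := by rw [hs, Expr.eval, Expr.eval, harr, hj, hl]
    refine Spec.seq (symCmd_spec (hE₃.frame g₁) (v := v) (fun X => ?_) hs) ?_
    · rw [g₁.arr .cur, hcur]; exact hv X
    · intro τ₂ g₂ harg
      refine Spec.seq (compCmd_spec (P := P) ((hE₃.frame g₁).frame g₂).ctx
        (F := formFormula A v (l.take i)) ?_ harg) ?_
      · rwa [g₂.arr .acc, g₁.arr .acc]
      · intro τ₃ g₃ hacc₃
        refine Spec.set ?_
        refine ⟨?_, ?_⟩
        · simp [Expr.eval, g₃.reg .j, g₂.reg .j, g₁.reg .j, hj, add_assoc]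
        · rw [List.take_succ_eq_append_getElem hi, formFormula_append_singleton]
          exact hacc₃
  · rintro τ f ⟨hj, -⟩
    have hhi₃ : τ.reg .hi = σ.reg .j + l.length :=
      (f.reg .hi).trans ((f₂.reg .hi).trans ((f₁.reg .hi).trans hhi))
    simp [Expr.eval, hj, hhi₃]
  · rw [Finset.sum_const, Finset.card_range, smul_eq_mul, add_mul]
    have hM : 1 ≤ numClauses Q := Nat.one_le_two_pow
    simp only [formCmd, Cmd.bound]
    generalize Cmd.bound (numClauses Q) symCmd = b₁
    generalize Cmd.bound (numClauses Q) compCmd = b₂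
    generalize Cmd.bound (numClauses Q) (clearArr .acc) = b₃
    simp only [Expr.cost, one_mul, Nat.reduceAdd]
    generalize 3 + (b₁ + (b₂ + 4)) + 3 + 1 = b₄
    -- `Cmd.bound` charges `M` rounds to the loop, and `M ≥ 1`, so one copy of it pays for each
    -- actual round.
    have h : b₄ ≤ numClauses Q * b₄ := Nat.le_mul_of_pos_left b₄ hM
    have h' := Nat.mul_le_mul_left l.length
      (show b₄ ≤ b₃ + (4 + (numClauses Q * b₄ + 3 + 1)) by omega)
    omega

end

/-- Every clause of `F'` has a subset in `F`. -/
def Subsumes {Q : Type} (F F' : CNF Q) : Prop := ∀ H ∈ F', ∃ K ∈ F, K ⊆ H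

/-- If no clause of `F` is contained in `H`, each one has a box outside `H`, so making exactly the
boxes outside `H` true satisfies `F` and falsifies `H`. This turns implication into a comparison of
clauses. -/
theorem subsumes_iff {Q : Type} (F F' : CNF Q) :
    Subsumes F F' ↔ ∀ ν, Sat ν F → Sat ν F' := by
  constructor
  · intro h ν hF H hH
    obtain ⟨K, hK, hKH⟩ := h H hH
    obtain ⟨ρ, h1, h2⟩ := hF K hK
    exact ⟨ρ, hKH h1, h2⟩
  · intro h H hH
    by_contra! hc
    have : Sat Hᶜ F := fun K hK => by
      obtain ⟨ρ, h1, h2⟩ := Set.not_subset.1 (hc K hK)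
      exact ⟨ρ, h1, h2⟩
    obtain ⟨ρ, h1, h2⟩ := h _ this H hH
    exact h2 h1

theorem cnfEquiv_iff {Q : Type} (F F' : CNF Q) :
    CNFEquiv F F' ↔ Subsumes F F' ∧ Subsumes F' F := by
  rw [subsumes_iff, subsumes_iff]
  exact ⟨fun h => ⟨fun ν => (h ν).1, fun ν => (h ν).2⟩, fun h ν => ⟨h.1 ν, h.2 ν⟩⟩

/-! ### The tests for equivalence and rejection -/

section

variable {N T Q : Type} [Fintype N] [Fintype T] [Fintype Q] {G : Grammar N T} {A : NFA T Q}
variable {P : Presentation G Q} {q₀ : Q} {α : List (N ⊕ T)} {σ : Store}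

/-- The command only ever resets `conv`, so its effect is stated relative to the old value, and
several tests accumulate. -/
theorem impliesCmd_spec (hC : Ctx Q σ) {a b : Arr} {F F' : CNF Q}
    (hF : P.Holds (σ.arr a) (σ.reg .base) F) (hF' : P.Holds (σ.arr b) (σ.reg .base) F') :
    Spec (numClauses Q) σ (impliesCmd a b)
      (fun τ => τ.reg .conv = 0 ↔ (σ.reg .conv = 0 ∨ ¬ Subsumes F F')) := by
  refine forClauses_spec (P := P) F' hC ?_
    (fun S τ => τ.reg .conv = 0 ↔ (σ.reg .conv = 0 ∨ ¬ Subsumes F S))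
    (fun _ _ _ h => by simpa [Store.setReg_reg] using h) (by simp [Subsumes]) ?_ fun _ _ h => h
  · rintro τ i f rfl hi
    have hbase : τ.reg .base = σ.reg .base := f.reg .base rfl
    have harr : τ.arr b = σ.arr b := f.arr_eq b rfl
    simpa [Expr.eval, hbase, harr] using hF'.ne_zero_iff hi
  · rintro H - S τ f hlt rfl hconv
    have hbase : τ.reg .base = σ.reg .base := f.reg .base rfl
    have harr : τ.arr a = σ.arr a := f.arr_eq a rfl
    refine Spec.set_seq fun τ₁ f₁ hfnd => ?_
    refine Spec.seq (forClauses_spec (P := P) F ((hC.frame f).frame f₁) ?_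
      (fun S υ => υ.reg .fnd ≠ 0 ↔ ∃ K ∈ S, K ⊆ P.clauseOf (τ.reg .H))
      (fun _ _ _ h => by simpa [Store.setReg_reg] using h) (by simp [hfnd, Expr.eval]) ?_
      fun _ _ h => h) ?_
    · rintro υ i f' rfl hi
      have hbase' : υ.reg .base = τ.reg .base := (f'.reg .base rfl).trans (f₁.reg .base)
      have harr' : υ.arr a = τ.arr a := (f'.arr_eq a rfl).trans (f₁.arr_eq a rfl)
      simpa [Expr.eval, hbase, harr, hbase', harr'] using hF.ne_zero_iff hi
    · rintro K - S' υ f' hlt' rfl h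
      have hH : υ.reg .H = τ.reg .H := (f'.reg .H rfl).trans (f₁.reg .H)
      have hcond : (Expr.eq (.lor (.reg .K) (.reg .H)) (.reg .H)).eval υ ≠ 0 ↔
          P.clauseOf (υ.reg .K) ⊆ P.clauseOf (τ.reg .H) := by
        rw [P.clauseOf_subset hlt' hlt]
        simp [Expr.eval, hH]
      refine Spec.when (fun h1 => Spec.set ?_) fun h1 => ?_
      · rw [hcond] at h1
        simp [Expr.eval, h1]
      · have h1 := mt hcond.2 (not_not.2 h1)
        simp [h, h1]
    · intro υ f' h
      have hconv' : υ.reg .conv = τ.reg .conv := (f'.reg .conv rfl).trans (f₁.reg .conv)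
      have hins : Subsumes F (insert (P.clauseOf (τ.reg .H)) S) ↔
          υ.reg .fnd ≠ 0 ∧ Subsumes F S := by
        rw [h]; simp [Subsumes]
      refine Spec.ite (fun h1 => Spec.skip ?_) fun h1 => Spec.set ?_
      · have h1 : υ.reg .fnd ≠ 0 := h1
        rw [hconv', hconv, hins]
        simp [h1]
      · have h1 : υ.reg .fnd = 0 := h1
        rw [hins]
        simp [Expr.eval, h1]

theorem input_final (p : Q) : (P.input A q₀ α).arr .final (P.eQ p) ≠ 0 ↔ p ∈ A.accept := by
  simp only [Presentation.input, ne_eq, ite_eq_right_iff, one_ne_zero, imp_false, not_not]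
  constructor
  · rintro ⟨r, h, he⟩
    rw [P.state_inj] at he
    exact he ▸ h
  · exact fun h => ⟨p, h, rfl⟩

/-- As `q₀` is the only initial state, a box is rejecting iff row `q₀` of it has no final state; the
inner loop scans just this row. -/
theorem rejectCmd_spec (hE : Env P A q₀ α σ) (hA : A.start = {q₀}) {F : CNF Q}
    (hF : P.Holds (σ.arr .acc) 0 F) :
    Spec (numClauses Q) σ rejectCmd (fun τ => (Rejecting A F → τ.reg .out = 1) ∧
      (¬ Rejecting A F → τ.reg .out = 0)) := by
  have hq₀ : σ.reg .q0 = P.eQ q₀ := hE.reg .q0 (by simp)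
  refine Spec.seq (mulTo_spec (u := P.eQ q₀) (v := Fintype.card Q) card_le_numClauses
    (fun τ f => (f.reg .q0).trans hq₀) (fun τ f => (f.reg .nQ).trans hE.ctx.nQ) (by decide)) ?_
  intro σ₁ f₁ hrow
  refine Spec.set_seq fun σ₂ f₂ hout => ?_
  replace hE := (hE.frame f₁).frame f₂
  rw [← f₂.reg .row1] at hrow
  rw [← f₁.arr .acc, ← f₂.arr .acc] at hF
  clear hq₀ f₁ f₂
  refine forClauses_spec (P := P) F hE.ctx ?_
    (fun S τ => (Rejecting A S → τ.reg .out = 1) ∧ (¬ Rejecting A S → τ.reg .out = 0))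
    (fun _ _ _ h => by simpa [Store.setReg_reg] using h)
    (by simp [Rejecting, Sat, hout, Expr.eval]) ?_ fun _ _ h => h
  · rintro τ i f rfl hi
    simpa [Expr.eval, f.arr .acc] using hF.ne_zero_iff' hi
  rintro K - S τ f hlt rfl hS
  refine Spec.set_seq fun τ₁ f₁ hfnd => ?_
  have hE₁ := (hE.frame f).frame f₁
  have hrow₁ : τ₁.reg .row1 = P.eQ q₀ * Fintype.card Q :=
    (f₁.reg .row1).trans ((f.reg .row1).trans hrow)
  refine Spec.seq (forBoxes_spec (P := P) hE₁.ctx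
    (fun S υ => υ.reg .fnd ≠ 0 ↔
      ∃ ρ ∈ S, ρ ∈ {ρ : Box Q | ∀ q ∈ A.start, ∀ f ∈ A.accept, (q, f) ∉ ρ})
    (fun _ _ _ h => by simpa [Store.setReg_reg] using h) (by simp [hfnd, Expr.eval]) ?_
    fun _ _ h => h) ?_
  · rintro ρ S' - υ g hρ rfl hS'
    refine Spec.set_seq fun υ₁ g₁ hbad => ?_
    have hE₂ := (hE₁.frame g).frame g₁
    have hrow₂ : υ₁.reg .row1 = P.eQ q₀ * Fintype.card Q :=
      (g₁.reg .row1).trans ((g.reg .row1).trans hrow₁)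
    refine Spec.seq (R' := fun ω => ω.reg .bad ≠ 0 ↔
      ∃ p ∈ A.accept, (q₀, p) ∈ P.boxOf (υ.reg .rho)) (Spec.forReg (Fintype.card Q)
      card_le_numClauses hE₂.ctx.nQ (fun i ω => ω.reg .bad ≠ 0 ↔
        ∃ p, (P.eQ p : ℕ) < i ∧ p ∈ A.accept ∧ (q₀, p) ∈ P.boxOf (υ.reg .rho)) ?_ ?_ ?_) ?_
    · simp [Store.setReg_reg, hbad, Expr.eval]
    · rintro i hi ω g₂ hp1 h
      obtain ⟨p, rfl⟩ := P.exists_state hi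
      have hfin : (Expr.read .final (.reg .p1)).eval ω ≠ 0 ↔ p ∈ A.accept := by
        rw [← input_final (P := P) (A := A) (q₀ := q₀) (α := α), ← hE₂.arr .final (by simp),
          ← g₂.arr .final, ← hp1]
        rfl
      have hbit : (Expr.bit (.reg .rho) (.add (.reg .row1) (.reg .p1))).eval ω ≠ 0 ↔
          (q₀, p) ∈ P.boxOf (υ.reg .rho) := by
        simp [Expr.eval, g₂.reg .rho, g₁.reg .rho, g₂.reg .row1, hrow₂, hp1,
          Presentation.mem_boxOf]
      have hsucc : (∃ r, (P.eQ r : ℕ) < P.eQ p + 1 ∧ r ∈ A.accept ∧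
          (q₀, r) ∈ P.boxOf (υ.reg .rho)) ↔ (p ∈ A.accept ∧ (q₀, p) ∈ P.boxOf (υ.reg .rho)) ∨
          ∃ r, (P.eQ r : ℕ) < P.eQ p ∧ r ∈ A.accept ∧ (q₀, r) ∈ P.boxOf (υ.reg .rho) := by
        simp only [Nat.lt_succ_iff_lt_or_eq, P.state_inj]
        constructor
        · rintro ⟨r, h1 | rfl, h2⟩
          · exact .inr ⟨r, h1, h2⟩
          · exact .inl h2
        · rintro (h1 | ⟨r, h1, h2⟩)
          · exact ⟨p, .inr rfl, h1⟩
          · exact ⟨r, .inl h1, h2⟩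
      simp only [hsucc]
      refine Spec.when (fun h1 => Spec.when (fun h2 => Spec.set ?_) fun h2 => ?_) fun h1 => ?_
      · simp [Store.setReg_reg, Expr.eval, hfin.1 h1, hbit.1 h2]
      · have h2 := mt hbit.2 (not_not.2 h2)
        simpa [Store.setReg_reg, h2] using h
      · have h1 := mt hfin.2 (not_not.2 h1)
        simpa [Store.setReg_reg, h1] using h
    · rintro ω g₂ h
      rw [h]; simp
    · intro ω g₂ h
      have hfnd' : ω.reg .fnd = υ.reg .fnd := (g₂.reg .fnd).trans (g₁.reg .fnd)
      have hins : (∃ ρ ∈ insert (P.boxOf (υ.reg .rho)) S',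
          ρ ∈ {ρ : Box Q | ∀ q ∈ A.start, ∀ f ∈ A.accept, (q, f) ∉ ρ}) ↔
          ω.reg .bad = 0 ∨ υ.reg .fnd ≠ 0 := by
        rw [hS', ← not_ne_iff (a := ω.reg .bad), h]
        simp [hA]
      rw [hins]
      refine Spec.ite (fun h1 => Spec.skip ?_) fun h1 => Spec.set ?_
      · have h1 : ω.reg .bad ≠ 0 := h1
        simp [hfnd', h1]
      · have h1 : ω.reg .bad = 0 := h1
        simp [Expr.eval, h1]
  · intro υ g h
    have hout' : υ.reg .out = τ.reg .out := (g.reg .out).trans (f₁.reg .out)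
    rw [f₁.reg .K] at h
    have hins : Rejecting A (insert (P.clauseOf (τ.reg .K)) S) ↔
        υ.reg .fnd ≠ 0 ∧ Rejecting A S := by
      rw [h]
      simp only [Rejecting, Sat, Set.mem_insert_iff, forall_eq_or_imp]
    rw [hins]
    refine Spec.ite (fun h1 => Spec.skip ?_) fun h1 => Spec.set ?_
    · have h1 : υ.reg .fnd ≠ 0 := h1
      simpa [h1, hout'] using hS
    · have h1 : υ.reg .fnd = 0 := h1
      simp [Expr.eval, h1]

end

/-- A loop of `n` rounds whose body stays within the time bound for loops of at most `M` rounds. -/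
theorem Triple.forReg {M : ℕ} {σ : Store} {c : Cmd} {R : Store → Prop} {x y : Reg} (hM : 1 ≤ M)
    (n : ℕ) (hy : σ.reg y = n) (Inv : ℕ → Store → Prop) (h0 : Inv 0 (σ.setReg x 0))
    (hs : ∀ i < n, ∀ τ, Frame (InclusionGame.forTo x (.reg y) c) σ τ → τ.reg x = i → Inv i τ →
      Spec M τ c (fun υ => Inv (i + 1) (υ.setReg x (i + 1))))
    (hR : ∀ τ, Frame (InclusionGame.forTo x (.reg y) c) σ τ → Inv n τ → R τ)
    (hx : c.writesReg x = false := by first | decide | rfl)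
    (hyx : (InclusionGame.forTo x (.reg y) c).writesReg y = false := by first | decide | rfl) :
    Triple σ (InclusionGame.forTo x (.reg y) c)
      ((n + 1) * (InclusionGame.forTo x (.reg y) c).bound M) R := by
  refine Triple.conseq (Triple.forTo n hx (fun _ hf => (hf.reg_eq y hyx).trans hy) Inv h0 hs) ?_ hR
  rw [Finset.sum_const, Finset.card_range, smul_eq_mul, add_mul]
  simp only [InclusionGame.forTo, Cmd.bound, Expr.cost, one_mul, Nat.reduceAdd]
  have h1 : c.bound M + 4 + 3 + 1 = c.bound M + 8 := rfl
  simp only [h1]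
  generalize c.bound M + 8 = b
  have h : b ≤ M * b := Nat.le_mul_of_pos_left b hM
  have h' := Nat.mul_le_mul_left n (show b ≤ 2 + (M * b + 3 + 1) by omega)
  omega

/-- The equations restricted to a set of rules. -/
def equationsOn {N T Q : Type} (G : Grammar N T) (A : NFA T Q) (R : Set (N × List (N ⊕ T)))
    (v : N → CNF Q) (X : N) : CNF Q :=
  match G.own X with
  | .prover => cnfConj {η | (X, η) ∈ R} (formFormula A v)
  | .refuter => cnfDisj {η | (X, η) ∈ R} (formFormula A v)

theorem equationsOn_rules {N T Q : Type} (G : Grammar N T) (A : NFA T Q) (v : N → CNF Q) (X : N) :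
    equationsOn G A {r | r ∈ G.rules} v X = equations G A v X := rfl

theorem equationsOn_congr {N T Q : Type} {G : Grammar N T} {A : NFA T Q}
    {R R' : Set (N × List (N ⊕ T))} {v : N → CNF Q} {X : N}
    (h : ∀ η, (X, η) ∈ R ↔ (X, η) ∈ R') : equationsOn G A R v X = equationsOn G A R' v X := by
  simp only [equationsOn, h]

/-- The empty disjunction is `false`, which explains why the table of a refuter's non-terminal
starts with a `1` in cell `0`. -/
theorem cnfDisj_empty {Q I : Type} (F : I → CNF Q) : cnfDisj ∅ F = {∅} := by
  ext C
  simp only [cnfDisj, Set.mem_ofPred_eq, Set.mem_singleton_iff]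
  exact ⟨fun ⟨z, _, h⟩ => by simpa using h, fun h => ⟨fun _ => ∅, by simp, by simpa using h⟩⟩

/-- The analogue of `clauseComp_insert`. Freshness of `i` is guaranteed in the program because the
list of rules has no repetitions. -/
theorem cnfDisj_insert {Q I : Type} {S : Set I} {i : I} (hi : i ∉ S) (F : I → CNF Q) :
    cnfDisj (insert i S) F = Set.image2 (· ∪ ·) (cnfDisj S F) (F i) := by
  classical
  ext C
  simp only [Set.mem_image2, cnfDisj, Set.mem_ofPred_eq]
  constructor
  · rintro ⟨c, hc, rfl⟩
    refine ⟨_, ⟨c, fun j h => hc j (.inr h), rfl⟩, _, hc i (.inl rfl), ?_⟩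
    rw [Set.biUnion_insert, Set.union_comm]
  · rintro ⟨_, ⟨c, hc, rfl⟩, H, hH, rfl⟩
    refine ⟨Function.update c i H, ?_, ?_⟩
    · rintro j (rfl | h)
      · simpa using hH
      · rw [Function.update_of_ne (ne_of_mem_of_not_mem h hi)]
        exact hc j h
    · rw [Set.biUnion_insert, Set.union_comm, Function.update_self]
      congr 1
      refine Set.iUnion₂_congr fun j h => ?_
      rw [Function.update_of_ne (ne_of_mem_of_not_mem h hi)]

theorem equationsOn_insert_prover {N T Q : Type} {G : Grammar N T} (A : NFA T Q)
    {R : Set (N × List (N ⊕ T))} (v : N → CNF Q) {X : N} {η : List (N ⊕ T)}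
    (hX : G.own X = .prover) :
    equationsOn G A (insert (X, η) R) v X = equationsOn G A R v X ∪ formFormula A v η := by
  have : {η' | (X, η') ∈ insert (X, η) R} = insert η {η' | (X, η') ∈ R} := by ext; simp
  simp only [equationsOn, hX, this, cnfConj, Set.biUnion_insert, Set.union_comm]

theorem equationsOn_insert_refuter {N T Q : Type} {G : Grammar N T} (A : NFA T Q)
    {R : Set (N × List (N ⊕ T))} (v : N → CNF Q) {X : N} {η : List (N ⊕ T)}
    (hX : G.own X = .refuter) (hη : (X, η) ∉ R) :
    equationsOn G A (insert (X, η) R) v X =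
      Set.image2 (· ∪ ·) (equationsOn G A R v X) (formFormula A v η) := by
  have : {η' | (X, η') ∈ insert (X, η) R} = insert η {η' | (X, η') ∈ R} := by ext; simp
  simp only [equationsOn, hX, this]
  exact cnfDisj_insert (S := {η' | (X, η') ∈ R}) hη _

/-- Locates a symbol of the rule number `r` in the concatenation of all right-hand sides. -/
theorem getElem?_flatMap {β γ : Type} {l : List β} {f : β → List γ} {r i : ℕ}
    (hr : r < l.length) (hi : i < (f l[r]).length) :
    (l.flatMap f)[((l.take r).flatMap f).length + i]? = (f l[r])[i]? := by
  have : l.flatMap f = (l.take r).flatMap f ++ (f l[r] ++ (l.drop (r + 1)).flatMap f) := by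
    rw [← List.flatMap_cons, ← List.flatMap_append, ← List.drop_eq_getElem_cons hr,
      List.take_append_drop]
  rw [this, List.getElem?_append_right (by omega), Nat.add_sub_cancel_left,
    List.getElem?_append_left hi]

/-! ### Tables of several non-terminals in one array, and the layout of the input -/

section

variable {N T Q : Type} [Fintype N] [Fintype T] [Fintype Q] {G : Grammar N T} {A : NFA T Q}
variable {P : Presentation G Q} {q₀ : Q} {α : List (N ⊕ T)} {σ : Store}

theorem one_le_numClauses : 1 ≤ numClauses Q := Nat.one_le_two_pow

theorem Presentation.exists_nonterminal (P : Presentation G Q) {i : ℕ}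
    (hi : i < Fintype.card N) : ∃ X, (P.eN X : ℕ) = i :=
  ⟨P.eN.symm ⟨i, hi⟩, by simp⟩

theorem Presentation.nonterminal_inj (P : Presentation G Q) {X Y : N} :
    (P.eN X : ℕ) = P.eN Y ↔ X = Y := by
  rw [← Fin.ext_iff, P.eN.injective.eq_iff]

/-- Different non-terminals own disjoint blocks of length `M`, so writing one block leaves the
tables in the others intact. -/
theorem Presentation.Holds.of_outside {a b : ℕ → ℕ} {i j base : ℕ} {F : CNF Q}
    (h : P.Holds a (i * numClauses Q) F) (hij : i ≠ j) (hbase : base = j * numClauses Q)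
    (hab : ∀ c, ¬ (base ≤ c ∧ c < base + numClauses Q) → b c = a c) :
    P.Holds b (i * numClauses Q) F := by
  refine h.congr fun c hc => hab _ ?_
  rw [hbase]
  rintro ⟨h1, h2⟩
  rcases Nat.lt_or_gt_of_ne hij with h3 | h3
  · have := Nat.mul_le_mul_right (numClauses Q) (Nat.succ_le_of_lt h3)
    rw [Nat.succ_mul] at this
    omega
  · have := Nat.mul_le_mul_right (numClauses Q) (Nat.succ_le_of_lt h3)
    rw [Nat.succ_mul] at this
    omega

theorem initCmd_spec (hE : Env P A q₀ α σ) :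
    Triple σ initCmd ((Fintype.card N + 1) * initCmd.bound (numClauses Q))
      (fun τ => ∀ X : N, P.Holds (τ.arr .cur) (P.eN X * numClauses Q) (cnfFalse Q)) := by
  refine Triple.conseq (Triple.seq (R' := fun τ => τ.reg .base = 0) (Triple.set (by simp [Expr.eval]))
    fun σ₁ f₁ hbase => Triple.forReg (one_le_numClauses (Q := Q)) (Fintype.card N)
      ((f₁.reg .nN).trans (hE.reg .nN (by simp))) (fun i τ => τ.reg .base = i * numClauses Q ∧
        ∀ X : N, (P.eN X : ℕ) < i → P.Holds (τ.arr .cur) (P.eN X * numClauses Q) (cnfFalse Q))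
      ?_ ?_ fun _ _ h => h) ?_ fun τ _ h X => h.2 X (P.eN X).2
  · simpa [Store.setReg_reg] using hbase
  · rintro i hi τ f - ⟨hb, h⟩
    have hC := (hE.ctx.frame f₁).frame f
    obtain ⟨X, rfl⟩ := P.exists_nonterminal hi
    refine Spec.seq (fill_spec hC (v := fun _ => 0) fun _ _ _ _ => rfl) ?_
    rintro τ₁ g₁ ⟨h1, h2⟩
    refine Spec.store_seq fun τ₂ g₂ h3 => Spec.set ?_
    have hb₁ := (g₁.reg .base).trans hb
    have hb₂ := (g₂.reg .base).trans hb₁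
    simp only [Expr.eval, hb₁] at h3
    rw [hb] at h1 h2
    refine ⟨by simp [Store.setReg_reg, Expr.eval, hb₂, ((hC.frame g₁).frame g₂).M, add_mul], ?_⟩
    intro Y hY
    simp only [Store.setReg_arr]
    rw [h3]
    rcases Nat.lt_succ_iff_lt_or_eq.1 hY with hY | hY
    · refine (h Y hY).of_outside hY.ne rfl fun c hc => ?_
      rw [Function.update_of_ne (by have := one_le_numClauses (Q := Q); omega)]
      exact h2 c hc
    · rw [hY]
      -- The zeroed block is the empty formula; setting its first cell adds the clause with code
      -- `0`, the empty one.
      have h4 : P.Holds (τ₁.arr .cur) (P.eN X * numClauses Q) ∅ := fun c hc => by simp [h1 c hc]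
      have h5 := h4.insert (c := 0) one_le_numClauses
      rw [P.clauseOf_zero] at h5
      simpa [cnfFalse] using h5
  · simp only [initCmd, Cmd.bound]
    nlinarith [Nat.zero_le (Fintype.card N)]

theorem input_owner (X : N) : (P.input A q₀ α).arr .owner (P.eN X) ≠ 0 ↔ G.own X = .prover := by
  simp only [Presentation.input, ne_eq, ite_eq_right_iff, one_ne_zero, imp_false, not_not]
  constructor
  · rintro ⟨Y, h, he⟩
    rw [P.nonterminal_inj] at he
    exact he ▸ h
  · exact fun h => ⟨X, h, rfl⟩

theorem input_lhs {r : ℕ} (hr : r < P.prods.length) :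
    (P.input A q₀ α).arr .lhs r = P.eN P.prods[r].1 := by
  simp [Presentation.input, hr]

theorem input_start_succ {r : ℕ} (hr : r < P.prods.length) :
    (P.input A q₀ α).arr .start (r + 1) =
      (P.input A q₀ α).arr .start r + P.prods[r].2.length := by
  change ((P.prods.take (r + 1)).map fun r => r.2.length).sum =
    ((P.prods.take r).map fun r => r.2.length).sum + P.prods[r].2.length
  rw [List.take_succ_eq_append_getElem hr, List.map_append, List.sum_append]
  simp

theorem input_sym {r : ℕ} (hr : r < P.prods.length) (i : ℕ) (hi : i < P.prods[r].2.length) :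
    (P.input A q₀ α).arr .sym ((P.input A q₀ α).arr .start r + i) =
      P.symCode P.prods[r].2[i] := by
  have hlen : (P.input A q₀ α).arr .start r =
      ((P.prods.take r).flatMap fun r => r.2).length := by
    simp only [Presentation.input, List.length_flatMap]
  rw [hlen]
  simp only [Presentation.input, List.getD_eq_getElem?_getD, List.getElem?_map]
  rw [getElem?_flatMap (f := fun r : N × List (N ⊕ T) => r.2) hr hi]
  simp [hi]

theorem input_alpha (i : ℕ) (hi : i < α.length) :
    (P.input A q₀ α).arr .alpha i = P.symCode α[i] := by
  simp [Presentation.input, hi]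

end

/-- The part of `equationsCmd` that starts with the empty conjunctions and disjunctions. -/
def equationsInitCmd : Cmd :=
  forTo .X (.reg .nN) (
    forTo .i (.reg .M) (.store .nxt (.add (.reg .base) (.reg .i)) (.lit 0)) ;;
    .ite (.read .owner (.reg .X)) .skip (.store .nxt (.reg .base) (.lit 1)) ;;
    .set .base (.add (.reg .base) (.reg .M)))

/-- The part of `equationsCmd` that adds the value of a right-hand side to an equation. -/
def addRuleCmd : Cmd :=
  copyArr .arg .acc ;;
  .set .X (.read .lhs (.reg .r)) ;;
  mulTo .base (.reg .X) (.reg .M) ;;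
  loadArr .acc .nxt ;;
  .ite (.read .owner (.reg .X)) conjCmd disjCmd ;;
  saveArr .nxt .acc

/-- The part of `equationsCmd` that deals with one rule. -/
def ruleCmd : Cmd :=
  .set .j (.read .start (.reg .r)) ;;
  .set .hi (.read .start (.add (.reg .r) (.lit 1))) ;;
  formCmd .sym ;;
  addRuleCmd

/-- Every non-terminal has a rule, and each rule counts at least one. Loops over the non-terminals
are thereby paid for by `|G|`. -/
theorem Grammar.card_le_size {N T : Type} [Fintype N] (G : Grammar N T) : Fintype.card N ≤ G.size := by
  classical
  have h1 : Fintype.card N ≤ G.rules.card := by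
    refine Finset.card_le_card_of_surjOn (s := G.rules) (t := Finset.univ) Prod.fst ?_
    intro X _
    obtain ⟨η, h⟩ := G.exists_rule X
    exact ⟨(X, η), h, rfl⟩
  refine h1.trans ?_
  rw [Grammar.size, Finset.card_eq_sum_ones]
  exact Finset.sum_le_sum fun r _ => by omega

theorem sum_range_getD (l : List ℕ) : ∑ i ∈ Finset.range l.length, l.getD i 0 = l.sum := by
  induction l with
  | nil => rfl
  | cons a l ih => rw [List.length_cons, Finset.sum_range_succ', List.sum_cons, ← ih, add_comm]; rfl

/-! ### One round of the Kleene iteration -/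

section

variable {N T Q : Type} [Fintype N] [Fintype T] [Fintype Q] {G : Grammar N T} {A : NFA T Q}
variable {P : Presentation G Q} {q₀ : Q} {α : List (N ⊕ T)} {σ : Store}

/-- Without rules, prover's conjunction has no clause and refuter's disjunction only the empty
clause. -/
theorem equationsInitCmd_spec (hE : Env P A q₀ α σ) (hbase : σ.reg .base = 0) (v : N → CNF Q) :
    Triple σ equationsInitCmd ((Fintype.card N + 1) * equationsInitCmd.bound (numClauses Q))
      (fun τ => ∀ X : N, P.Holds (τ.arr .nxt) (P.eN X * numClauses Q)
        (equationsOn G A ∅ v X)) := by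
  refine Triple.forReg (one_le_numClauses (Q := Q)) (Fintype.card N)
      (hE.reg .nN (by simp)) (fun i τ => τ.reg .base = i * numClauses Q ∧
        ∀ X : N, (P.eN X : ℕ) < i → P.Holds (τ.arr .nxt) (P.eN X * numClauses Q)
          (equationsOn G A ∅ v X))
      ?_ ?_ fun τ _ h X => h.2 X (P.eN X).2
  · simpa [Store.setReg_reg] using hbase
  · rintro i hi τ f hX ⟨hb, h⟩
    have hC := hE.ctx.frame f
    obtain ⟨X, rfl⟩ := P.exists_nonterminal hi
    refine Spec.seq (fill_spec hC (v := fun _ => 0) fun _ _ _ _ => rfl) ?_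
    rintro τ₁ g₁ ⟨h1, h2⟩
    have hb₁ := (g₁.reg .base).trans hb
    rw [hb] at h1 h2
    have hown : (Expr.read .owner (.reg .X)).eval τ₁ ≠ 0 ↔ G.own X = .prover := by
      rw [← input_owner (P := P) (A := A) (q₀ := q₀) (α := α) X, ← hE.arr .owner (by simp)]
      simp only [Expr.eval, g₁.arr .owner, f.arr .owner, g₁.reg .X, hX]
    have h4 : P.Holds (τ₁.arr .nxt) (P.eN X * numClauses Q) ∅ := fun c hc => by simp [h1 c hc]
    refine Spec.seq (R' := fun τ₂ => P.Holds (τ₂.arr .nxt) (P.eN X * numClauses Q)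
      (equationsOn G A ∅ v X) ∧ ∀ c, ¬ (P.eN X * numClauses Q ≤ c ∧
        c < P.eN X * numClauses Q + numClauses Q) → τ₂.arr .nxt c = τ.arr .nxt c)
      (Spec.ite (fun h3 => Spec.skip ?_) fun h3 => Spec.store ?_) ?_
    · rw [hown] at h3
      refine ⟨?_, h2⟩
      simpa [equationsOn, h3, cnfConj] using h4
    · have h3 : G.own X = .refuter := by
        have := mt hown.2 (not_not.2 h3)
        cases hx : G.own X
        · rfl
        · exact absurd hx this
      simp only [Expr.eval, hb₁, Store.setArr_arr_self]
      refine ⟨?_, fun c hc => ?_⟩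
      · have h5 := h4.insert (c := 0) one_le_numClauses
        rw [P.clauseOf_zero] at h5
        simpa [equationsOn, h3, cnfDisj_empty] using h5
      · rw [Function.update_of_ne (by have := one_le_numClauses (Q := Q); omega)]
        exact h2 c hc
    · rintro τ₂ g₂ ⟨h5, h6⟩
      refine Spec.set ⟨?_, fun Y hY => ?_⟩
      · simp [Store.setReg_reg, Expr.eval, g₂.reg .base, hb₁, ((hC.frame g₁).frame g₂).M, add_mul]
      · simp only [Store.setReg_arr]
        rcases Nat.lt_succ_iff_lt_or_eq.1 hY with hY | hY
        · exact (h Y hY).of_outside hY.ne rfl h6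
        · rw [P.nonterminal_inj] at hY
          exact hY ▸ h5

/-- The hypothesis that the rule is new matters for refuter only, through
`equationsOn_insert_refuter`; conjunction is idempotent on sets of clauses. -/
theorem addRuleCmd_spec (hE : Env P A q₀ α σ) {v : N → CNF Q} {r : ℕ} (hr : r < P.prods.length)
    (hσ : σ.reg .r = r) (hacc : P.Holds (σ.arr .acc) 0 (formFormula A v P.prods[r].2))
    {R : Set (N × List (N ⊕ T))} (hR : P.prods[r] ∉ R)
    (hnxt : ∀ X : N, P.Holds (σ.arr .nxt) (P.eN X * numClauses Q) (equationsOn G A R v X)) :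
    Spec (numClauses Q) σ addRuleCmd (fun τ => ∀ X : N,
      P.Holds (τ.arr .nxt) (P.eN X * numClauses Q)
        (equationsOn G A (insert P.prods[r] R) v X)) := by
  generalize hρ : P.prods[r] = ρ at hacc hR ⊢
  obtain ⟨X, η⟩ := ρ
  refine Spec.seq (copyArr_holds (P := P) hE.ctx (by decide) hacc) fun σ₁ f₁ harg => ?_
  refine Spec.set_seq fun σ₂ f₂ hX => ?_
  have hE₂ := (hE.frame f₁).frame f₂
  replace hX : σ₂.reg .X = P.eN X := by
    rw [hX]
    simp only [Expr.eval, f₁.arr .lhs, f₁.reg .r, hσ, hE.arr .lhs (by simp), input_lhs hr, hρ]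
  rw [← f₂.arr .arg] at harg
  rw [← f₁.arr .nxt, ← f₂.arr .nxt] at hnxt
  clear f₁ f₂
  refine Spec.seq (mulTo_spec (u := P.eN X) (v := numClauses Q) le_rfl
    (fun τ f => (f.reg .X).trans hX) (fun τ f => (f.reg .M).trans hE₂.ctx.M) (by decide)) ?_
  intro σ₃ f₃ hbase
  have hE₃ := hE₂.frame f₃
  rw [← f₃.arr .arg] at harg
  rw [← f₃.arr .nxt] at hnxt
  rw [← f₃.reg .X] at hX
  clear f₃
  refine Spec.seq (loadArr_spec (P := P) hE₃.ctx (F := equationsOn G A R v X) (by decide)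
    (by rw [hbase]; exact hnxt X)) ?_
  intro σ₄ f₄ hacc
  have hE₄ := hE₃.frame f₄
  rw [← f₄.arr .arg] at harg
  rw [← f₄.arr .nxt] at hnxt
  rw [← f₄.reg .X] at hX
  rw [← f₄.reg .base] at hbase
  clear f₄
  have hown : (Expr.read .owner (.reg .X)).eval σ₄ ≠ 0 ↔ G.own X = .prover := by
    rw [← input_owner (P := P) (A := A) (q₀ := q₀) (α := α) X, ← hE₄.arr .owner (by simp)]
    simp only [Expr.eval, hX]
  refine Spec.seq (R' := fun τ => P.Holds (τ.arr .acc) 0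
    (equationsOn G A (insert (X, η) R) v X))
    (Spec.ite (fun h3 => ?_) fun h3 => ?_) ?_
  · rw [hown] at h3
    rw [equationsOn_insert_prover A v h3]
    exact conjCmd_spec hE₄.ctx hacc harg
  · have h3 : G.own X = .refuter := by
      have := mt hown.2 (not_not.2 h3)
      cases hx : G.own X
      · rfl
      · exact absurd hx this
    rw [equationsOn_insert_refuter A v h3 hR]
    exact disjCmd_spec hE₄.ctx hacc harg
  · intro σ₅ f₅ hacc₅
    refine (saveArr_spec (hE₄.frame f₅).ctx (by decide)).conseq ?_
    rintro τ - ⟨h1, h2⟩ Y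
    have hb : σ₅.reg .base = P.eN X * numClauses Q := (f₅.reg .base).trans hbase
    rw [f₅.arr .nxt] at h2
    by_cases hY : Y = X
    · subst hY
      refine hacc₅.congr fun c hc => ?_
      rw [← hb, h1 c hc, zero_add]
    · have : equationsOn G A (insert (X, η) R) v Y = equationsOn G A R v Y :=
        equationsOn_congr (by simp [hY])
      rw [this]
      exact (hnxt Y).of_outside (fun h => hY (P.nonterminal_inj.1 h)) hb h2

theorem ruleCmd_spec (hE : Env P A q₀ α σ) {v : N → CNF Q}
    (hv : ∀ X, P.Holds (σ.arr .cur) (P.eN X * numClauses Q) (v X)) {r : ℕ}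
    (hr : r < P.prods.length) (hσ : σ.reg .r = r)
    {R : Set (N × List (N ⊕ T))} (hR : P.prods[r] ∉ R)
    (hnxt : ∀ X : N, P.Holds (σ.arr .nxt) (P.eN X * numClauses Q) (equationsOn G A R v X)) :
    Triple σ ruleCmd ((P.prods[r].2.length + 1) * ruleCmd.bound (numClauses Q))
      (fun τ => ∀ X : N, P.Holds (τ.arr .nxt) (P.eN X * numClauses Q)
        (equationsOn G A (insert P.prods[r] R) v X)) := by
  refine Triple.conseq (Triple.seq (R' := fun τ => τ.reg .j = (P.input A q₀ α).arr .start r)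
    (Triple.set ?_) fun σ₁ f₁ hj => Triple.seq
    (R' := fun τ => τ.reg .hi = (P.input A q₀ α).arr .start r + P.prods[r].2.length)
    (Triple.set ?_) fun σ₂ f₂ hhi => Triple.seq (formCmd_spec ((hE.frame f₁).frame f₂) (v := v)
      ?_ rfl ?_ ?_) fun σ₃ f₃ hacc => addRuleCmd_spec (((hE.frame f₁).frame f₂).frame f₃) hr
        ?_ hacc hR ?_) ?_ fun _ _ h => h
  · simp [Expr.eval, hσ, hE.arr .start]
  · simp [Expr.eval, f₁.reg .r, hσ, (hE.frame f₁).arr .start, input_start_succ hr]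
  · rw [f₂.arr .cur, f₁.arr .cur]; exact hv
  · intro i hi
    rw [f₂.reg .j, hj, ((hE.frame f₁).frame f₂).arr .sym (by simp), input_sym hr i hi]
  · rw [hhi, f₂.reg .j, hj]
  · rw [f₃.reg .r, f₂.reg .r, f₁.reg .r, hσ]
  · rw [f₃.arr .nxt, f₂.arr .nxt, f₁.arr .nxt]; exact hnxt
  · simp only [ruleCmd, Cmd.bound]
    generalize Cmd.bound (numClauses Q) (formCmd .sym) = b₁
    generalize Cmd.bound (numClauses Q) addRuleCmd = b₂
    generalize P.prods[r].2.length = n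
    simp only [Expr.cost]
    nlinarith [Nat.zero_le (n * b₂), Nat.zero_le n]

theorem Presentation.mem_take_succ (P : Presentation G Q) {r : ℕ} (hr : r < P.prods.length) :
    {x | x ∈ P.prods.take (r + 1)} = insert P.prods[r] {x | x ∈ P.prods.take r} := by
  ext x
  change x ∈ P.prods.take (r + 1) ↔ x = P.prods[r] ∨ x ∈ P.prods.take r
  rw [List.take_succ_eq_append_getElem hr, List.mem_append, List.mem_singleton, or_comm]

theorem Presentation.notMem_take (P : Presentation G Q) {r : ℕ} (hr : r < P.prods.length) :
    P.prods[r] ∉ {x | x ∈ P.prods.take r} := by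
  intro h
  have h1 : (P.prods.take (r + 1)).Nodup := P.nodup.sublist (List.take_sublist _ _)
  rw [List.take_succ_eq_append_getElem hr, List.nodup_append] at h1
  exact h1.2.2 _ h _ (by simp) rfl

theorem Presentation.size_eq (P : Presentation G Q) :
    (P.prods.map fun r => r.2.length + 1).sum = G.size := by
  classical
  have : G.rules = P.prods.toFinset := by ext; simp [P.mem_prods]
  rw [Grammar.size, this, List.sum_toFinset _ P.nodup]
  simp [add_comm]

/-- Rule by rule, the equations for the processed rules are extended by one rule. The time is linear
in `|G|` because the costs of the rules are added up individually instead of being estimated by the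
longest one. -/
theorem equationsCmd_spec (hE : Env P A q₀ α σ) {v : N → CNF Q}
    (hv : ∀ X, P.Holds (σ.arr .cur) (P.eN X * numClauses Q) (v X)) :
    Triple σ equationsCmd ((G.size + 1) * equationsCmd.bound (numClauses Q))
      (fun τ => ∀ X : N, P.Holds (τ.arr .nxt) (P.eN X * numClauses Q) (equations G A v X)) := by
  refine Triple.conseq (Triple.seq (R' := fun τ => τ.reg .base = 0)
    (Triple.set (by simp [Expr.eval])) fun σ₁ f₁ hbase =>
    Triple.seq (equationsInitCmd_spec (hE.frame f₁) hbase v) fun σ₂ f₂ hnxt =>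
      Triple.forTo (c := ruleCmd) (e := .reg .nR) P.prods.length (by decide)
        (fun τ f => (f.reg .nR).trans (((hE.frame f₁).frame f₂).reg .nR (by simp)))
        (fun i τ => ∀ X : N, P.Holds (τ.arr .nxt) (P.eN X * numClauses Q)
          (equationsOn G A {x | x ∈ P.prods.take i} v X))
        -- The rule number `r`, with right-hand side `η`, is charged `|η| + 1`; these charges sum to
        -- `|G|` by `Presentation.size_eq`.
        (b := fun r => ((P.prods.map fun r => r.2.length + 1).getD r 0) *
          ruleCmd.bound (numClauses Q)) ?_ ?_) ?_ ?_
  · intro X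
    have : {x | x ∈ P.prods.take 0} = (∅ : Set (N × List (N ⊕ T))) := by ext; simp
    rw [this]
    exact hnxt X
  · intro r hr τ f hτ h
    rw [P.mem_take_succ hr]
    refine (ruleCmd_spec (((hE.frame f₁).frame f₂).frame f) ?_ hr hτ (P.notMem_take hr) h).conseq
      ?_ fun _ _ h => h
    · rw [f.arr .cur, f₂.arr .cur, f₁.arr .cur]; exact hv
    · simp [hr]
  · have hsum : ∑ i ∈ Finset.range P.prods.length,
        ((P.prods.map fun r => r.2.length + 1).getD i 0) = G.size := by
      rw [← P.size_eq, ← sum_range_getD, List.length_map]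
    have hlen : P.prods.length ≤ G.size := by
      rw [← P.size_eq]
      simp
    have hN := G.card_le_size
    simp only [Finset.sum_add_distrib, ← Finset.sum_mul, hsum, Finset.sum_const,
      Finset.card_range, smul_eq_mul]
    have hb : equationsCmd.bound (numClauses Q) = 2 +
      (equationsInitCmd.bound (numClauses Q) +
        (2 + (numClauses Q * (ruleCmd.bound (numClauses Q) + 4 + 3 + 1) + 3 + 1))) := rfl
    rw [hb]
    have hM := one_le_numClauses (Q := Q)
    generalize equationsInitCmd.bound (numClauses Q) = b₁
    generalize ruleCmd.bound (numClauses Q) = b₂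
    have h1 : b₂ + 8 ≤ numClauses Q * (b₂ + 4 + 3 + 1) := Nat.le_mul_of_pos_left _ hM
    have h2 := Nat.mul_le_mul_left (G.size + 1) h1
    have h3 := Nat.mul_le_mul_right b₁ hN
    simp only [Expr.cost]
    nlinarith
  · intro τ _ h X
    rw [← equationsOn_rules, ← equationsOn_congr (R := {x | x ∈ P.prods.take P.prods.length})]
    · exact h X
    · simp [P.mem_prods]

theorem compareCmd_spec (hE : Env P A q₀ α σ) {v w : N → CNF Q}
    (hv : ∀ X, P.Holds (σ.arr .cur) (P.eN X * numClauses Q) (v X))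
    (hw : ∀ X, P.Holds (σ.arr .nxt) (P.eN X * numClauses Q) (w X)) :
    Triple σ compareCmd ((Fintype.card N + 1) * compareCmd.bound (numClauses Q))
      (fun τ => (∀ X : N, P.Holds (τ.arr .cur) (P.eN X * numClauses Q) (w X)) ∧
        (τ.reg .conv = 0 ↔ ∃ X, ¬ CNFEquiv (w X) (v X))) := by
  refine Triple.conseq (Triple.seq (R' := fun τ => τ.reg .conv = 1)
    (Triple.set (by simp [Expr.eval])) fun σ₁ f₁ hconv =>
    Triple.seq (R' := fun τ => τ.reg .base = 0)
    (Triple.set (by simp [Expr.eval])) fun σ₂ f₂ hbase =>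
    Triple.forReg (one_le_numClauses (Q := Q)) (Fintype.card N)
      (((hE.frame f₁).frame f₂).reg .nN (by simp)) (fun i τ => τ.reg .base = i * numClauses Q ∧
        -- The new values replace the old ones block by block; each block is compared before it is
        -- overwritten, so the old value is still there when needed.
        (∀ X : N, P.Holds (τ.arr .cur) (P.eN X * numClauses Q)
          (if (P.eN X : ℕ) < i then w X else v X)) ∧
        (τ.reg .conv = 0 ↔ ∃ X, (P.eN X : ℕ) < i ∧ ¬ CNFEquiv (w X) (v X)))
      ?_ ?_ fun _ _ h => h) ?_ ?_
  · refine ⟨by simpa [Store.setReg_reg] using hbase, fun X => ?_, ?_⟩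
    · simpa [f₂.arr .cur, f₁.arr .cur] using hv X
    · simp [Store.setReg_reg, f₂.reg .conv, hconv]
  · rintro i hi τ f - ⟨hb, h, hc⟩
    have hC := ((hE.frame f₁).frame f₂).ctx.frame f
    obtain ⟨X, rfl⟩ := P.exists_nonterminal hi
    have hnxt : P.Holds (τ.arr .nxt) (P.eN X * numClauses Q) (w X) := by
      rw [f.arr .nxt, f₂.arr .nxt, f₁.arr .nxt]; exact hw X
    have hcur : P.Holds (τ.arr .cur) (P.eN X * numClauses Q) (v X) := by simpa using h X
    refine Spec.seq (impliesCmd_spec (P := P) hC (F := v X) (F' := w X) (by rwa [hb])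
      (by rwa [hb])) fun τ₁ g₁ h₁ => ?_
    have hb₁ := (g₁.reg .base).trans hb
    refine Spec.seq (impliesCmd_spec (P := P) (hC.frame g₁) (F := w X) (F' := v X)
      (by rwa [hb₁, g₁.arr .nxt]) (by rwa [hb₁, g₁.arr .cur])) fun τ₂ g₂ h₂ => ?_
    have hb₂ := (g₂.reg .base).trans hb₁
    refine Spec.seq (fill_spec ((hC.frame g₁).frame g₂)
      (v := fun c => τ₂.arr .nxt (P.eN X * numClauses Q + c)) ?_) ?_
    · intro υ i g hi
      simp only [Expr.eval, g.reg .base, g.arr .nxt, hi, hb₂]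
    · rintro τ₃ g₃ ⟨h3, h4⟩
      rw [hb₂] at h3 h4
      refine Spec.set ⟨?_, fun Y => ?_, ?_⟩
      · simp [Store.setReg_reg, Expr.eval, g₃.reg .base, hb₂,
          (((hC.frame g₁).frame g₂).frame g₃).M, add_mul]
      · simp only [Store.setReg_arr]
        by_cases hY : Y = X
        · subst hY
          rw [if_pos (by omega)]
          refine hnxt.congr fun c hc => ?_
          rw [h3 c hc, g₂.arr .nxt, g₁.arr .nxt]
        · have hne : (P.eN Y : ℕ) ≠ P.eN X := fun h => hY (P.nonterminal_inj.1 h)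
          have := h Y
          rw [← g₁.arr .cur, ← g₂.arr .cur] at this
          have h5 := this.of_outside hne rfl h4
          have h6 : ((P.eN Y : ℕ) < P.eN X + 1) ↔ (P.eN Y : ℕ) < P.eN X := by omega
          simpa only [h6] using h5
      · simp only [Store.setReg_reg, reduceCtorEq, if_false, Expr.eval, g₃.reg .conv, h₂, h₁, hc,
          Nat.lt_succ_iff_lt_or_eq, P.nonterminal_inj]
        constructor
        · rintro ((⟨Y, h5, h6⟩ | h5) | h5)
          · exact ⟨Y, .inl h5, h6⟩
          · exact ⟨X, .inr rfl, fun h => h5 ((cnfEquiv_iff _ _).1 h).2⟩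
          · exact ⟨X, .inr rfl, fun h => h5 ((cnfEquiv_iff _ _).1 h).1⟩
        · rintro ⟨Y, h5 | rfl, h6⟩
          · exact .inl (.inl ⟨Y, h5, h6⟩)
          · rw [cnfEquiv_iff, not_and_or] at h6
            rcases h6 with h6 | h6
            · exact .inr h6
            · exact .inl (.inr h6)
  · simp only [compareCmd, Cmd.bound]
    nlinarith [Nat.zero_le (Fintype.card N)]
  · rintro τ - ⟨-, h1, h2⟩
    exact ⟨fun X => by simpa using h1 X, by simpa using h2⟩

end

/-! ### The whole program and its running time -/

section

variable {N T Q : Type} [Fintype N] [Fintype T] [Fintype Q] {G : Grammar N T} {A : NFA T Q}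
variable {P : Presentation G Q} {q₀ : Q} {α : List (N ⊕ T)}

/-- The time is `n` rounds linear in `|G|`, one form of length `|α|`, and parts run once, which are
covered by generous increments of the factors. -/
theorem kleeneProgram_spec (P : Presentation G Q) (hA : A.start = {q₀}) (α : List (N ⊕ T)) {n : ℕ}
    (hn : StopsAt G A n) :
    Triple (P.input A q₀ α) kleeneProgram
      (((n + 1) * (G.size + 2) + (α.length + 1)) * kleeneProgram.bound (numClauses Q))
      (fun τ => (∀ X : N, P.Holds (τ.arr .cur) (P.eN X * numClauses Q) (approximant G A n X)) ∧
        P.Holds (τ.arr .acc) 0 (formFormula A (approximant G A n) α) ∧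
        (Rejecting A (formFormula A (approximant G A n) α) → τ.reg .out = 1) ∧
        (¬ Rejecting A (formFormula A (approximant G A n) α) → τ.reg .out = 0)) := by
  obtain ⟨⟨hn1, hn2⟩, hn3⟩ := hn
  refine Triple.conseq (Triple.seq (setup_spec (P := P) (A := A) (q₀ := q₀) (α := α) rfl)
    fun σ₁ _ hE₁ => Triple.seq (initCmd_spec hE₁) fun σ₂ f₂ hcur₂ =>
    Triple.seq (R' := fun τ => τ.reg .conv = 0) (Triple.set (by simp [Expr.eval]))
    fun σ₃ f₃ hconv₃ => Triple.seq (Triple.loop n (fun i τ =>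
      (∀ X : N, P.Holds (τ.arr .cur) (P.eN X * numClauses Q) (approximant G A i X)) ∧
      -- At `i = 0` the right side holds because of `1 ≤ i`, in accordance with a loop that is
      -- entered at least once.
      (τ.reg .conv = 0 ↔
        ¬ (1 ≤ i ∧ ∀ X, CNFEquiv (approximant G A i X) (approximant G A (i - 1) X))))
      (b := fun _ => (G.size + 1) * equationsCmd.bound (numClauses Q) +
        (Fintype.card N + 1) * compareCmd.bound (numClauses Q)) ?_ ?_ ?_)
    fun σ₄ f₄ h₄ => Triple.seq (R' := fun τ => τ.reg .j = 0) (Triple.set (by simp [Expr.eval]))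
    fun σ₅ f₅ hj₅ => Triple.seq (R' := fun τ => τ.reg .hi = α.length) (Triple.set ?_)
    fun σ₆ f₆ hhi₆ => Triple.seq (formCmd_spec (P := P) (A := A) (q₀ := q₀) (α := α)
      (v := approximant G A n) (l := α) ?_ ?_ rfl ?_ ?_)
    fun σ₇ f₇ hacc₇ => Triple.conseq
      (rejectCmd_spec (P := P) (q₀ := q₀) (α := α) ?_ hA hacc₇) le_rfl
      fun τ f h => ⟨?_, ?_, h⟩) ?_ fun _ _ h => h
  · refine ⟨fun X => ?_, by simp [hconv₃]⟩
    rw [f₃.arr .cur]; exact hcur₂ X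
  · rintro i hi τ f ⟨hcur, hconv⟩
    have hE := ((hE₁.frame f₂).frame f₃).frame f
    -- By minimality of `n` the test fails in all earlier stages, so the loop makes exactly `n`
    -- rounds.
    have hns : ¬ (1 ≤ i ∧ ∀ X, CNFEquiv (approximant G A i X) (approximant G A (i - 1) X)) :=
      fun h => absurd (hn3 h) (by omega)
    refine ⟨by simp [Expr.eval, hconv.2 hns], ?_⟩
    refine Triple.seq (equationsCmd_spec hE hcur) fun υ g hnxt => ?_
    refine (compareCmd_spec (hE.frame g) (v := approximant G A i) ?_ hnxt).conseq le_rfl ?_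
    · rw [g.arr .cur]; exact hcur
    · rintro ω - ⟨h1, h2⟩
      refine ⟨h1, h2.trans ?_⟩
      simp [approximant]
  · rintro τ f ⟨-, hconv⟩
    have : τ.reg .conv ≠ 0 := fun h => hconv.1 h ⟨hn1, hn2⟩
    simp [Expr.eval, this]
  · have hE₅ := (((hE₁.frame f₂).frame f₃).frame f₄).frame f₅
    exact hE₅.reg .len (by simp)
  · exact ((((hE₁.frame f₂).frame f₃).frame f₄).frame f₅).frame f₆
  · rw [f₆.arr .cur, f₅.arr .cur]; exact h₄.1
  · intro i hi
    have hE₆ := ((((hE₁.frame f₂).frame f₃).frame f₄).frame f₅).frame f₆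
    rw [f₆.reg .j, hj₅, zero_add, hE₆.arr .alpha (by simp), input_alpha i hi]
  · rw [hhi₆, f₆.reg .j, hj₅, zero_add]
  · exact (((((hE₁.frame f₂).frame f₃).frame f₄).frame f₅).frame f₆).frame f₇
  · have hb : kleeneProgram.bound (numClauses Q) = setup.bound (numClauses Q) +
      (initCmd.bound (numClauses Q) + (2 + (numClauses Q * (equationsCmd.bound (numClauses Q) +
        compareCmd.bound (numClauses Q) + 3 + 1) + 3 + 1 + (2 + (2 +
        ((formCmd .alpha).bound (numClauses Q) + rejectCmd.bound (numClauses Q))))))) := rfl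
    rw [hb, Finset.sum_const, Finset.card_range, smul_eq_mul]
    have hM := one_le_numClauses (Q := Q)
    have hN := G.card_le_size
    simp only [Expr.cost]
    generalize setup.bound (numClauses Q) = b₁
    generalize initCmd.bound (numClauses Q) = b₂
    generalize equationsCmd.bound (numClauses Q) = b₃
    generalize compareCmd.bound (numClauses Q) = b₄
    generalize (formCmd .alpha).bound (numClauses Q) = b₅
    generalize rejectCmd.bound (numClauses Q) = b₆
    -- The common factor `w` dominates the number of charges to every part except the final form, so
    -- the bounds can be compared part by part.
    obtain ⟨w, hw⟩ : ∃ w, w = (n + 1) * (G.size + 2) := ⟨_, rfl⟩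
    have hw' : G.size + 2 ≤ w := hw ▸ Nat.le_mul_of_pos_left _ (by omega)
    have h1 : b₁ ≤ w * b₁ := Nat.le_mul_of_pos_left _ (by omega)
    have h2 : (Fintype.card N + 1) * b₂ ≤ w * b₂ := Nat.mul_le_mul_right _ (by omega)
    have h3 : n * ((G.size + 1) * b₃ + (Fintype.card N + 1) * b₄ + (1 + 1 + 1) + 1) ≤
        w * (b₃ + b₄ + 3 + 1) := by
      rw [hw, mul_assoc]
      refine Nat.mul_le_mul (by omega) ?_
      have h3 : (G.size + 1) * b₃ ≤ (G.size + 2) * b₃ := Nat.mul_le_mul_right _ (by omega)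
      have h4 : (Fintype.card N + 1) * b₄ ≤ (G.size + 2) * b₄ :=
        Nat.mul_le_mul_right _ (by omega)
      linarith
    have h4 : b₃ + b₄ + 3 + 1 ≤ numClauses Q * (b₃ + b₄ + 3 + 1) :=
      Nat.le_mul_of_pos_left _ hM
    have h5 := Nat.mul_le_mul_left w h4
    have h6 : b₆ ≤ w * b₆ := Nat.le_mul_of_pos_left _ (by omega)
    rw [← hw, add_mul]
    generalize b₃ + b₄ + 3 + 1 = b₇ at *
    nlinarith [Nat.zero_le (w * b₅), Nat.zero_le (α.length * b₁), Nat.zero_le (α.length * b₂),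
      Nat.zero_le (α.length * b₆), Nat.zero_le (α.length * (numClauses Q * b₇))]
  · rw [f.arr .cur, f₇.arr .cur, f₆.arr .cur, f₅.arr .cur]; exact h₄.1
  · rwa [f.arr .acc]

/-- A power of the number of clauses is at most doubly exponential in a power of the number of
states. -/
theorem numClauses_pow_le [Nonempty Q] (d : ℕ) :
    numClauses Q ^ d ≤ 4 ^ d * 2 ^ 2 ^ (Fintype.card Q ^ (d + 2)) := by
  have hq : 0 < Fintype.card Q := Fintype.card_pos
  simp only [numClauses, numBoxes]
  generalize Fintype.card Q = q at hq
  -- For one state the powers of `|Q|` do not grow. There `M = 4`, which is what the factor `4 ^ d`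
  -- is for; from two states on this factor is not needed.
  rcases (Nat.succ_le_of_lt hq).eq_or_lt with rfl | hq2
  · exact Nat.le_mul_of_pos_right _ (Nat.two_pow_pos _)
  · refine le_trans ?_ (Nat.le_mul_of_pos_left _ (by positivity))
    rw [← pow_mul]
    refine Nat.pow_le_pow_right (by norm_num) ?_
    calc 2 ^ (q * q) * d ≤ 2 ^ (q * q) * 2 ^ d :=
          Nat.mul_le_mul_left _ Nat.lt_two_pow_self.le
      _ = 2 ^ (q * q + d) := (pow_add _ _ _).symm
      _ ≤ 2 ^ q ^ (d + 2) := Nat.pow_le_pow_right (by norm_num) ?_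
    have h1 : d + 1 ≤ q ^ d := (Nat.succ_le_of_lt Nat.lt_two_pow_self).trans
      (Nat.pow_le_pow_left (by omega) d)
    have h2 : 1 ≤ q * q := Nat.mul_pos hq hq
    calc q * q + d ≤ (d + 1) * (q * q) := by nlinarith
      _ ≤ q ^ d * (q * q) := Nat.mul_le_mul_right _ h1
      _ = q ^ (d + 2) := by ring

end

end InclusionGame

theorem mainTheorem7 :
    ∃ C c₁ c₂ : ℕ,
      ∀ (N T Q : Type) [Fintype N] [Fintype T] [Fintype Q]
        (G : Grammar N T) (A : NFA T Q) (q₀ : Q) (_ : A.start = {q₀})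
        (α : List (N ⊕ T)) (P : Presentation G Q),
        ∃ n : ℕ, StopsAt G A n ∧
          (Rejecting A (formFormula A (approximant G A n) α) ↔ RefuterWins G A α) ∧
          ∃ (σ : Store) (t : ℕ),
            Exec kleeneProgram (P.input A q₀ α) σ t ∧
            (∀ X : N, P.formulaOf (σ.arr .cur)
                ((P.eN X : ℕ) * 2 ^ 2 ^ (Fintype.card Q * Fintype.card Q)) =
              approximant G A n X) ∧
            P.formulaOf (σ.arr .acc) 0 = formFormula A (approximant G A n) α ∧
            (RefuterWins G A α → σ.reg .out = 1) ∧
            (¬ RefuterWins G A α → σ.reg .out = 0) ∧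
            (0 < G.size + α.length →
              t ≤ C * (G.size ^ 2 * 2 ^ 2 ^ (Fintype.card Q ^ c₁) +
                α.length * 2 ^ 2 ^ (Fintype.card Q ^ c₂))) := by
  obtain ⟨C, d, hCd⟩ := kleeneProgram.polyBounded_bound
  -- The program costs at most `C * M ^ d` per unit of the counting factor, and the number of rounds
  -- contributes one more `M`. Applying `numClauses_pow_le` to `d + 1` gives the exponent `d + 3`
  -- and the factor `4 ^ (d + 1)`; `11` comes from `hsize`.
  refine ⟨11 * C * 4 ^ (d + 1), d + 3, d + 3, ?_⟩
  intro N T Q _ _ _ G A q₀ hA α P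
  obtain ⟨n, hn, hle⟩ := exists_stopsAt G A
  have hwin := (rejecting_iff_win hn α).trans refuterWins_iff_win.symm
  obtain ⟨σ, t, hexec, ht, hcur, hacc, hout1, hout0⟩ := kleeneProgram_spec P hA α hn
  refine ⟨n, hn, hwin, σ, t, hexec, fun X => (hcur X).formulaOf_eq, hacc.formulaOf_eq,
    fun h => hout1 (hwin.2 h), fun h => hout0 (mt hwin.1 h), fun hpos => ht.trans ?_⟩
  have : Nonempty Q := ⟨q₀⟩
  have hM : 1 ≤ numClauses Q := one_le_numClauses
  have hpow := numClauses_pow_le (Q := Q) (d + 1)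
  rw [pow_succ] at hpow
  have hb : kleeneProgram.bound (numClauses Q) ≤ _ := hCd _ hM
  have hn' : n ≤ G.size * numClauses Q + 1 :=
    hle.trans (Nat.succ_le_succ (Nat.mul_le_mul_right _ G.card_le_size))
  generalize kleeneProgram.bound (numClauses Q) = b at hb
  have hn2 : n + 1 ≤ (G.size + 2) * numClauses Q := by nlinarith
  -- Additive constants are absorbed here, which requires a non-trivial input. The tightest case is
  -- `|G| = 1` with empty `α`, where the left side is 10.
  have hsize : (G.size + 2) * (G.size + 2) + (α.length + 1) ≤ 11 * (G.size ^ 2 + α.length) := by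
    rcases Nat.eq_zero_or_pos G.size with h | h
    · rw [h] at hpos ⊢
      omega
    · nlinarith
  have hfactor : (n + 1) * (G.size + 2) + (α.length + 1) ≤
      11 * (G.size ^ 2 + α.length) * numClauses Q := by
    refine le_trans ?_ (Nat.mul_le_mul_right _ hsize)
    rw [add_mul ((G.size + 2) * (G.size + 2))]
    refine add_le_add ((Nat.mul_le_mul_right _ hn2).trans_eq (mul_right_comm _ _ _)) ?_
    exact Nat.le_mul_of_pos_right _ hM
  calc ((n + 1) * (G.size + 2) + (α.length + 1)) * b
      ≤ 11 * (G.size ^ 2 + α.length) * numClauses Q * (C * numClauses Q ^ d) :=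
        Nat.mul_le_mul hfactor hb
    _ = 11 * (G.size ^ 2 + α.length) * (C * (numClauses Q ^ d * numClauses Q)) := by ring
    _ ≤ 11 * (G.size ^ 2 + α.length) *
          (C * (4 ^ (d + 1) * 2 ^ 2 ^ (Fintype.card Q ^ (d + 1 + 2)))) :=
        Nat.mul_le_mul_left _ (Nat.mul_le_mul_left _ hpow)
    _ = _ := by ring
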